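/- Let $n,r\ge 1$ be integers, $v$ an indeterminate, $\mathcal Z=\mathbb Z[v,v^{-1}]$. **Group and Hecke algebra.** Let $\mathfrak S_{\Delta,r}$ be the group of permutations $w$ of $\mathbb Z$ with $w(i+r)=w(i)+r$. For $i\not\equiv j \pmod r$ let $(i,j)\in\mathfrak S_{\Delta,r}$ interchange $i+tr$ and $j+tr$ for all $t\in\mathbb Z$ and fix all other integers; these are the reflections, and the $s_i=(i,i+1)$ are the simple reflections (none if $r=1$). Let $\rho(j)=j+1$, and let $\ell(w)$ be the least $k$ such that $w=\rho^a t_1\cdots t_k$ with $a\in\mathbb Z$ and simple reflections $t_1,\dots,t_k$. Write $y\le w$ (Bruhat order) if $w$ is obtained from $y$ by successive left multiplications by reflections, each increasing the length. Let $\mathcal H$ be the extended affine Hecke algebra: the unital $\mathcal Z$-algebra with basis $\{T_w\}_{w\in\mathfrak S_{\Delta,r}}$ and $T_s^2=(v^2-1)T_s+v^2$ for simple reflections $s$, $T_wT_{w'}=T_{ww'}$ if $\ell(ww')=\ell(w)+\ell(w')$. Its bar involution is the ring homomorphism with $\bar v=v^{-1}$, $\overline{T_w}=T_{w^{-1}}^{-1}$.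 Put $\widetilde T_w=v^{-\ell(w)}T_w$. The Kazhdan–Lusztig polynomials $P_{y,w}\in\mathbb Z[v^2]$ are determined by: $P_{w,w}=1$; $P_{y,w}=0$ unless $y\le w$; $P_{y,w}$ has degree at most $(\ell(w)-\ell(y)-1)/2$ in $v^2$ if $y<w$; and $C'_w=\sum_{y\le w}v^{\ell(y)-\ell(w)}P_{y,w}\widetilde T_y$ is bar-invariant. **Matrices.** Let $\Lambda_\Delta(n,r)$ be the set of $\lambda=(\lambda_i)_{i\in\mathbb Z}$ with $\lambda_i\in\mathbb N$, $\lambda_{i+n}=\lambda_i$ and $\lambda_1+\dots+\lambda_n=r$. Let $\Theta_\Delta(n,r)$ be the set of matrices $A=(a_{i,j})_{i,j\in\mathbb Z}$ over $\mathbb N$ with $a_{i+n,j+n}=a_{i,j}$, with finitely many nonzero entries in each row and column, and with $\sum_{1\le i\le n,\,j\in\mathbb Z}a_{i,j}=r$. Let $\mathrm{ro}(A)$, $\mathrm{co}(A)$ be the sequences of row and column sums of $A$. For $1\le i\le n$ and $k\in\mathbb Z$ let $R^\lambda_{i+kn}$ consist of the $\lambda_i$ consecutive integers following $kr+\lambda_1+\dots+\lambda_{i-1}$.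 Let $\mathfrak S_\lambda\subset\mathfrak S_{\Delta,r}$ be the Young subgroup of elements preserving every $R^\lambda_m$, with longest element $w_{0,\lambda}$. Let $\mathcal D^\Delta_\lambda=\{d:\ell(wd)=\ell(w)+\ell(d)\text{ for all }w\in\mathfrak S_\lambda\}$ and $\mathcal D^\Delta_{\lambda,\mu}=\mathcal D^\Delta_\lambda\cap(\mathcal D^\Delta_\mu)^{-1}$. For $d\in\mathcal D^\Delta_{\lambda,\mu}$ let $d^+$ be the unique longest element of $\mathfrak S_\lambda d\mathfrak S_\mu$. The map $\jmath_\Delta(\lambda,d,\mu)=(|R^\lambda_k\cap dR^\mu_l|)_{k,l\in\mathbb Z}$ is a bijection from the set of triples with $\lambda,\mu\in\Lambda_\Delta(n,r)$, $d\in\mathcal D^\Delta_{\lambda,\mu}$ to $\Theta_\Delta(n,r)$. If $A=\jmath_\Delta(\lambda,d,\mu)$, put $y_A=d$ and $y_A^+=d^+$. Write $B\le^{Bo}A$ if $\mathrm{ro}(B)=\mathrm{ro}(A)$, $\mathrm{co}(B)=\mathrm{co}(A)$ and $y_B\le y_A$. Put $\sigma_{i,j}(A)=\sum_{s\le i,\,t\ge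 j}a_{s,t}$ for $i<j$ and $\sigma_{i,j}(A)=\sum_{s\ge i,\,t\le j}a_{s,t}$ for $i>j$, and write $B\sqsubset A$ if $B\ne A$, $\mathrm{ro}(B)=\mathrm{ro}(A)$, $\mathrm{co}(B)=\mathrm{co}(A)$ and $\sigma_{i,j}(B)\le\sigma_{i,j}(A)$ for all $i\ne j$. **Schur algebra.** Let $x_\lambda=\sum_{w\in\mathfrak S_\lambda}T_w$ and $\mathcal S=\mathrm{End}_{\mathcal H}\bigl(\bigoplus_{\lambda\in\Lambda_\Delta(n,r)}x_\lambda\mathcal H\bigr)$ (endomorphisms of right $\mathcal H$-modules), the affine quantum Schur algebra over $\mathcal Z$. For $A=\jmath_\Delta(\lambda,d,\mu)$ let $e_A\in\mathcal S$ be given by $e_A(x_\nu h)=\delta_{\mu\nu}\sum_{w\in\mathfrak S_\lambda d\mathfrak S_\mu}T_wh\in x_\lambda\mathcal H$, and let $[A]=v^{-d_A}e_A$ with $d_A=\sum_{1\le i\le n,\,i\ge k,\,j<l}a_{i,j}a_{k,l}$; the $e_A$ form a $\mathcal Z$-basis of $\mathcal S$. The bar involution of $\mathcal S$ is given by $\bar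 f(C'_{w_{0,\mu}}h)=\overline{f(C'_{w_{0,\mu}})}\,h$, where $C'_{w_{0,\mu}}=v^{-\ell(w_{0,\mu})}x_\mu$. The canonical basis $\{\theta_{A,r}\}_{A\in\Theta_\Delta(n,r)}$ is the unique $\mathcal Z$-basis of $\mathcal S$ with $\overline{\theta_{A,r}}=\theta_{A,r}$ and $\theta_{A,r}-[A]\in\sum_{B\sqsubset A}v^{-1}\mathbb Z[v^{-1}][B]$. For $\lambda,\mu\in\Lambda_\Delta(n,r)$ and $d\in\mathcal D^\Delta_{\lambda,\mu}$ let $\theta^d_{\lambda,\mu}\in\mathcal S$ be given by $\theta^d_{\lambda,\mu}(x_\nu h)=\delta_{\mu\nu}v^{\ell(w_{0,\mu})}C'_{d^+}h\in x_\lambda\mathcal H$. **Proposition.** All the objects above are well defined: those introduced by a description exist and are unique, $\jmath_\Delta$ is bijective, and $\{T_w\}$, $\{e_A\}$ are $\mathcal Z$-bases of $\mathcal H$ (defined by generators $T_w$ and the relations above together with $T_1=1$) and of $\mathcal S$. Moreover, for all $\lambda,\mu\in\Lambda_\Delta(n,r)$, $d\in\mathcal D^\Delta_{\lambda,\mu}$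 and $A=\jmath_\Delta(\lambda,d,\mu)$, $$\theta^d_{\lambda,\mu}=\theta_{A,r}=\sum_{\substack{B\in\Theta_\Delta(n,r)\\ B\le^{Bo}A}}v^{\ell(y_B^+)-\ell(y_A^+)}\,P_{y_B^+,y_A^+}\,[B].$$ -/

import Mathlib

noncomputable section

namespace AffSchur

/-! ## Weights, matrices, and the extended affine symmetric group -/

/-- The ring of Laurent polynomials in `v` over the integers. -/
abbrev Zv : Type := LaurentPolynomial ℤ

/-- The power `v ^ k`. -/
def vpow (k : ℤ) : Zv := LaurentPolynomial.T k

/-- `n`-periodic sequences of natural numbers with sum `r` over a period. -/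
def Wt (n r : ℕ) : Type :=
  {la : ℤ → ℕ // (∀ i, la (i + n) = la i) ∧ ∑ i ∈ Finset.Icc (1 : ℤ) n, la i = r}

instance (n r : ℕ) : DecidableEq (Wt n r) := Classical.decEq _

instance (n r : ℕ) : CoeFun (Wt n r) (fun _ => ℤ → ℕ) := ⟨fun la => la.1⟩

/-- The `n`-periodic matrices over the natural numbers, indexed by pairs of integers, with finite
rows and columns, whose entries in rows `1, …, n` add up to `r`. -/
def Theta (n r : ℕ) : Type :=
  {a : ℤ → ℤ → ℕ // (∀ i j, a (i + n) (j + n) = a i j) ∧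
    (∀ i, {j | a i j ≠ 0}.Finite) ∧ (∀ i, {j | a j i ≠ 0}.Finite) ∧
    ∑ i ∈ Finset.Icc (1 : ℤ) n, ∑ᶠ j, a i j = r}

instance (n r : ℕ) : CoeFun (Theta n r) (fun _ => ℤ → ℤ → ℕ) := ⟨fun A => A.1⟩

theorem perm_apply_inv (f : Equiv.Perm ℤ) (x : ℤ) : f (f⁻¹ x) = x := by simp

theorem perm_inv_apply (f : Equiv.Perm ℤ) (x : ℤ) : f⁻¹ (f x) = x := by simp

/-- Permutations `w` of the integers with `w (i + r) = w i + r`. -/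
def affSubgroup (r : ℕ) : Subgroup (Equiv.Perm ℤ) where
  carrier := {w | ∀ i, w (i + r) = w i + r}
  one_mem' := fun _ => rfl
  mul_mem' := by
    intro a b ha hb i
    rw [Equiv.Perm.mul_apply, hb, ha, Equiv.Perm.mul_apply]
  inv_mem' := by
    intro a ha i
    rw [Equiv.Perm.inv_eq_iff_eq, ha]
    simp

/-- The extended affine symmetric group. -/
abbrev AffSym (r : ℕ) : Type := affSubgroup r

/-- The permutation `j ↦ j + 1`. -/
def rho (r : ℕ) : AffSym r :=
  ⟨Equiv.addRight 1, fun i => by simp only [Equiv.coe_addRight]; ring⟩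

/-- The function interchanging the residue classes of `i` and `j` modulo `r`. -/
def swapFun (r : ℕ) (i j k : ℤ) : ℤ :=
  if k ≡ i [ZMOD r] then j + k - i else if k ≡ j [ZMOD r] then i + k - j else k

theorem swapFun_involutive (r : ℕ) (i j : ℤ) (h : ¬ i ≡ j [ZMOD r]) :
    Function.Involutive (swapFun r i j) := by
  intro k
  by_cases h1 : k ≡ i [ZMOD r]
  · have e : j + k - i ≡ j [ZMOD r] := by
      have := (h1.add_left j).sub_right i
      simpa using this
    have e2 : ¬ j + k - i ≡ i [ZMOD r] := fun e3 => h (e3.symm.trans e)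
    simp only [swapFun, h1, if_true, e, e2, if_false]
    ring
  · by_cases h2 : k ≡ j [ZMOD r]
    · have e : i + k - j ≡ i [ZMOD r] := by
        have := (h2.add_left i).sub_right j
        simpa using this
      simp only [swapFun, h1, h2, if_true, if_false, e]
      ring
    · simp only [swapFun, h1, h2, if_false]

/-- The affine transposition `(i, j)`, for `i`, `j` not congruent modulo `r`. -/
def affSwap (r : ℕ) (i j : ℤ) (h : ¬ i ≡ j [ZMOD r]) : AffSym r :=
  ⟨(swapFun_involutive r i j h).toPerm, by
    intro k
    have e : ∀ a : ℤ, (k + r ≡ a [ZMOD r]) ↔ (k ≡ a [ZMOD r]) := fun a => by simp [Int.ModEq]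
    simp only [Function.Involutive.coe_toPerm, swapFun, e]
    split_ifs <;> ring⟩

/-- The set of all reflections. -/
def IsReflection {r : ℕ} (t : AffSym r) : Prop :=
  ∃ (i j : ℤ) (h : ¬ i ≡ j [ZMOD r]), t = affSwap r i j h

/-- The simple reflections `s_i = (i, i + 1)`; there are none when `r = 1`. -/
def IsSimple {r : ℕ} (s : AffSym r) : Prop :=
  ∃ (i : ℤ) (h : ¬ i ≡ i + 1 [ZMOD r]), s = affSwap r i (i + 1) h

/-- The length of `w`: the least `k` such that `w` is a power of `rho` times a product of `k` simple
reflections. -/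
def len {r : ℕ} (w : AffSym r) : ℕ :=
  sInf {k | ∃ (a : ℤ) (l : List (AffSym r)), (∀ s ∈ l, IsSimple s) ∧ l.length = k ∧
    w = rho r ^ a * l.prod}

theorem len_one (r : ℕ) : len (1 : AffSym r) = 0 :=
  Nat.sInf_eq_zero.2 (Or.inl ⟨0, [], by simp, rfl, by simp⟩)

/-- The Bruhat order. Since reflections are permuted by conjugation with `rho` and
`len (rho ^ a * y) = len y`, this relation, defined for all elements by chains of reflections, is the
Bruhat order of the affine Weyl group on each coset `rho ^ a * W`, and elements of different cosets
are not comparable. -/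
def BruhatLE {r : ℕ} (y w : AffSym r) : Prop :=
  Relation.ReflTransGen (fun a b => ∃ t, IsReflection t ∧ b = t * a ∧ len a < len b) y w

/-- `w` is an element of `X` of maximal length. -/
def IsLongest {r : ℕ} (X : Set (AffSym r)) (w : AffSym r) : Prop :=
  w ∈ X ∧ ∀ u ∈ X, len u ≤ len w

/-- The longest element of `X` (used only where there is exactly one). -/
def longest {r : ℕ} (X : Set (AffSym r)) : AffSym r :=
  Classical.epsilon (IsLongest X)

/-- The number preceding the block `R_m`: for `m = i + k n` with `1 ≤ i ≤ n` it is
`k r + (la_1 + ⋯ + la_{i-1})`. -/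
def blockStart {n r : ℕ} (la : Wt n r) (m : ℤ) : ℤ :=
  ((m - 1) / n) * r + ∑ t ∈ Finset.Icc (1 : ℤ) ((m - 1) % n), (la t : ℤ)

/-- The block `R_m` of `la_m` consecutive integers. -/
def block {n r : ℕ} (la : Wt n r) (m : ℤ) : Finset ℤ :=
  Finset.Ioc (blockStart la m) (blockStart la m + la m)

/-- The standard Young subgroup of the weight `la`. -/
def young {n r : ℕ} (la : Wt n r) : Subgroup (AffSym r) where
  carrier := {w | ∀ m a, w.1 a ∈ block la m ↔ a ∈ block la m}
  one_mem' := fun _ _ => Iff.rfl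
  mul_mem' := by
    intro u w hu hw m a
    exact (hu m (w.1 a)).trans (hw m a)
  inv_mem' := by
    intro u hu m a
    have := hu m (u.1⁻¹ a)
    rw [perm_apply_inv] at this
    exact this.symm

/-- The elements `d` with `len (w * d) = len w + len d` for all `w` in the Young subgroup. -/
def cosetReps {n r : ℕ} (la : Wt n r) : Set (AffSym r) :=
  {d | ∀ w ∈ young la, len (w * d) = len w + len d}

/-- The distinguished double coset representatives. -/
def dblReps {n r : ℕ} (la mu : Wt n r) : Set (AffSym r) :=
  {d | d ∈ cosetReps la ∧ d⁻¹ ∈ cosetReps mu}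

/-- The double coset of `d` with respect to two Young subgroups. -/
def dblCoset {n r : ℕ} (la : Wt n r) (d : AffSym r) (mu : Wt n r) : Set (AffSym r) :=
  {w | ∃ a ∈ young la, ∃ b ∈ young mu, w = a * d * b}

/-- The longest element of the double coset of `d`. -/
def dPlus {n r : ℕ} (la : Wt n r) (d : AffSym r) (mu : Wt n r) : AffSym r :=
  longest (dblCoset la d mu)

/-- The longest element of the Young subgroup. -/
def wZero {n r : ℕ} (la : Wt n r) : AffSym r := longest (young la : Set (AffSym r))

/-! ## The bijection between double cosets and matrices -/

/-- Triples `(la, d, mu)` with `d` a distinguished double coset representative. -/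
structure Triple (n r : ℕ) where
  la : Wt n r
  d : AffSym r
  mu : Wt n r
  mem : d ∈ dblReps la mu

theorem blockStart_succ {n r : ℕ} [NeZero n] (mu : Wt n r) (m : ℤ) :
    blockStart mu (m + 1) = blockStart mu m + mu m := by
  have hn : (0 : ℤ) < n := by exact_mod_cast Nat.pos_of_ne_zero (NeZero.ne n)
  have hper : ∀ (q : ℤ) (i : ℤ), mu (i + n * q) = mu i := by
    have hp : Function.Periodic mu.1 (n : ℤ) := mu.2.1
    intro q i
    have := hp.int_mul q i
    simpa [mul_comm] using this
  obtain ⟨q, i, hi0, hin, hm⟩ : ∃ q i : ℤ, 0 ≤ i ∧ i < n ∧ m = i + n * q + 1 :=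
    ⟨(m - 1) / n, (m - 1) % n, Int.emod_nonneg _ hn.ne', Int.emod_lt_of_pos _ hn, by
      have := Int.emod_add_mul_ediv (m - 1) n
      linarith⟩
  have h1 : (m - 1) / n = q := by
    rw [hm, show i + n * q + 1 - 1 = i + n * q by ring, Int.add_mul_ediv_left _ _ hn.ne',
      Int.ediv_eq_zero_of_lt hi0 hin, zero_add]
  have h2 : (m - 1) % n = i := by
    rw [hm, show i + n * q + 1 - 1 = i + n * q by ring, Int.add_mul_emod_self_left,
      Int.emod_eq_of_lt hi0 hin]
  have hmu : mu m = mu (i + 1) := by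
    rw [hm, show i + n * q + 1 = (i + 1) + n * q by ring, hper]
  have hs : ∑ t ∈ Finset.Icc (1 : ℤ) (i + 1), (mu t : ℤ)
      = ∑ t ∈ Finset.Icc (1 : ℤ) i, (mu t : ℤ) + mu (i + 1) := by
    have : Finset.Icc (1 : ℤ) (i + 1) = insert (i + 1) (Finset.Icc (1 : ℤ) i) := by
      ext x; simp only [Finset.mem_Icc, Finset.mem_insert]; omega
    rw [this, Finset.sum_insert (by simp), add_comm]
  unfold blockStart
  rw [h1, h2, hmu, add_sub_cancel_right]
  by_cases hi : i + 1 < n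
  · have h3 : m / n = q := by
      rw [hm, show i + n * q + 1 = (i + 1) + n * q by ring, Int.add_mul_ediv_left _ _ hn.ne',
        Int.ediv_eq_zero_of_lt (by omega) hi, zero_add]
    have h4 : m % n = i + 1 := by
      rw [hm, show i + n * q + 1 = (i + 1) + n * q by ring, Int.add_mul_emod_self_left,
        Int.emod_eq_of_lt (by omega) hi]
    rw [h3, h4, hs, add_assoc]
  · have hi' : i + 1 = n := by omega
    have hm' : m = n * (q + 1) := by rw [hm, ← hi']; ring
    have h3 : m / n = q + 1 := by rw [hm', Int.mul_ediv_cancel_left _ hn.ne']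
    have h4 : m % n = 0 := by rw [hm', Int.mul_emod_right]
    have h5 : ∑ t ∈ Finset.Icc (1 : ℤ) n, (mu t : ℤ) = r := by exact_mod_cast mu.2.2
    have h6 : ∑ t ∈ Finset.Icc (1 : ℤ) n, (mu t : ℤ)
        = ∑ t ∈ Finset.Icc (1 : ℤ) i, (mu t : ℤ) + mu (i + 1) := by
      rw [← hs]
      exact Finset.sum_congr (congrArg _ hi'.symm) fun _ _ => rfl
    rw [h3, h4]
    simp only [Finset.Icc_eq_empty (show ¬ (1 : ℤ) ≤ 0 by norm_num), Finset.sum_empty, add_zero]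
    linarith

theorem blockStart_add {n r : ℕ} [NeZero n] (mu : Wt n r) (m : ℤ) :
    blockStart mu (m + n) = blockStart mu m + r := by
  have hn : (n : ℤ) ≠ 0 := by exact_mod_cast NeZero.ne n
  unfold blockStart
  rw [show m + n - 1 = m - 1 + n by ring, Int.add_ediv_of_dvd_right (dvd_refl _), Int.ediv_self hn,
    Int.add_emod_right]
  ring

theorem blockStart_mono {n r : ℕ} [NeZero n] (mu : Wt n r) : Monotone (blockStart mu) :=
  monotone_int_of_le_succ fun m => by rw [blockStart_succ]; omega

theorem blockStart_one_add {n r : ℕ} [NeZero n] (mu : Wt n r) (q : ℤ) :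
    blockStart mu (n * q + 1) = q * r := by
  have hn : (n : ℤ) ≠ 0 := by exact_mod_cast NeZero.ne n
  rw [blockStart, add_sub_cancel_right, Int.mul_ediv_cancel_left _ hn, Int.mul_emod_right]
  simp

theorem mem_block {n r : ℕ} [NeZero n] (mu : Wt n r) (m b : ℤ) :
    b ∈ block mu m ↔ blockStart mu m < b ∧ b ≤ blockStart mu (m + 1) := by
  rw [block, Finset.mem_Ioc, blockStart_succ]

theorem block_unique {n r : ℕ} [NeZero n] (mu : Wt n r) {m m' b : ℤ}
    (h : b ∈ block mu m) (h' : b ∈ block mu m') : m = m' := by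
  rw [mem_block] at h h'
  rcases lt_trichotomy m m' with hl | hl | hl
  · have := blockStart_mono mu (show m + 1 ≤ m' by omega)
    omega
  · exact hl
  · have := blockStart_mono mu (show m' + 1 ≤ m by omega)
    omega

theorem exists_block {n r : ℕ} [NeZero n] [NeZero r] (mu : Wt n r) (b : ℤ) :
    ∃ m, b ∈ block mu m := by
  have hr : (1 : ℤ) ≤ r := by exact_mod_cast Nat.one_le_iff_ne_zero.2 (NeZero.ne r)
  have hb : ∃ c, ∀ z, blockStart mu z < b → z ≤ c := by
    refine ⟨n * |b| + 1, fun z hz => ?_⟩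
    by_contra hc
    have := blockStart_mono mu (not_le.1 hc).le
    rw [blockStart_one_add] at this
    nlinarith [le_abs_self b, abs_nonneg b]
  have he : ∃ z, blockStart mu z < b := by
    refine ⟨n * (-|b| - 1) + 1, ?_⟩
    rw [blockStart_one_add]
    nlinarith [neg_abs_le b, abs_nonneg b]
  obtain ⟨m, h1, h2⟩ := Int.exists_greatest_of_bdd hb he
  refine ⟨m, (mem_block _ _ _).2 ⟨h1, ?_⟩⟩
  by_contra hc
  have := h2 _ (not_le.1 hc)
  omega

theorem block_add {n r : ℕ} [NeZero n] (mu : Wt n r) (m b : ℤ) :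
    b + r ∈ block mu (m + n) ↔ b ∈ block mu m := by
  rw [mem_block, mem_block, show m + n + 1 = (m + 1) + n by ring, blockStart_add, blockStart_add]
  omega

/-- The entry `|R_k ∩ d R_l|`. -/
def jEntry {n r : ℕ} (la : Wt n r) (d : AffSym r) (mu : Wt n r) (k l : ℤ) : ℕ :=
  (block la k ∩ (block mu l).image d.1).card

theorem mem_jEntry {n r : ℕ} (la : Wt n r) (d : AffSym r) (mu : Wt n r) (k l b : ℤ) :
    b ∈ block la k ∩ (block mu l).image d.1 ↔ b ∈ block la k ∧ d.1⁻¹ b ∈ block mu l := by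
  rw [Finset.mem_inter, Finset.mem_image]
  refine and_congr_right fun _ => ⟨?_, fun h => ⟨_, h, perm_apply_inv _ _⟩⟩
  rintro ⟨a, ha, rfl⟩
  rwa [perm_inv_apply]

theorem jEntry_periodic {n r : ℕ} [NeZero n] (la : Wt n r) (d : AffSym r) (mu : Wt n r)
    (k l : ℤ) : jEntry la d mu (k + n) (l + n) = jEntry la d mu k l := by
  have hd : ∀ i, d.1⁻¹ (i + r) = d.1⁻¹ i + r := (inv_mem d.2 : d.1⁻¹ ∈ affSubgroup r)
  unfold jEntry
  symm
  refine Finset.card_bij (fun b _ => b + r) (fun b hb => ?_) (fun a _ b _ h => by simpa using h)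
    (fun b hb => ⟨b - r, ?_, by ring⟩)
  · rw [mem_jEntry] at hb ⊢
    rwa [hd, block_add, block_add]
  · rw [mem_jEntry] at hb ⊢
    rwa [← block_add (n := n), ← block_add (n := n) mu, ← hd, sub_add_cancel]

theorem jEntry_row_sum {n r : ℕ} [NeZero n] [NeZero r] (la : Wt n r) (d : AffSym r) (mu : Wt n r)
    (k : ℤ) : {l | jEntry la d mu k l ≠ 0}.Finite ∧ ∑ᶠ l, jEntry la d mu k l = la k := by
  choose f hf using exists_block mu
  have hs : ∀ l, block la k ∩ (block mu l).image d.1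
      = {b ∈ block la k | f (d.1⁻¹ b) = l} := by
    intro l
    ext b
    rw [mem_jEntry, Finset.mem_filter]
    refine and_congr_right fun _ => ⟨fun h => block_unique mu (hf _) h, ?_⟩
    rintro rfl
    exact hf _
  have hsupp : ∀ l, jEntry la d mu k l ≠ 0 → l ∈ (block la k).image fun b => f (d.1⁻¹ b) := by
    intro l hl
    obtain ⟨b, hb⟩ := Finset.card_ne_zero.1 hl
    rw [hs, Finset.mem_filter] at hb
    exact Finset.mem_image.2 ⟨b, hb.1, hb.2⟩
  refine ⟨((block la k).image _).finite_toSet.subset hsupp, ?_⟩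
  rw [finsum_eq_sum_of_support_subset (s := (block la k).image fun b => f (d.1⁻¹ b)) _ hsupp]
  have := Finset.card_eq_sum_card_fiberwise (f := fun b => f (d.1⁻¹ b)) (s := block la k)
    (t := (block la k).image fun b => f (d.1⁻¹ b)) (fun b hb => Finset.mem_coe.2
      (Finset.mem_image_of_mem _ hb))
  have hc : (block la k).card = la k := by simp [block]
  rw [← hc, this]
  exact Finset.sum_congr rfl fun l _ => by rw [jEntry, hs]

theorem jEntry_col_finite {n r : ℕ} [NeZero n] [NeZero r] (la : Wt n r) (d : AffSym r)
    (mu : Wt n r) (l : ℤ) : {k | jEntry la d mu k l ≠ 0}.Finite := by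
  choose f hf using exists_block la
  refine ((block mu l).image fun a => f (d.1 a)).finite_toSet.subset fun k hk => ?_
  obtain ⟨b, hb⟩ := Finset.card_ne_zero.1 hk
  rw [mem_jEntry] at hb
  refine Finset.mem_coe.2 (Finset.mem_image.2 ⟨_, hb.2, ?_⟩)
  rw [perm_apply_inv]
  exact block_unique la (hf b) hb.1

/-- The map sending `(la, d, mu)` to the matrix with entries `|R_k ∩ d R_l|`. -/
def jMap {n r : ℕ} [NeZero n] [NeZero r] (t : Triple n r) : Theta n r :=
  ⟨jEntry t.la t.d t.mu, jEntry_periodic t.la t.d t.mu,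
    fun i => (jEntry_row_sum t.la t.d t.mu i).1, jEntry_col_finite t.la t.d t.mu, by
      exact (Finset.sum_congr rfl fun i _ => (jEntry_row_sum t.la t.d t.mu i).2).trans t.la.2.2⟩

instance (n r : ℕ) [NeZero n] : Nonempty (Triple n r) := by
  have hn : (1 : ℤ) ≤ n := by exact_mod_cast Nat.one_le_iff_ne_zero.2 (NeZero.ne n)
  let la : Wt n r := ⟨fun i => if (n : ℤ) ∣ i then r else 0, fun i => by simp, by
    rw [Finset.sum_eq_single (n : ℤ)]
    · simp
    · intro b hb hbn
      rw [Finset.mem_Icc] at hb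
      rw [if_neg]
      intro hd
      exact hbn (le_antisymm hb.2 (Int.le_of_dvd (by omega) hd))
    · intro h
      exact absurd (Finset.mem_Icc.2 ⟨hn, le_refl _⟩) h⟩
  refine ⟨⟨la, 1, la, ?_, ?_⟩⟩
  · intro w _
    rw [mul_one, len_one, add_zero]
  · intro w _
    rw [inv_one, mul_one, len_one, add_zero]

/-- The triple attached to a matrix, by inverting `jMap`. -/
def triple {n r : ℕ} [NeZero n] [NeZero r] (A : Theta n r) : Triple n r :=
  Function.invFun jMap A

/-- The distinguished double coset representative attached to a matrix. -/
def yRep {n r : ℕ} [NeZero n] [NeZero r] (A : Theta n r) : AffSym r := (triple A).d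

/-- The longest element of the double coset attached to a matrix. -/
def yPlus {n r : ℕ} [NeZero n] [NeZero r] (A : Theta n r) : AffSym r :=
  dPlus (triple A).la (triple A).d (triple A).mu

/-- Row sums. -/
def ro {n r : ℕ} (A : Theta n r) (i : ℤ) : ℕ := ∑ᶠ j, A i j

/-- Column sums. -/
def co {n r : ℕ} (A : Theta n r) (j : ℤ) : ℕ := ∑ᶠ i, A i j

open Classical in
/-- The corner sums: over `s ≤ i`, `t ≥ j` if `i < j`, and over `s ≥ i`, `t ≤ j` if `i > j`. -/
def cornerSum {n r : ℕ} (i j : ℤ) (A : Theta n r) : ℕ :=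
  if i < j then ∑ᶠ p : ℤ × ℤ, if p.1 ≤ i ∧ j ≤ p.2 then A p.1 p.2 else 0
  else ∑ᶠ p : ℤ × ℤ, if i ≤ p.1 ∧ p.2 ≤ j then A p.1 p.2 else 0

/-- The strict order on matrices given by corner sums, with fixed row and column sums. -/
def SqLT {n r : ℕ} (B A : Theta n r) : Prop :=
  (∀ i j : ℤ, i ≠ j → cornerSum i j B ≤ cornerSum i j A) ∧ co B = co A ∧ ro B = ro A ∧ B ≠ A

/-- The order on matrices induced by the Bruhat order. -/
def BoLE {n r : ℕ} [NeZero n] [NeZero r] (B A : Theta n r) : Prop :=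
  ro B = ro A ∧ co B = co A ∧ BruhatLE (yRep B) (yRep A)

open Classical in
/-- The sum of `a_{i,j} a_{k,l}` over `1 ≤ i ≤ n`, `i ≥ k`, `j < l`. -/
def dNum {n r : ℕ} (A : Theta n r) : ℕ :=
  ∑ i ∈ Finset.Icc (1 : ℤ) n, ∑ᶠ p : ℤ × ℤ × ℤ,
    if p.2.1 ≤ i ∧ p.1 < p.2.2 then A i p.1 * A p.2.1 p.2.2 else 0

/-! ## The extended affine Hecke algebra and its Kazhdan–Lusztig basis -/

/-- The relations between the generators `T_w`. -/
inductive HeckeRel (r : ℕ) : FreeAlgebra Zv (AffSym r) → FreeAlgebra Zv (AffSym r) → Prop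
  | one : HeckeRel r (FreeAlgebra.ι Zv 1) 1
  | quad (s : AffSym r) (hs : IsSimple s) :
      HeckeRel r (FreeAlgebra.ι Zv s * FreeAlgebra.ι Zv s)
        ((vpow 2 - 1) • FreeAlgebra.ι Zv s + vpow 2 • (1 : FreeAlgebra Zv (AffSym r)))
  | mul (w w' : AffSym r) (h : len (w * w') = len w + len w') :
      HeckeRel r (FreeAlgebra.ι Zv w * FreeAlgebra.ι Zv w') (FreeAlgebra.ι Zv (w * w'))

/-- The extended affine Hecke algebra. -/
def Hecke (r : ℕ) : Type := RingQuot (HeckeRel r)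

instance (r : ℕ) : Ring (Hecke r) := inferInstanceAs (Ring (RingQuot (HeckeRel r)))

instance (r : ℕ) : Algebra Zv (Hecke r) := inferInstanceAs (Algebra Zv (RingQuot (HeckeRel r)))

/-- The element `T_w`. -/
def TT {r : ℕ} (w : AffSym r) : Hecke r := RingQuot.mkAlgHom Zv (HeckeRel r) (FreeAlgebra.ι Zv w)

/-- The normalized element `v ^ (- len w) T_w`. -/
def TTn {r : ℕ} (w : AffSym r) : Hecke r := vpow (-(len w : ℤ)) • TT w

/-- `β` is a ring homomorphism with `v ↦ v⁻¹` that maps each `T_w` to the inverse of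
`T_{w⁻¹}`. -/
def IsHeckeBar (r : ℕ) (β : Hecke r →+* Hecke r) : Prop :=
  (∀ z : Zv, β (algebraMap Zv _ z) = algebraMap Zv _ (LaurentPolynomial.invert z)) ∧
    ∀ w : AffSym r, β (TT w) * TT w⁻¹ = 1 ∧ TT w⁻¹ * β (TT w) = 1

/-- The bar involution of the Hecke algebra: the ring homomorphism just described. -/
def heckeBar (r : ℕ) : Hecke r →+* Hecke r :=
  @Classical.epsilon _ ⟨RingHom.id _⟩ (IsHeckeBar r)

/-- For a family `P` of polynomials in `q = v²`, the sum over `y` of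
`v ^ (len y - len w) P_y` times the normalized `T_y`. -/
def klSum {r : ℕ} (w : AffSym r) (P : AffSym r →₀ Polynomial ℤ) : Hecke r :=
  P.sum fun y p =>
    (vpow ((len y : ℤ) - len w) * Polynomial.aeval (vpow 2) p) • TTn y

/-- `P` is the family of Kazhdan–Lusztig polynomials `P_{y, w}` with `w` fixed. For `w` in the affine
Weyl group this is the usual characterization. Since `T_{rho}` is bar-invariant and left
multiplication by it permutes the `T_y`, preserving lengths and the Bruhat order, for
`w = rho ^ a * x` it describes `P_{rho ^ a * y, rho ^ a * x} = P_{y, x}` and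
`C'_w = T_{rho} ^ a C'_x`; the polynomials vanish for elements of different cosets. -/
def IsKLRow {r : ℕ} (w : AffSym r) (P : AffSym r →₀ Polynomial ℤ) : Prop :=
  P w = 1 ∧ (∀ y, P y ≠ 0 → BruhatLE y w) ∧
    (∀ y, BruhatLE y w → y ≠ w → len y + 2 * (P y).natDegree + 1 ≤ len w) ∧
    heckeBar r (klSum w P) = klSum w P

/-- The Kazhdan–Lusztig polynomials with `w` fixed. -/
def klRow {r : ℕ} (w : AffSym r) : AffSym r →₀ Polynomial ℤ := Classical.epsilon (IsKLRow w)

/-- The Kazhdan–Lusztig polynomial `P_{y, w}`, evaluated at `q = v²`. -/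
def klP {r : ℕ} (y w : AffSym r) : Zv := Polynomial.aeval (vpow 2) (klRow w y)

/-- The Kazhdan–Lusztig basis element `C'_w`. -/
def klC {r : ℕ} (w : AffSym r) : Hecke r := klSum w (klRow w)

/-! ## The affine quantum Schur algebra and its canonical basis -/

/-- The element `x_la`, the sum of all `T_w` with `w` in the Young subgroup. -/
def xElt {n r : ℕ} (la : Wt n r) : Hecke r := ∑ᶠ w ∈ young la, TT w

/-- The right ideal generated by `x_la`. -/
def xIdeal {n r : ℕ} (la : Wt n r) : Submodule (Hecke r)ᵐᵒᵖ (Hecke r) :=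
  Submodule.span (Hecke r)ᵐᵒᵖ {xElt la}

/-- There are finitely many weights. -/
instance (n r : ℕ) [NeZero n] : Finite (Wt n r) := by
  have hn : (0 : ℤ) < n := by exact_mod_cast Nat.pos_of_ne_zero (NeZero.ne n)
  have key : ∀ (la : Wt n r) (i : ℤ), ∃ j ∈ Finset.Icc (1 : ℤ) n, j = (i - 1) % n + 1 ∧
      la i = la j := by
    intro la i
    have hp : Function.Periodic la.1 (n : ℤ) := la.2.1
    have h0 := Int.emod_nonneg (i - 1) hn.ne'
    have h1 := Int.emod_lt_of_pos (i - 1) hn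
    refine ⟨(i - 1) % n + 1, Finset.mem_Icc.2 ⟨by omega, by omega⟩, rfl, ?_⟩
    have h2 := hp.int_mul ((i - 1) / n) ((i - 1) % n + 1)
    rw [← h2]
    refine congrArg la.1 ?_
    have := Int.emod_add_mul_ediv (i - 1) n
    push_cast
    linarith [mul_comm ((i - 1) / (n : ℤ)) n]
  refine Finite.of_injective (β := Finset.Icc (1 : ℤ) n → Fin (r + 1))
    (fun la j => ⟨la j, Nat.lt_succ_of_le ?_⟩) fun la mu h => Subtype.ext (funext fun i => ?_)
  · exact (Finset.single_le_sum (f := la.1) (fun _ _ => Nat.zero_le _) j.2).trans la.2.2.le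
  · obtain ⟨j, hj, hji, hla⟩ := key la i
    obtain ⟨j', hj', hji', hmu⟩ := key mu i
    obtain rfl : j' = j := hji'.trans hji.symm
    have := congrArg Fin.val (congrFun h ⟨j', hj⟩)
    exact hla.trans (this.trans hmu.symm)

/-- The direct sum of all the right ideals `x_la H`. There are finitely many summands, so that it is
the product. -/
abbrev TensorSpace (n r : ℕ) : Type := ∀ la : Wt n r, xIdeal la

/-- The affine quantum Schur algebra: the endomorphisms of the right `H`-module that is the direct sum of
the `x_la H`. -/
abbrev Schur (n r : ℕ) : Type := Module.End (Hecke r)ᵐᵒᵖ (TensorSpace n r)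

/-- The element `z x_la h` of the summand `x_la H`, for a scalar `z`. -/
def gen {n r : ℕ} (la : Wt n r) (z : Zv) (h : Hecke r) : TensorSpace n r :=
  Pi.single la (z • MulOpposite.op h • ⟨xElt la, Submodule.mem_span_singleton_self _⟩)

/-- The condition `f (x_nu h) = δ_{mu, nu} z h` for all `nu` and `h`, where `z h` lies in the summand
`x_la H`. -/
def ActsBy {n r : ℕ} (la mu : Wt n r) (z : Hecke r) (f : Schur n r) : Prop :=
  ∀ (nu : Wt n r) (h : Hecke r) (ka : Wt n r),
    ((f (gen nu 1 h) ka : xIdeal ka) : Hecke r) = if nu = mu ∧ ka = la then z * h else 0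

/-- The endomorphism satisfying the condition just described. -/
def schurHom {n r : ℕ} (la mu : Wt n r) (z : Hecke r) : Schur n r :=
  Classical.epsilon (ActsBy la mu z)

/-- The sum of all `T_w` with `w` in the double coset of `d`. -/
def dblSum {n r : ℕ} (la : Wt n r) (d : AffSym r) (mu : Wt n r) : Hecke r :=
  ∑ᶠ w ∈ dblCoset la d mu, TT w

/-- The element `φ` attached to a double coset. -/
def phi {n r : ℕ} (la : Wt n r) (d : AffSym r) (mu : Wt n r) : Schur n r :=
  schurHom la mu (dblSum la d mu)

/-- The value at `x_mu` of the element `θ` attached to a double coset: `v ^ len (w_{0,mu})` times the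
Kazhdan–Lusztig basis element of the longest element of the double coset. -/
def thetaVal {n r : ℕ} (la : Wt n r) (d : AffSym r) (mu : Wt n r) : Hecke r :=
  vpow (len (wZero mu)) • klC (dPlus la d mu)

/-- The element `θ` attached to a double coset. -/
def thetaHom {n r : ℕ} (la : Wt n r) (d : AffSym r) (mu : Wt n r) : Schur n r :=
  schurHom la mu (thetaVal la d mu)

/-- The standard basis element `e_A`, identified with `φ` for the triple of `A`. -/
def eElt {n r : ℕ} [NeZero n] [NeZero r] (A : Theta n r) : Schur n r :=
  phi (triple A).la (triple A).d (triple A).mu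

/-- The normalized basis element `[A]`. -/
def brk {n r : ℕ} [NeZero n] [NeZero r] (A : Theta n r) : Schur n r :=
  vpow (-(dNum A : ℤ)) • eElt A

/-- `g` is the image of `f` under the bar involution of the Schur algebra. With
`c = v ^ (- len (w_{0,mu})) x_mu`, which is the Kazhdan–Lusztig basis element of `w_{0,mu}`, the
condition is that `g (c h)` is the bar of `f c`, times `h`, for all `mu` and `h`. -/
def IsSchurBar {n r : ℕ} (f g : Schur n r) : Prop :=
  ∀ (mu : Wt n r) (h : Hecke r) (ka : Wt n r),
    ((g (gen mu (vpow (-(len (wZero mu) : ℤ))) h) ka : xIdeal ka) : Hecke r) =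
      heckeBar r ((f (gen mu (vpow (-(len (wZero mu) : ℤ))) 1) ka : xIdeal ka) : Hecke r) * h

/-- `θ` is the canonical basis: a basis of the Schur algebra over the Laurent polynomials, consisting
of bar-invariant elements, such that `θ_A - [A]` is a combination of elements `[B]` with `B` strictly
below `A`, with coefficients in `v⁻¹ ℤ[v⁻¹]`. -/
def IsCanonicalBasis {n r : ℕ} [NeZero n] [NeZero r] (θ : Theta n r → Schur n r) : Prop :=
  (∃ b : Module.Basis (Theta n r) Zv (Schur n r), ⇑b = θ) ∧ (∀ A, IsSchurBar (θ A) (θ A)) ∧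
    ∀ A, θ A - brk A ∈ Submodule.span ℤ
      {x : Schur n r | ∃ B, SqLT B A ∧ ∃ k : ℕ, 1 ≤ k ∧ x = vpow (-(k : ℤ)) • brk B}

/-- The canonical basis of the affine quantum Schur algebra. -/
def canonicalBasis (n r : ℕ) [NeZero n] [NeZero r] : Theta n r → Schur n r :=
  Classical.epsilon IsCanonicalBasis

/-- All the objects introduced above by a description (rather than by a construction) exist and are
unique, the elements `T_w` form a basis of the Hecke algebra, and the elements `e_A` form a basis of
the Schur algebra. -/
def WellDefined (n r : ℕ) [NeZero n] [NeZero r] : Prop :=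
  (∃ b : Module.Basis (AffSym r) Zv (Hecke r), ⇑b = TT) ∧
  (∃! β, IsHeckeBar r β) ∧
  (∀ w : AffSym r, ∃! P, IsKLRow w P) ∧
  (∀ la : Wt n r, ∃! w, IsLongest (young la : Set (AffSym r)) w) ∧
  Function.Bijective (jMap : Triple n r → Theta n r) ∧
  (∀ t : Triple n r, (∃! w, IsLongest (dblCoset t.la t.d t.mu) w) ∧
    (∃! f, ActsBy t.la t.mu (dblSum t.la t.d t.mu) f) ∧
    (∃! f, ActsBy t.la t.mu (thetaVal t.la t.d t.mu) f)) ∧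
  (∃ b : Module.Basis (Theta n r) Zv (Schur n r), ⇑b = eElt) ∧
  (∃! θ : Theta n r → Schur n r, IsCanonicalBasis θ)

end AffSchur

end

/-! An endomorphism in the Schur algebra is determined by its values at the generators `x_mu`. The
possible components in `x_la H` of such a value are the Hecke algebra elements whose `T`-coordinates
are constant on the left cosets of the Young subgroup of `la` and on the right cosets of that of
`mu` (`leftInv_sval`, `rightInv_sval`, `existsUnique_actsBy`). The Schur algebra thus consists of
finitely supported functions on double cosets, with the `e_A` as indicator functions. Constancy
under a simple reflection `s` is the eigenvector equation `C'_s h = (v + v⁻¹) h`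
(`csim_mul_eq_iff`), and `C'_w` satisfies it for every left descent `s` of `w`. The longest element
`d⁺` of a double coset has all simple reflections of the two Young subgroups as descents, so
`C'_{d⁺}` defines an element `θ` of the Schur algebra.

Counting inversions of `d⁺` gives `ℓ(d⁺) = d_A + ℓ(w_{0,mu})` (`dNum_add_len_wZero`). With this
identity all normalizing powers of `v` cancel: the coefficient of `[B]` in `θ` for `A` is the
coefficient of the normalized `T` at `y_B⁺` in `C'_w` for `w = y_A⁺` (`bcoef_thetaElt`).
Bar-invariance and the negativity of the exponents are then inherited from `C'`. A nonzero
coefficient forces `y_B⁺ ≤ y_A⁺`; this implies both the inequalities of corner sums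
(`BruhatLE.ncard_corner_le`), hence `SqLT` when `B ≠ A`, and `y_B ≤ y_A` (`BruhatLE.dblReps`), which
bounds the sum. Uniqueness of the canonical basis holds because a bar-invariant element with all
coefficients in `v⁻¹ ℤ[v⁻¹]` vanishes (`eq_zero_of_isSchurBar`).

The group theory rests on one fact about permutations of the integers: for `i < j`, left
multiplication by `(i, j)` shortens `w` exactly when `w⁻¹` reverses the order of `i` and `j`
(`len_affSwap_mul_lt_iff`). From it follow the exchange and lifting properties, the regular
representation that makes the `T_w` independent, the usual inductive construction of `C'_w`, and the
description of coset representatives by monotonicity on blocks. Monotonicity on blocks makes an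
element of a double coset recoverable from its matrix, which gives the bijectivity of `jMap` and the
uniqueness of longest elements. -/

noncomputable section

namespace AffSchur

/-! ### The affine symmetric group acting on the integers. -/

section Group

variable {r : ℕ}

theorem one_val_apply (i : ℤ) : (1 : AffSym r).1 i = i := rfl

theorem mul_val_apply (a b : AffSym r) (i : ℤ) : (a * b).1 i = a.1 (b.1 i) := rfl

theorem val_inv_apply (a : AffSym r) (i : ℤ) : a.1 (a⁻¹.1 i) = i := perm_apply_inv _ _

theorem inv_val_apply (a : AffSym r) (i : ℤ) : a⁻¹.1 (a.1 i) = i := perm_inv_apply _ _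

theorem affSym_ext {a b : AffSym r} (h : ∀ i, a.1 i = b.1 i) : a = b :=
  Subtype.ext (Equiv.ext h)

theorem val_add (w : AffSym r) (i : ℤ) : w.1 (i + r) = w.1 i + r := w.2 i

theorem val_add_mul (w : AffSym r) (i k : ℤ) : w.1 (i + k * r) = w.1 i + k * r := by
  have hp : Function.Periodic (fun i => w.1 i - i) (r : ℤ) := fun i => by
    simp only [val_add]; ring
  have := hp.int_mul k i
  simp only [Int.cast_id] at this
  linarith

theorem val_modEq_of (w : AffSym r) {i j : ℤ} (h : i ≡ j [ZMOD r]) :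
    w.1 i ≡ w.1 j [ZMOD r] := by
  obtain ⟨k, hk⟩ := h.dvd
  have : j = i + k * r := by linarith
  rw [this, val_add_mul]
  simp [Int.ModEq]

theorem val_modEq (w : AffSym r) {i j : ℤ} :
    w.1 i ≡ w.1 j [ZMOD r] ↔ i ≡ j [ZMOD r] := by
  refine ⟨fun h => ?_, val_modEq_of w⟩
  simpa only [inv_val_apply] using val_modEq_of w⁻¹ h

theorem not_val_modEq (w : AffSym r) {i j : ℤ} (h : ¬ i ≡ j [ZMOD r]) :
    ¬ w.1 i ≡ w.1 j [ZMOD r] := fun e => h ((val_modEq w).1 e)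

theorem val_sub_of_modEq (w : AffSym r) {i k : ℤ} (h : k ≡ i [ZMOD r]) :
    w.1 k = w.1 i + (k - i) := by
  obtain ⟨m, hm⟩ := h.symm.dvd
  have : k = i + m * r := by linarith
  rw [this, val_add_mul]; ring

theorem affSwap_apply (i j k : ℤ) (h : ¬ i ≡ j [ZMOD r]) :
    (affSwap r i j h).1 k = swapFun r i j k := rfl

theorem affSwap_left (i j : ℤ) (h : ¬ i ≡ j [ZMOD r]) : (affSwap r i j h).1 i = j := by
  rw [affSwap_apply, swapFun, if_pos (Int.ModEq.refl _)]; ring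

theorem affSwap_right (i j : ℤ) (h : ¬ i ≡ j [ZMOD r]) : (affSwap r i j h).1 j = i := by
  rw [affSwap_apply, swapFun, if_neg (fun e => h e.symm), if_pos (Int.ModEq.refl _)]; ring

theorem affSwap_of_ne {i j k : ℤ} (h : ¬ i ≡ j [ZMOD r]) (h1 : ¬ k ≡ i [ZMOD r])
    (h2 : ¬ k ≡ j [ZMOD r]) : (affSwap r i j h).1 k = k := by
  rw [affSwap_apply, swapFun, if_neg h1, if_neg h2]

theorem affSwap_mul_self (i j : ℤ) (h : ¬ i ≡ j [ZMOD r]) :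
    affSwap r i j h * affSwap r i j h = 1 :=
  affSym_ext fun k => swapFun_involutive r i j h k

theorem affSwap_inv (i j : ℤ) (h : ¬ i ≡ j [ZMOD r]) : (affSwap r i j h)⁻¹ = affSwap r i j h :=
  inv_eq_of_mul_eq_one_left (affSwap_mul_self i j h)

theorem mul_affSwap (w : AffSym r) (i j : ℤ) (h : ¬ i ≡ j [ZMOD r]) :
    w * affSwap r i j h = affSwap r (w.1 i) (w.1 j) (not_val_modEq w h) * w := by
  refine affSym_ext fun k => ?_
  rw [mul_val_apply, mul_val_apply, affSwap_apply, affSwap_apply, swapFun, swapFun]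
  simp only [val_modEq]
  split_ifs with h1 h2
  · rw [show j + k - i = j + (k - i) by ring, val_sub_of_modEq w h1,
      val_sub_of_modEq w (i := j) (k := j + (k - i))]
    · ring
    · have := h1.sub_right i
      simpa using this.add_left j
  · rw [show i + k - j = i + (k - j) by ring, val_sub_of_modEq w h2,
      val_sub_of_modEq w (i := i) (k := i + (k - j))]
    · ring
    · have := h2.sub_right j
      simpa using this.add_left i
  · rfl

theorem affSwap_comm (i j : ℤ) (h : ¬ i ≡ j [ZMOD r]) :
    affSwap r i j h = affSwap r j i (fun e => h e.symm) := by
  refine affSym_ext fun k => ?_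
  rw [affSwap_apply, affSwap_apply, swapFun, swapFun]
  split_ifs with h1 h2
  · exact absurd (h1.symm.trans h2) h
  all_goals rfl

theorem affSwap_shift (i j k : ℤ) (h : ¬ i ≡ j [ZMOD r])
    (h' : ¬ i + k * r ≡ j + k * r [ZMOD r]) :
    affSwap r (i + k * r) (j + k * r) h' = affSwap r i j h := by
  refine affSym_ext fun m => ?_
  have e : ∀ a : ℤ, (m ≡ a + k * r [ZMOD r]) ↔ (m ≡ a [ZMOD r]) := fun a => by
    simp [Int.ModEq]
  rw [affSwap_apply, affSwap_apply, swapFun, swapFun]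
  simp only [e]
  split_ifs <;> ring

theorem IsSimple.isReflection {s : AffSym r} (hs : IsSimple s) : IsReflection s := by
  obtain ⟨i, h, rfl⟩ := hs
  exact ⟨i, i + 1, h, rfl⟩

theorem IsReflection.mul_self {t : AffSym r} (ht : IsReflection t) : t * t = 1 := by
  obtain ⟨i, j, h, rfl⟩ := ht
  exact affSwap_mul_self i j h

theorem IsReflection.inv {t : AffSym r} (ht : IsReflection t) : t⁻¹ = t :=
  inv_eq_of_mul_eq_one_left ht.mul_self

theorem IsReflection.mul_cancel_left {t : AffSym r} (ht : IsReflection t) (w : AffSym r) :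
    t * (t * w) = w := by rw [← mul_assoc, ht.mul_self, one_mul]

theorem IsReflection.mul_cancel_right {t : AffSym r} (ht : IsReflection t) (w : AffSym r) :
    w * t * t = w := by rw [mul_assoc, ht.mul_self, mul_one]

theorem IsReflection.conj {t : AffSym r} (ht : IsReflection t) (w : AffSym r) :
    IsReflection (w * t * w⁻¹) := by
  obtain ⟨i, j, h, rfl⟩ := ht
  refine ⟨w.1 i, w.1 j, not_val_modEq w h, ?_⟩
  rw [mul_affSwap, mul_inv_cancel_right]

theorem IsReflection.exists_lt {t : AffSym r} (ht : IsReflection t) :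
    ∃ (i j : ℤ) (h : ¬ i ≡ j [ZMOD r]), i < j ∧ t = affSwap r i j h := by
  obtain ⟨i, j, h, rfl⟩ := ht
  rcases lt_trichotomy i j with hl | hl | hl
  · exact ⟨i, j, h, hl, rfl⟩
  · exact absurd (hl ▸ rfl) h
  · exact ⟨j, i, fun e => h e.symm, hl, affSwap_comm i j h⟩

theorem rho_apply (i : ℤ) : (rho r).1 i = i + 1 := rfl

theorem rho_zpow_apply (a i : ℤ) : (rho r ^ a).1 i = i + a := by
  induction a using Int.induction_on generalizing i with
  | zero => simp
  | succ k ih => rw [zpow_add_one, mul_val_apply, rho_apply, ih]; ring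
  | pred k ih =>
    have := ih (i - 1)
    rw [show (-(k : ℤ)) = (-(k : ℤ) - 1) + 1 by ring, zpow_add_one, mul_val_apply, rho_apply] at this
    simp only [sub_add_cancel] at this
    rw [this]; ring

theorem isSimple_conj_rho (a : ℤ) {s : AffSym r} (hs : IsSimple s) :
    ∃ s', IsSimple s' ∧ s * rho r ^ a = rho r ^ a * s' := by
  obtain ⟨i, h, rfl⟩ := hs
  have h' : ¬ i - a ≡ i - a + 1 [ZMOD r] := by
    intro e
    have := e.add_right a
    rw [sub_add_cancel, show i - a + 1 + a = i + 1 by ring] at this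
    exact h this
  refine ⟨_, ⟨i - a, h', rfl⟩, ?_⟩
  rw [mul_affSwap]
  congr 1
  refine affSym_ext fun k => ?_
  simp only [affSwap_apply, rho_zpow_apply]
  congr 1 <;> ring

theorem prod_mul_rho (a : ℤ) (l : List (AffSym r)) (hl : ∀ s ∈ l, IsSimple s) :
    ∃ l' : List (AffSym r), (∀ s ∈ l', IsSimple s) ∧ l'.length = l.length ∧
      l.prod * rho r ^ a = rho r ^ a * l'.prod := by
  induction l with
  | nil => exact ⟨[], by simp, rfl, by simp⟩
  | cons s l ih =>
    obtain ⟨l', h1, h2, h3⟩ := ih fun t ht => hl t (List.mem_cons_of_mem _ ht)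
    obtain ⟨s', hs', e⟩ := isSimple_conj_rho a (hl s List.mem_cons_self)
    refine ⟨s' :: l', ?_, by simp [h2], ?_⟩
    · intro t ht
      rcases List.mem_cons.1 ht with rfl | ht
      · exact hs'
      · exact h1 t ht
    · rw [List.prod_cons, List.prod_cons, mul_assoc, h3, ← mul_assoc, e, mul_assoc]

/-- A monotone element is a power of `rho`. -/
theorem eq_rho_zpow_of_lt (w : AffSym r) (h : ∀ i, w.1 i < w.1 (i + 1)) :
    w = rho r ^ (w.1 0) := by
  have hm : StrictMono w.1 := strictMono_int_of_lt_succ h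
  have hsucc : ∀ i, w.1 (i + 1) = w.1 i + 1 := by
    intro i
    -- If a value were skipped between `w i` and `w (i + 1)`, its preimage would lie strictly
    -- between `i` and `i + 1`.
    by_contra hne
    have h1 : w.1 i + 1 < w.1 (i + 1) := by have := h i; omega
    have e := val_inv_apply w (w.1 i + 1)
    have h2 : i < w⁻¹.1 (w.1 i + 1) := hm.lt_iff_lt.1 (by rw [e]; omega)
    have h3 : w⁻¹.1 (w.1 i + 1) < i + 1 := hm.lt_iff_lt.1 (by rw [e]; exact h1)
    omega
  refine affSym_ext fun i => ?_
  rw [rho_zpow_apply]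
  induction i using Int.induction_on with
  | zero => simp
  | succ k ih => rw [hsucc, ih]; ring
  | pred k ih =>
    have := hsucc (-(k : ℤ) - 1)
    rw [sub_add_cancel] at this
    linarith

theorem not_modEq_succ_of_gt (w : AffSym r) {i : ℤ} (h : w.1 (i + 1) < w.1 i) :
    ¬ i ≡ i + 1 [ZMOD r] := by
  intro e
  have := val_sub_of_modEq w e.symm
  omega

/-- Used to start the period at an arbitrary `i`, so that `i` and `i + 1` become its first two
positions. -/
theorem sum_period_shift (f : ℤ → ℤ) (hf : ∀ i, f (i + r) = f i) (a : ℤ) :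
    ∑ k ∈ Finset.range r, f (a + k) = ∑ k ∈ Finset.range r, f k := by
  have step : ∀ a : ℤ, ∑ k ∈ Finset.range r, f (a + 1 + k) = ∑ k ∈ Finset.range r, f (a + k) := by
    intro a
    have h1 := Finset.sum_range_succ (fun k : ℕ => f (a + k)) r
    have h2 := Finset.sum_range_succ' (fun k : ℕ => f (a + k)) r
    simp only [hf, Nat.cast_zero, add_zero, Nat.cast_succ] at h1 h2
    have h3 : ∑ k ∈ Finset.range r, f (a + 1 + k) = ∑ k ∈ Finset.range r, f (a + (k + 1)) :=
      Finset.sum_congr rfl fun k _ => by congr 1; ring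
    linarith
  induction a using Int.induction_on with
  | zero => simp
  | succ k ih => rw [step, ih]
  | pred k ih => rw [← ih, ← step, sub_add_cancel]

/-- The squared displacement over one period. -/
def displacement (w : AffSym r) : ℤ := ∑ k ∈ Finset.range r, (w.1 k - k) ^ 2

theorem displacement_nonneg (w : AffSym r) : 0 ≤ displacement w :=
  Finset.sum_nonneg fun _ _ => sq_nonneg _

/-- Over the period starting at `i` only the first two summands change, and their sum drops by `2 (w
i - w (i + 1))`. -/
theorem displacement_mul_lt [NeZero r] (w : AffSym r) (i : ℤ) (h : ¬ i ≡ i + 1 [ZMOD r])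
    (hw : w.1 (i + 1) < w.1 i) :
    displacement (w * affSwap r i (i + 1) h) < displacement w := by
  have hper : ∀ u : AffSym r, displacement u
      = ∑ k ∈ Finset.range r, (u.1 (i + k) - (i + k)) ^ 2 := fun u =>
    (sum_period_shift (fun k => (u.1 k - k) ^ 2) (fun k => by rw [val_add]; ring) i).symm
  have hr : r ≠ 1 := by
    rintro rfl
    exact h (Int.modEq_one)
  rw [hper, hper]
  rcases r with _ | _ | r
  · exact absurd rfl (NeZero.ne 0)
  · exact absurd rfl hr
  · rw [Finset.sum_range_succ', Finset.sum_range_succ', Finset.sum_range_succ',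
      Finset.sum_range_succ']
    have e : ∀ k ∈ Finset.range r, ((w * affSwap (r + 1 + 1) i (i + 1) h).1 (i + ((k + 1 + 1 : ℕ) : ℤ))
        - (i + ((k + 1 + 1 : ℕ) : ℤ))) ^ 2
        = (w.1 (i + ((k + 1 + 1 : ℕ) : ℤ)) - (i + ((k + 1 + 1 : ℕ) : ℤ))) ^ 2 := by
      intro k hk
      have hk := Finset.mem_range.1 hk
      rw [mul_val_apply, affSwap_of_ne]
      · intro e
        have := Int.le_of_dvd (by push_cast; omega) (e.symm.dvd)
        push_cast at this; omega
      · intro e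
        have := Int.le_of_dvd (by push_cast; omega) (e.symm.dvd)
        push_cast at this; omega
    rw [Finset.sum_congr rfl e]
    simp only [mul_val_apply, Nat.cast_zero, add_zero, zero_add, Nat.cast_one, affSwap_left,
      affSwap_right]
    nlinarith

/-! ### Words, length, and the strong exchange property. -/

set_option linter.unusedSectionVars false

variable [NeZero r]

/-- Bubble sort: as long as `w` has a descent at some `i`, removing it lowers the displacement, and
an element without descents is a power of `rho`. This ensures that the infimum defining `len` is
over a nonempty set and hence is attained. -/
theorem exists_word (w : AffSym r) : ∃ (a : ℤ) (l : List (AffSym r)), (∀ s ∈ l, IsSimple s) ∧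
    w = rho r ^ a * l.prod := by
  induction hn : (displacement w).toNat using Nat.strong_induction_on generalizing w with
  | _ n ih =>
    by_cases hw : ∃ i, w.1 (i + 1) < w.1 i
    · obtain ⟨i, hi⟩ := hw
      have h := not_modEq_succ_of_gt w hi
      have h1 := displacement_mul_lt w i h hi
      have h2 := displacement_nonneg w
      have h3 := displacement_nonneg (w * affSwap r i (i + 1) h)
      obtain ⟨a, l, hl, e⟩ := ih _ (by omega) (w * affSwap r i (i + 1) h) rfl
      refine ⟨a, l ++ [affSwap r i (i + 1) h], ?_, ?_⟩
      · intro s hs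
        rcases List.mem_append.1 hs with hs | hs
        · exact hl s hs
        · rw [List.mem_singleton.1 hs]
          exact ⟨i, h, rfl⟩
      · rw [List.prod_append, List.prod_singleton, ← mul_assoc, ← e, mul_assoc, affSwap_mul_self,
          mul_one]
    · push Not at hw
      refine ⟨w.1 0, [], by simp, ?_⟩
      rw [List.prod_nil, mul_one]
      refine eq_rho_zpow_of_lt w fun i => lt_of_le_of_ne (hw i) fun e => ?_
      have := w.1.injective e
      omega

theorem exists_reduced_word (w : AffSym r) : ∃ (a : ℤ) (l : List (AffSym r)),
    (∀ s ∈ l, IsSimple s) ∧ l.length = len w ∧ w = rho r ^ a * l.prod := by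
  obtain ⟨a, l, hl, e⟩ := exists_word w
  exact Nat.sInf_mem (s := {k | ∃ (a : ℤ) (l : List (AffSym r)), (∀ s ∈ l, IsSimple s) ∧
    l.length = k ∧ w = rho r ^ a * l.prod}) ⟨l.length, a, l, hl, rfl, e⟩

theorem len_le_of_word (a : ℤ) (l : List (AffSym r)) (hl : ∀ s ∈ l, IsSimple s) :
    len (rho r ^ a * l.prod) ≤ l.length := Nat.sInf_le ⟨a, l, hl, rfl, rfl⟩

/-- Concatenate reduced words, after moving the power of `rho` in the middle to the left;
conjugation by it permutes the simple reflections. -/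
theorem len_mul_le (u w : AffSym r) : len (u * w) ≤ len u + len w := by
  obtain ⟨a, l, hl, hlen, e⟩ := exists_reduced_word u
  obtain ⟨b, m, hm, hlen', e'⟩ := exists_reduced_word w
  obtain ⟨l', h1, h2, h3⟩ := prod_mul_rho b l hl
  have : u * w = rho r ^ (a + b) * (l' ++ m).prod := by
    rw [e, e', List.prod_append, zpow_add, mul_assoc, mul_assoc, ← mul_assoc l.prod, h3]
    simp only [mul_assoc]
  rw [this]
  refine (len_le_of_word _ _ ?_).trans ?_
  · intro s hs
    rcases List.mem_append.1 hs with hs | hs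
    · exact h1 s hs
    · exact hm s hs
  · rw [List.length_append, h2, hlen, hlen']

theorem len_rho_zpow (a : ℤ) : len (rho r ^ a) = 0 := by
  have := len_le_of_word (r := r) a [] (by simp)
  simpa using this

theorem len_rho_zpow_mul (a : ℤ) (w : AffSym r) : len (rho r ^ a * w) = len w := by
  have h1 := len_mul_le (rho r ^ a) w
  have h2 := len_mul_le (rho r ^ (-a)) (rho r ^ a * w)
  rw [← mul_assoc, ← zpow_add, neg_add_cancel, zpow_zero, one_mul] at h2
  rw [len_rho_zpow] at h1 h2
  omega

theorem len_mul_rho_zpow (a : ℤ) (w : AffSym r) : len (w * rho r ^ a) = len w := by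
  have h1 := len_mul_le w (rho r ^ a)
  have h2 := len_mul_le (w * rho r ^ a) (rho r ^ (-a))
  rw [mul_assoc, ← zpow_add, add_neg_cancel, zpow_zero, mul_one] at h2
  rw [len_rho_zpow] at h1 h2
  omega

theorem eq_rho_zpow_of_len_eq_zero {w : AffSym r} (h : len w = 0) : ∃ a : ℤ, w = rho r ^ a := by
  obtain ⟨a, l, -, hlen, e⟩ := exists_reduced_word w
  rw [h, List.length_eq_zero_iff] at hlen
  exact ⟨a, by rw [e, hlen, List.prod_nil, mul_one]⟩

theorem len_inv_le (w : AffSym r) : len w⁻¹ ≤ len w := by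
  obtain ⟨a, l, hl, hlen, e⟩ := exists_reduced_word w
  rw [e, mul_inv_rev, ← zpow_neg, len_mul_rho_zpow, ← e, ← hlen, List.prod_inv_reverse]
  have hl' : (l.map fun x => x⁻¹) = l := by
    conv_rhs => rw [← List.map_id l]
    exact List.map_congr_left fun s hs => (hl s hs).isReflection.inv
  rw [hl']
  have := len_le_of_word (r := r) 0 l.reverse (fun s hs => hl s (List.mem_reverse.1 hs))
  simpa using this

theorem len_inv (w : AffSym r) : len w⁻¹ = len w := by
  refine le_antisymm (len_inv_le w) ?_
  have := len_inv_le w⁻¹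
  rwa [inv_inv] at this

/-- A simple reflection raises the class of `k` by one, lowers the class of `k + 1` by one and fixes
the rest, so the only pairs it can reverse are neighbours starting in the class of `k`. -/
theorem swapFun_succ_lt {i j k : ℤ} (hk : ¬ k ≡ k + 1 [ZMOD r]) (hij : i < j)
    (hne : ¬ (i ≡ k [ZMOD r] ∧ j = i + 1)) :
    (affSwap r k (k + 1) hk).1 i < (affSwap r k (k + 1) hk).1 j := by
  have bound : ∀ m, (affSwap r k (k + 1) hk).1 m = m + 1 ∧ m ≡ k [ZMOD r] ∨
      m - 1 ≤ (affSwap r k (k + 1) hk).1 m ∧ (affSwap r k (k + 1) hk).1 m ≤ m := by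
    intro m
    rw [affSwap_apply, swapFun]
    split_ifs with h1 h2
    · exact Or.inl ⟨by ring, h1⟩
    · right; constructor <;> linarith
    · right; constructor <;> linarith
  have hinj : (affSwap r k (k + 1) hk).1 i ≠ (affSwap r k (k + 1) hk).1 j := fun e => by
    have := (affSwap r k (k + 1) hk).1.injective e
    omega
  by_cases hj : j = i + 1
  · have h1 : ¬ i ≡ k [ZMOD r] := fun e => hne ⟨e, hj⟩
    rcases bound i with ⟨_, h⟩ | h
    · exact absurd h h1
    · rcases bound j with ⟨h', _⟩ | h' <;> omega
  · rcases bound i with ⟨h, _⟩ | h <;> rcases bound j with ⟨h', _⟩ | h' <;> omega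

theorem affSwap_succ_congr {i k : ℤ} (h : ¬ i ≡ i + 1 [ZMOD r]) (hk : ¬ k ≡ k + 1 [ZMOD r])
    (e : i ≡ k [ZMOD r]) : affSwap r i (i + 1) h = affSwap r k (k + 1) hk := by
  obtain ⟨m, hm⟩ := e.symm.dvd
  obtain rfl : i = k + m * r := by linarith
  have h' : ¬ k + m * r ≡ k + 1 + m * r [ZMOD r] := by
    rwa [show k + 1 + m * r = k + m * r + 1 by ring]
  rw [← affSwap_shift k (k + 1) m hk h']
  congr 1
  ring

/-- Either a reflection `(i, j)` is the simple reflection `s`, or `s` preserves the order of `i`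
and `j`. -/
theorem IsSimple.eq_or_lt {s : AffSym r} (hs : IsSimple s) {i j : ℤ} (h : ¬ i ≡ j [ZMOD r])
    (hij : i < j) : affSwap r i j h = s ∨ s.1 i < s.1 j := by
  obtain ⟨k, hk, rfl⟩ := hs
  by_cases hne : i ≡ k [ZMOD r] ∧ j = i + 1
  · obtain ⟨e, rfl⟩ := hne
    exact Or.inl (affSwap_succ_congr h hk e)
  · exact Or.inr (swapFun_succ_lt hk hij hne)

/-- The strong exchange property for products of simple reflections. -/
theorem strong_exchange_prod (l : List (AffSym r)) (hl : ∀ s ∈ l, IsSimple s) {i j : ℤ}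
    (h : ¬ i ≡ j [ZMOD r]) (hij : i < j) (hw : l.prod⁻¹.1 j < l.prod⁻¹.1 i) :
    ∃ l' : List (AffSym r), (∀ s ∈ l', IsSimple s) ∧ l'.length < l.length ∧
      affSwap r i j h * l.prod = l'.prod := by
  induction l generalizing i j with
  | nil =>
    simp only [List.prod_nil, inv_one, one_val_apply] at hw
    omega
  | cons s l ih =>
    have hs := hl s List.mem_cons_self
    have hl' : ∀ s ∈ l, IsSimple s := fun t ht => hl t (List.mem_cons_of_mem _ ht)
    -- If the reflection is the first letter, that letter is deleted. Otherwise the reflection is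
    -- conjugated past the first letter, which keeps `i` and `j` in order, so the inversion is
    -- passed on to the rest of the word.
    rcases hs.eq_or_lt h hij with e | hlt
    · refine ⟨l, hl', by simp, ?_⟩
      rw [List.prod_cons, e, hs.isReflection.mul_cancel_left]
    · rw [List.prod_cons, mul_inv_rev, hs.isReflection.inv] at hw
      obtain ⟨l', h1, h2, h3⟩ := ih hl' (not_val_modEq s h) hlt hw
      refine ⟨s :: l', ?_, by simpa using h2, ?_⟩
      · intro t ht
        rcases List.mem_cons.1 ht with rfl | ht
        · exact hs
        · exact h1 t ht
      · rw [List.prod_cons, List.prod_cons, ← h3, ← mul_assoc, ← mul_assoc, mul_affSwap]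
        simp only [← mul_val_apply, hs.isReflection.mul_self, one_val_apply]

/-- Exchange applied to a reduced word: the power of `rho` in front is a translation, so it
conjugates the reflection to another one without disturbing the order of the pair. -/
theorem len_affSwap_mul_lt {w : AffSym r} {i j : ℤ} (h : ¬ i ≡ j [ZMOD r]) (hij : i < j)
    (hw : w⁻¹.1 j < w⁻¹.1 i) : len (affSwap r i j h * w) < len w := by
  obtain ⟨a, l, hl, hlen, e⟩ := exists_reduced_word w
  have hinv : ∀ k, w⁻¹.1 k = l.prod⁻¹.1 ((rho r ^ (-a)).1 k) := fun k => by
    rw [← mul_val_apply, zpow_neg, ← mul_inv_rev, ← e]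
  rw [hinv, hinv] at hw
  have h2 : (rho r ^ (-a)).1 i < (rho r ^ (-a)).1 j := by
    rw [rho_zpow_apply, rho_zpow_apply]; omega
  obtain ⟨l', h3, h4, h5⟩ := strong_exchange_prod l hl (not_val_modEq _ h) h2 hw
  have h6 : affSwap r i j h * w = rho r ^ a * l'.prod := by
    rw [← h5, ← mul_assoc, mul_affSwap]
    simp only [← mul_val_apply, ← zpow_add, add_neg_cancel, zpow_zero, one_val_apply]
    rw [mul_assoc, ← e]
  rw [h6, ← hlen]
  exact (len_le_of_word _ _ h3).trans_lt h4

theorem len_lt_affSwap_mul {w : AffSym r} {i j : ℤ} (h : ¬ i ≡ j [ZMOD r]) (hij : i < j)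
    (hw : w⁻¹.1 i < w⁻¹.1 j) : len w < len (affSwap r i j h * w) := by
  have := len_affSwap_mul_lt (w := affSwap r i j h * w) h hij (by
    rwa [mul_inv_rev, affSwap_inv, mul_val_apply, mul_val_apply, affSwap_left, affSwap_right])
  rwa [← mul_assoc, affSwap_mul_self, one_mul] at this

theorem inv_val_ne {w : AffSym r} {i j : ℤ} (h : i ≠ j) : w.1 i ≠ w.1 j :=
  fun e => h (w.1.injective e)

theorem len_affSwap_mul_lt_iff {w : AffSym r} {i j : ℤ} (h : ¬ i ≡ j [ZMOD r]) (hij : i < j) :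
    len (affSwap r i j h * w) < len w ↔ w⁻¹.1 j < w⁻¹.1 i := by
  refine ⟨fun hl => ?_, len_affSwap_mul_lt h hij⟩
  by_contra hc
  have := len_lt_affSwap_mul h hij
    (lt_of_le_of_ne (not_lt.1 hc) (inv_val_ne (w := w⁻¹) hij.ne))
  omega

theorem len_lt_affSwap_mul_iff {w : AffSym r} {i j : ℤ} (h : ¬ i ≡ j [ZMOD r]) (hij : i < j) :
    len w < len (affSwap r i j h * w) ↔ w⁻¹.1 i < w⁻¹.1 j := by
  refine ⟨fun hl => ?_, len_lt_affSwap_mul h hij⟩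
  by_contra hc
  have := len_affSwap_mul_lt h hij
    (lt_of_le_of_ne (not_lt.1 hc) (inv_val_ne (w := w⁻¹) hij.ne'))
  omega

theorem len_mul_affSwap (w : AffSym r) {i j : ℤ} (h : ¬ i ≡ j [ZMOD r]) :
    len (w * affSwap r i j h) = len (affSwap r i j h * w⁻¹) := by
  rw [← len_inv, mul_inv_rev, affSwap_inv]

theorem len_mul_affSwap_lt_iff {w : AffSym r} {i j : ℤ} (h : ¬ i ≡ j [ZMOD r]) (hij : i < j) :
    len (w * affSwap r i j h) < len w ↔ w.1 j < w.1 i := by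
  rw [len_mul_affSwap, ← len_inv w, len_affSwap_mul_lt_iff h hij, inv_inv]

/-- This takes the place of the parity of the length: in combination with the triangle inequality it
shows that a simple reflection changes the length by exactly one. -/
theorem IsReflection.len_mul_ne {t : AffSym r} (ht : IsReflection t) (w : AffSym r) :
    len (t * w) ≠ len w := by
  obtain ⟨i, j, h, hij, rfl⟩ := ht.exists_lt
  rcases lt_or_gt_of_ne (inv_val_ne (w := w⁻¹) hij.ne) with h1 | h1
  · exact (len_lt_affSwap_mul h hij h1).ne'
  · exact (len_affSwap_mul_lt h hij h1).ne

theorem IsSimple.len_le_one {s : AffSym r} (hs : IsSimple s) : len s ≤ 1 := by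
  have := len_le_of_word (r := r) 0 [s] (by simpa using hs)
  simpa using this

theorem IsSimple.len_eq_one {s : AffSym r} (hs : IsSimple s) : len s = 1 := by
  have h1 := hs.len_le_one
  have h2 := hs.isReflection.len_mul_ne 1
  rw [mul_one, len_one] at h2
  omega

theorem IsSimple.len_mul {s : AffSym r} (hs : IsSimple s) (w : AffSym r) :
    len (s * w) = len w + 1 ∨ len (s * w) + 1 = len w := by
  have h1 := len_mul_le s w
  have h2 := len_mul_le s (s * w)
  rw [hs.isReflection.mul_cancel_left] at h2
  have h3 := hs.isReflection.len_mul_ne w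
  have h4 := hs.len_eq_one
  omega

theorem IsSimple.len_mul_right {s : AffSym r} (hs : IsSimple s) (w : AffSym r) :
    len (w * s) = len w + 1 ∨ len (w * s) + 1 = len w := by
  have := hs.len_mul w⁻¹
  rwa [← len_inv, mul_inv_rev, inv_inv, hs.isReflection.inv, len_inv] at this

/-- Without a left descent, `w⁻¹` would be strictly increasing, hence a power of `rho` and of length
zero. -/
theorem exists_left_descent {w : AffSym r} (h : len w ≠ 0) :
    ∃ s, IsSimple s ∧ len (s * w) + 1 = len w := by
  by_contra! hc
  apply h
  have hmono : ∀ i, w⁻¹.1 i < w⁻¹.1 (i + 1) := by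
    intro i
    by_contra hlt
    have hlt' := lt_of_le_of_ne (not_lt.1 hlt) (inv_val_ne (w := w⁻¹) (by omega))
    have hi := not_modEq_succ_of_gt w⁻¹ hlt'
    have hs : IsSimple (affSwap r i (i + 1) hi) := ⟨i, hi, rfl⟩
    have h1 := len_affSwap_mul_lt hi (by omega) hlt'
    have h2 := hs.len_mul w
    have h3 := hc _ hs
    omega
  rw [← len_inv, eq_rho_zpow_of_lt w⁻¹ hmono, len_rho_zpow]

/-- Induction on the length by left multiplication with simple reflections. -/
theorem len_induction {P : AffSym r → Prop} (h0 : ∀ a : ℤ, P (rho r ^ a))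
    (h1 : ∀ s w, IsSimple s → len (s * w) = len w + 1 → P w → P (s * w)) (w : AffSym r) : P w := by
  induction hn : len w generalizing w with
  | zero =>
    obtain ⟨a, rfl⟩ := eq_rho_zpow_of_len_eq_zero hn
    exact h0 a
  | succ n ih =>
    obtain ⟨s, hs, e⟩ := exists_left_descent (w := w) (by omega)
    have := h1 s (s * w) hs (by rw [hs.isReflection.mul_cancel_left]; omega) (ih _ (by omega))
    rwa [hs.isReflection.mul_cancel_left] at this

end Group

/-! ### The Bruhat order and its lifting property. -/

section Bruhat

set_option linter.unusedSectionVars false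

variable {r : ℕ} [NeZero r]

theorem BruhatLE.refl (w : AffSym r) : BruhatLE w w := Relation.ReflTransGen.refl

theorem BruhatLE.trans {x y z : AffSym r} (h : BruhatLE x y) (h' : BruhatLE y z) :
    BruhatLE x z := Relation.ReflTransGen.trans h h'

theorem BruhatLE.of_reflection {t w : AffSym r} (ht : IsReflection t) (h : len w < len (t * w)) :
    BruhatLE w (t * w) := Relation.ReflTransGen.single ⟨t, ht, rfl, h⟩

theorem BruhatLE.eq_or_len_lt {y w : AffSym r} (h : BruhatLE y w) : y = w ∨ len y < len w := by
  induction h with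
  | refl => exact Or.inl rfl
  | tail _ hs ih =>
    obtain ⟨t, _, _, hlt⟩ := hs
    rcases ih with rfl | ih
    · exact Or.inr hlt
    · exact Or.inr (ih.trans hlt)

theorem BruhatLE.len_le {y w : AffSym r} (h : BruhatLE y w) : len y ≤ len w := by
  rcases h.eq_or_len_lt with rfl | h
  · exact le_rfl
  · exact h.le

theorem BruhatLE.len_lt {y w : AffSym r} (h : BruhatLE y w) (hne : y ≠ w) : len y < len w :=
  h.eq_or_len_lt.resolve_left hne

theorem BruhatLE.inv {y w : AffSym r} (h : BruhatLE y w) : BruhatLE y⁻¹ w⁻¹ := by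
  induction h with
  | refl => exact BruhatLE.refl _
  | @tail a b _ hs ih =>
    obtain ⟨t, ht, rfl, hlt⟩ := hs
    refine ih.trans ?_
    -- The inverse turns left multiplication by `t` into right multiplication; conjugation by `a⁻¹`
    -- turns it back into left multiplication by a reflection.
    have e : (t * a)⁻¹ = (a⁻¹ * t * a⁻¹⁻¹) * a⁻¹ := by
      rw [mul_inv_rev, ht.inv, mul_assoc, inv_mul_cancel, mul_one]
    have h1 := BruhatLE.of_reflection (w := a⁻¹) (ht.conj a⁻¹) (by rw [← e, len_inv, len_inv]; exact hlt)
    rwa [← e] at h1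

/-- Left multiplication by a simple reflection `s` preserves the ascents given by reflections
other than `s`. -/
theorem IsSimple.len_lt_of_ne {s t a : AffSym r} (hs : IsSimple s) (ht : IsReflection t)
    (hne : t ≠ s) (h : len a < len (t * a)) : len (s * a) < len (s * (t * a)) := by
  obtain ⟨i, j, hij, hlt, rfl⟩ := ht.exists_lt
  rcases hs.eq_or_lt hij hlt with e | hl
  · exact absurd e hne
  · rw [len_lt_affSwap_mul_iff hij hlt] at h
    rw [← mul_assoc, mul_affSwap, mul_assoc]
    refine len_lt_affSwap_mul _ hl ?_
    rwa [mul_inv_rev, mul_val_apply, mul_val_apply, inv_val_apply, inv_val_apply]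

/-- The element of `{w, s w}` of smaller length. -/
def downL (s w : AffSym r) : AffSym r := if len (s * w) < len w then s * w else w

theorem downL_eq_or (s w : AffSym r) : downL s w = s * w ∨ downL s w = w := by
  unfold downL; split_ifs <;> simp

theorem downL_of_lt {s w : AffSym r} (h : len (s * w) < len w) : downL s w = s * w := if_pos h

theorem IsSimple.downL_mul {s : AffSym r} (hs : IsSimple s) (w : AffSym r) :
    downL s (s * w) = downL s w := by
  unfold downL
  rw [hs.isReflection.mul_cancel_left]
  have := hs.isReflection.len_mul_ne w
  split_ifs <;> first | rfl | omega

theorem IsSimple.downL_le {s : AffSym r} (hs : IsSimple s) (w : AffSym r) :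
    BruhatLE (downL s w) w := by
  unfold downL
  split_ifs with h
  · have := BruhatLE.of_reflection (w := s * w) hs.isReflection
      (by rwa [hs.isReflection.mul_cancel_left])
    rwa [hs.isReflection.mul_cancel_left] at this
  · exact BruhatLE.refl w

theorem IsSimple.downL_le_mul {s : AffSym r} (hs : IsSimple s) (w : AffSym r) :
    BruhatLE (downL s w) (s * w) := by
  rw [← hs.downL_mul]; exact hs.downL_le _

/-- The lifting property, phrased as monotonicity of the projection to the smaller element of `{w, s
w}`. In a link `a < t a` with `t = s` both ends project to the same element; if `t ≠ s`, then `s a <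
s t a` is again a link, by the reflection `s t s⁻¹`. -/
theorem IsSimple.downL_mono {s : AffSym r} (hs : IsSimple s) {y w : AffSym r} (h : BruhatLE y w) :
    BruhatLE (downL s y) (downL s w) := by
  induction h with
  | refl => exact BruhatLE.refl _
  | @tail a b _ hst ih =>
    obtain ⟨t, ht, rfl, hlt⟩ := hst
    refine ih.trans ?_
    by_cases hts : t = s
    · rw [hts, hs.downL_mul]; exact BruhatLE.refl _
    · rcases downL_eq_or s (t * a) with e | e <;> rw [e]
      · refine (hs.downL_le_mul a).trans ?_
        have h1 := hs.len_lt_of_ne ht hts hlt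
        have e2 : s * (t * a) = (s * t * s⁻¹) * (s * a) := by group
        rw [e2] at h1 ⊢
        exact BruhatLE.of_reflection (ht.conj s) h1
      · exact (hs.downL_le a).trans (BruhatLE.of_reflection ht hlt)

/-- The element of `{w, w s}` of smaller length. -/
def downR (s w : AffSym r) : AffSym r := (downL s w⁻¹)⁻¹

theorem IsSimple.downR_eq_or {s : AffSym r} (hs : IsSimple s) (w : AffSym r) :
    downR s w = w * s ∨ downR s w = w := by
  unfold downR
  rcases downL_eq_or s w⁻¹ with e | e <;> rw [e]
  · left; rw [mul_inv_rev, inv_inv, hs.isReflection.inv]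
  · right; rw [inv_inv]

theorem IsSimple.downR_of_lt {s w : AffSym r} (hs : IsSimple s) (h : len (w * s) < len w) :
    downR s w = w * s := by
  unfold downR
  rw [downL_of_lt, mul_inv_rev, inv_inv, hs.isReflection.inv]
  rwa [← len_inv, mul_inv_rev, inv_inv, hs.isReflection.inv, len_inv]

theorem IsSimple.downR_le {s : AffSym r} (hs : IsSimple s) (w : AffSym r) :
    BruhatLE (downR s w) w := by
  have := (hs.downL_le w⁻¹).inv
  rwa [inv_inv] at this

theorem IsSimple.downR_mono {s : AffSym r} (hs : IsSimple s) {y w : AffSym r} (h : BruhatLE y w) :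
    BruhatLE (downR s y) (downR s w) :=
  (hs.downL_mono h.inv).inv

/-- The element of `{w, s w}` of larger length. -/
def upL (s w : AffSym r) : AffSym r := if len w < len (s * w) then s * w else w

theorem upL_eq_or (s w : AffSym r) : upL s w = s * w ∨ upL s w = w := by
  unfold upL; split_ifs <;> simp

theorem IsSimple.upL_mul {s : AffSym r} (hs : IsSimple s) (w : AffSym r) :
    upL s (s * w) = upL s w := by
  unfold upL
  rw [hs.isReflection.mul_cancel_left]
  have := hs.isReflection.len_mul_ne w
  split_ifs <;> first | rfl | omega

theorem IsSimple.le_upL {s : AffSym r} (hs : IsSimple s) (w : AffSym r) :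
    BruhatLE w (upL s w) := by
  unfold upL
  split_ifs with h
  · exact BruhatLE.of_reflection hs.isReflection h
  · exact BruhatLE.refl w

theorem IsSimple.mul_le_upL {s : AffSym r} (hs : IsSimple s) (w : AffSym r) :
    BruhatLE (s * w) (upL s w) := by
  rw [← hs.upL_mul]; exact hs.le_upL _

/-- The dual of `IsSimple.downL_mono`, by the same case distinction on each link. -/
theorem IsSimple.upL_mono {s : AffSym r} (hs : IsSimple s) {y w : AffSym r} (h : BruhatLE y w) :
    BruhatLE (upL s y) (upL s w) := by
  induction h with
  | refl => exact BruhatLE.refl _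
  | @tail a b _ hst ih =>
    obtain ⟨t, ht, rfl, hlt⟩ := hst
    refine ih.trans ?_
    by_cases hts : t = s
    · rw [hts, hs.upL_mul]; exact BruhatLE.refl _
    · rcases upL_eq_or s a with e | e <;> rw [e]
      · refine BruhatLE.trans ?_ (hs.mul_le_upL (t * a))
        have h1 := hs.len_lt_of_ne ht hts hlt
        have e2 : s * (t * a) = (s * t * s⁻¹) * (s * a) := by group
        rw [e2] at h1 ⊢
        exact BruhatLE.of_reflection (ht.conj s) h1
      · exact (BruhatLE.of_reflection ht hlt).trans (hs.le_upL _)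

/-- Left multiplication by an ascending simple reflection is monotone. -/
theorem IsSimple.mul_le_mul {s : AffSym r} (hs : IsSimple s) {y w : AffSym r} (h : BruhatLE y w)
    (hw : len w < len (s * w)) : BruhatLE (s * y) (s * w) := by
  have h1 := (hs.mul_le_upL y).trans (hs.upL_mono h)
  rwa [upL, if_pos hw] at h1

end Bruhat

/-! ### The regular representation and the basis of the `T_w`. -/

section HeckeBasis

set_option linter.unusedSectionVars false

variable {r : ℕ} [NeZero r]

theorem len_induction_right {P : AffSym r → Prop} (h0 : ∀ a : ℤ, P (rho r ^ a))
    (h1 : ∀ s w, IsSimple s → len (w * s) = len w + 1 → P w → P (w * s)) (w : AffSym r) : P w := by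
  have := len_induction (P := fun w => P w⁻¹) (fun a => by simpa using h0 (-a))
    (fun s w hs hl hw => by
      rw [mul_inv_rev, hs.isReflection.inv]
      refine h1 s w⁻¹ hs ?_ hw
      rw [len_inv, ← hl, ← len_inv, mul_inv_rev, inv_inv, hs.isReflection.inv]) w⁻¹
  simpa using this

/-- Write `w t = t' w` with the reflection `t' = w t w⁻¹`. The hypothesis says `t' ≠ s`, and then
`s` preserves the direction in which `t'` changes the length. -/
theorem IsSimple.len_lt_mul_mul_iff {s t : AffSym r} (hs : IsSimple s) (ht : IsSimple t)
    (w : AffSym r) (hne : s * w ≠ w * t) :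
    len (s * w) < len (s * (w * t)) ↔ len w < len (w * t) := by
  have hr := ht.isReflection.conj w
  have e : w * t = (w * t * w⁻¹) * w := by group
  have hne' : w * t * w⁻¹ ≠ s := fun h => hne (by rw [← h]; group)
  have e' : w = (w * t * w⁻¹) * (w * t) := by
    have h := hr.mul_cancel_left w
    rw [← e] at h
    exact h.symm
  constructor
  · intro h
    by_contra hc
    have h2 : len (w * t) < len w := by rcases ht.len_mul_right w with h | h <;> omega
    have h3 := hs.len_lt_of_ne hr hne' (a := w * t) (by rwa [← e'])
    rw [← e'] at h3
    omega
  · intro h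
    have h3 := hs.len_lt_of_ne hr hne' (a := w) (by rwa [← e])
    rwa [← e] at h3

theorem IsSimple.len_lt_mul_mul_iff' {s t : AffSym r} (hs : IsSimple s) (ht : IsSimple t)
    (w : AffSym r) (hne : s * w ≠ w * t) :
    len (w * t) < len (s * (w * t)) ↔ len w < len (s * w) := by
  have h := ht.len_lt_mul_mul_iff hs w⁻¹ (fun e => hne (by
    have := congrArg (fun x => x⁻¹) e
    simpa only [mul_inv_rev, inv_inv, ht.isReflection.inv, hs.isReflection.inv] using this.symm))
  have e1 : t * w⁻¹ = (w * t)⁻¹ := by rw [mul_inv_rev, ht.isReflection.inv]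
  have e2 : w⁻¹ * s = (s * w)⁻¹ := by rw [mul_inv_rev, hs.isReflection.inv]
  have e3 : t * (w⁻¹ * s) = (s * (w * t))⁻¹ := by
    rw [mul_inv_rev, mul_inv_rev, hs.isReflection.inv, ht.isReflection.inv, mul_assoc]
  rwa [e1, e3, e2, len_inv, len_inv, len_inv, len_inv] at h

/-- The free module on the group. -/
abbrev FreeMod (r : ℕ) : Type := AffSym r →₀ Zv

/-- The basis vector of `FreeMod`. -/
abbrev ev (w : AffSym r) : FreeMod r := Finsupp.single w 1

open Classical in
/-- The coefficient of `s w` in the product of `T_s` and `T_w`. -/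
def upCoeff (w w' : AffSym r) : Zv := if len w < len w' then 1 else vpow 2

open Classical in
/-- The coefficient of `w` in the product of `T_s` and `T_w`. -/
def stayCoeff (w w' : AffSym r) : Zv := if len w < len w' then 0 else vpow 2 - 1

/-- Left multiplication by `T_s`. -/
def lop (s : AffSym r) : Module.End Zv (FreeMod r) :=
  Finsupp.linearCombination Zv fun w => upCoeff w (s * w) • ev (s * w) + stayCoeff w (s * w) • ev w

/-- Right multiplication by `T_s`. -/
def rop (s : AffSym r) : Module.End Zv (FreeMod r) :=
  Finsupp.linearCombination Zv fun w => upCoeff w (w * s) • ev (w * s) + stayCoeff w (w * s) • ev w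

/-- Left translation. -/
def ltrans (u : AffSym r) : Module.End Zv (FreeMod r) :=
  Finsupp.linearCombination Zv fun w => ev (u * w)

/-- Right translation. -/
def rtrans (u : AffSym r) : Module.End Zv (FreeMod r) :=
  Finsupp.linearCombination Zv fun w => ev (w * u)

theorem lop_ev (s w : AffSym r) :
    lop s (ev w) = upCoeff w (s * w) • ev (s * w) + stayCoeff w (s * w) • ev w := by
  simp only [lop, Finsupp.linearCombination_single, one_smul]

theorem rop_ev (s w : AffSym r) :
    rop s (ev w) = upCoeff w (w * s) • ev (w * s) + stayCoeff w (w * s) • ev w := by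
  simp only [rop, Finsupp.linearCombination_single, one_smul]

theorem ltrans_ev (u w : AffSym r) : ltrans u (ev w) = ev (u * w) := by
  simp only [ltrans, Finsupp.linearCombination_single, one_smul]

theorem rtrans_ev (u w : AffSym r) : rtrans u (ev w) = ev (w * u) := by
  simp only [rtrans, Finsupp.linearCombination_single, one_smul]

theorem end_ext {f g : Module.End Zv (FreeMod r)} (h : ∀ w, f (ev w) = g (ev w)) : f = g :=
  Finsupp.lhom_ext' fun w => LinearMap.ext_ring (h w)

/-- This commutation is what makes the free module a faithful model. When `s w = w t`, both sides
are visibly the same combination. Otherwise multiplication by `t` on the right does not affect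
whether `s` is an ascent on the left, and conversely, so the coefficients of the two operators are
independent. -/
theorem lop_mul_rop {s t : AffSym r} (hs : IsSimple s) (ht : IsSimple t) :
    lop s * rop t = rop t * lop s := by
  refine end_ext fun w => ?_
  simp only [Module.End.mul_apply, lop_ev, rop_ev, map_add, map_smul]
  by_cases hne : s * w = w * t
  · have e1 : s * (w * t) = w := by rw [← hne, hs.isReflection.mul_cancel_left]
    have e2 : s * w * t = w := by rw [hne, ht.isReflection.mul_cancel_right]
    rw [e1, e2, ← hne]
  · have h1 := hs.len_lt_mul_mul_iff ht w hne
    have h2 := hs.len_lt_mul_mul_iff' ht w hne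
    rw [mul_assoc]
    unfold upCoeff stayCoeff
    simp only [h1, h2, smul_add, smul_smul]
    module

theorem upCoeff_of_len_eq {a b c d : AffSym r} (h1 : len a = len c) (h2 : len b = len d) :
    upCoeff a b = upCoeff c d := by rw [upCoeff, upCoeff, h1, h2]

theorem stayCoeff_of_len_eq {a b c d : AffSym r} (h1 : len a = len c) (h2 : len b = len d) :
    stayCoeff a b = stayCoeff c d := by rw [stayCoeff, stayCoeff, h1, h2]

theorem lop_mul_rtrans (s : AffSym r) (a : ℤ) :
    lop s * rtrans (rho r ^ a) = rtrans (rho r ^ a) * lop s := by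
  refine end_ext fun w => ?_
  simp only [Module.End.mul_apply, lop_ev, rtrans_ev, map_add, map_smul]
  rw [upCoeff_of_len_eq (c := w) (d := s * w) (len_mul_rho_zpow _ _)
    (by rw [← mul_assoc, len_mul_rho_zpow]), stayCoeff_of_len_eq (c := w) (d := s * w)
    (len_mul_rho_zpow _ _) (by rw [← mul_assoc, len_mul_rho_zpow]), mul_assoc]

theorem ltrans_mul_rop (s : AffSym r) (a : ℤ) :
    ltrans (rho r ^ a) * rop s = rop s * ltrans (rho r ^ a) := by
  refine end_ext fun w => ?_
  simp only [Module.End.mul_apply, rop_ev, ltrans_ev, map_add, map_smul]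
  rw [upCoeff_of_len_eq (a := rho r ^ a * w) (c := w) (d := w * s) (len_rho_zpow_mul _ _)
    (by rw [mul_assoc, len_rho_zpow_mul]), stayCoeff_of_len_eq (a := rho r ^ a * w) (c := w)
    (d := w * s) (len_rho_zpow_mul _ _) (by rw [mul_assoc, len_rho_zpow_mul]), mul_assoc]

theorem ltrans_mul_rtrans (u u' : AffSym r) : ltrans u * rtrans u' = rtrans u' * ltrans u := by
  refine end_ext fun w => ?_
  simp only [Module.End.mul_apply, rtrans_ev, ltrans_ev, mul_assoc]

/-- Endomorphisms commuting with all right operators. -/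
def leftAlg (r : ℕ) : Subalgebra Zv (Module.End Zv (FreeMod r)) :=
  Subalgebra.centralizer Zv
    ({f | ∃ s : AffSym r, IsSimple s ∧ f = rop s} ∪ {f | ∃ a : ℤ, f = rtrans (rho r ^ a)})

theorem leftAlg_rop {f : Module.End Zv (FreeMod r)} (hf : f ∈ leftAlg r) {s : AffSym r}
    (hs : IsSimple s) (x : FreeMod r) : f (rop s x) = rop s (f x) := by
  have := (Subalgebra.mem_centralizer_iff Zv).1 hf (rop s) (Or.inl ⟨s, hs, rfl⟩)
  exact (LinearMap.congr_fun this x).symm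

theorem leftAlg_rtrans {f : Module.End Zv (FreeMod r)} (hf : f ∈ leftAlg r) (a : ℤ)
    (x : FreeMod r) : f (rtrans (rho r ^ a) x) = rtrans (rho r ^ a) (f x) := by
  have := (Subalgebra.mem_centralizer_iff Zv).1 hf (rtrans (rho r ^ a)) (Or.inr ⟨a, rfl⟩)
  exact (LinearMap.congr_fun this x).symm

theorem lop_mem {s : AffSym r} (hs : IsSimple s) : lop s ∈ leftAlg r := by
  refine (Subalgebra.mem_centralizer_iff Zv).2 ?_
  rintro _ (⟨t, ht, rfl⟩ | ⟨a, rfl⟩)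
  · exact (lop_mul_rop hs ht).symm
  · exact (lop_mul_rtrans s a).symm

theorem ltrans_mem (a : ℤ) : ltrans (rho r ^ a) ∈ leftAlg r := by
  refine (Subalgebra.mem_centralizer_iff Zv).2 ?_
  rintro _ (⟨t, ht, rfl⟩ | ⟨b, rfl⟩)
  · exact (ltrans_mul_rop t a).symm
  · exact (ltrans_mul_rtrans _ _).symm

/-- Right operators carry the basis vector at `1` to every basis vector, and the elements of
`leftAlg` commute with them. Every Hecke relation between left operators can therefore be checked at
`1` alone. -/
theorem leftAlg_ext {f g : Module.End Zv (FreeMod r)} (hf : f ∈ leftAlg r) (hg : g ∈ leftAlg r)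
    (h : f (ev 1) = g (ev 1)) : f = g := by
  refine end_ext fun w => ?_
  induction w using len_induction_right with
  | h0 a =>
    have := rtrans_ev (rho r ^ a) 1
    rw [one_mul] at this
    rw [← this, leftAlg_rtrans hf, leftAlg_rtrans hg, h]
  | h1 s w hs hl ih =>
    have : rop s (ev w) = ev (w * s) := by
      rw [rop_ev, upCoeff, stayCoeff, if_pos (by omega), if_pos (by omega), one_smul, zero_smul,
        add_zero]
    rw [← this, leftAlg_rop hf hs, leftAlg_rop hg hs, ih]

theorem exists_leftOp (w : AffSym r) : ∃ f ∈ leftAlg r, f (ev 1) = ev w := by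
  induction w using len_induction with
  | h0 a => exact ⟨_, ltrans_mem a, by rw [ltrans_ev, mul_one]⟩
  | h1 s w hs hl ih =>
    obtain ⟨f, hf, e⟩ := ih
    refine ⟨lop s * f, mul_mem (lop_mem hs) hf, ?_⟩
    rw [Module.End.mul_apply, e, lop_ev, upCoeff, stayCoeff, if_pos (by omega), if_pos (by omega),
      one_smul, zero_smul, add_zero]

/-- The operator of left multiplication by `T_w`. -/
def leftOp (w : AffSym r) : Module.End Zv (FreeMod r) := (exists_leftOp w).choose

theorem leftOp_mem (w : AffSym r) : leftOp w ∈ leftAlg r := (exists_leftOp w).choose_spec.1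

theorem leftOp_one (w : AffSym r) : leftOp w (ev 1) = ev w := (exists_leftOp w).choose_spec.2

theorem lop_ev_of_lt {s w : AffSym r} (h : len w < len (s * w)) : lop s (ev w) = ev (s * w) := by
  rw [lop_ev, upCoeff, stayCoeff, if_pos h, if_pos h, one_smul, zero_smul, add_zero]

theorem leftOp_simple {s : AffSym r} (hs : IsSimple s) : leftOp s = lop s :=
  leftAlg_ext (leftOp_mem s) (lop_mem hs) (by
    rw [leftOp_one, lop_ev_of_lt, mul_one]
    rw [mul_one, len_one, hs.len_eq_one]; omega)

/-- If the lengths of `s u` and `w'` add, then so do those of `u` and `w'`, and the remaining step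
by `s` is an ascent. -/
theorem leftOp_ev (w w' : AffSym r) (h : len (w * w') = len w + len w') :
    leftOp w (ev w') = ev (w * w') := by
  induction w using len_induction generalizing w' with
  | h0 a =>
    rw [leftAlg_ext (leftOp_mem _) (ltrans_mem a) (by rw [leftOp_one, ltrans_ev, mul_one]),
      ltrans_ev]
  | h1 s u hs hl ih =>
    have e : leftOp (s * u) = lop s * leftOp u :=
      leftAlg_ext (leftOp_mem _) (mul_mem (lop_mem hs) (leftOp_mem u)) (by
        rw [leftOp_one, Module.End.mul_apply, leftOp_one, lop_ev_of_lt (by omega)])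
    have h2 := len_mul_le u w'
    rw [mul_assoc] at h
    have h3 := hs.len_mul (u * w')
    rw [e, Module.End.mul_apply, ih _ (by omega), lop_ev_of_lt (by omega), mul_assoc]

theorem leftOp_mul (w w' : AffSym r) (h : len (w * w') = len w + len w') :
    leftOp w * leftOp w' = leftOp (w * w') :=
  leftAlg_ext (mul_mem (leftOp_mem _) (leftOp_mem _)) (leftOp_mem _) (by
    rw [Module.End.mul_apply, leftOp_one, leftOp_one, leftOp_ev _ _ h])

theorem leftOp_simple_sq {s : AffSym r} (hs : IsSimple s) :
    leftOp s * leftOp s = (vpow 2 - 1) • leftOp s + vpow 2 • 1 := by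
  refine leftAlg_ext (mul_mem (leftOp_mem _) (leftOp_mem _))
    (add_mem (Subalgebra.smul_mem _ (leftOp_mem _) _) (Subalgebra.smul_mem _ (one_mem _) _)) ?_
  rw [Module.End.mul_apply, LinearMap.add_apply, LinearMap.smul_apply, LinearMap.smul_apply,
    leftOp_one, Module.End.one_apply, leftOp_simple hs, lop_ev, hs.isReflection.mul_self, upCoeff,
    stayCoeff, if_neg (by rw [len_one]; omega), if_neg (by rw [len_one]; omega), add_comm]

/-- The left regular representation of the Hecke algebra on the free module. -/
def regRep (r : ℕ) [NeZero r] : Hecke r →ₐ[Zv] Module.End Zv (FreeMod r) :=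
  RingQuot.liftAlgHom Zv (s := HeckeRel r) ⟨FreeAlgebra.lift Zv leftOp, by
    intro x y h
    induction h with
    | one =>
      rw [FreeAlgebra.lift_ι_apply, map_one]
      exact leftAlg_ext (leftOp_mem _) (one_mem _) (by rw [leftOp_one, Module.End.one_apply])
    | quad s hs =>
      simp only [map_mul, map_add, map_smul, FreeAlgebra.lift_ι_apply, map_one]
      exact leftOp_simple_sq hs
    | mul w w' h =>
      rw [map_mul, FreeAlgebra.lift_ι_apply, FreeAlgebra.lift_ι_apply, FreeAlgebra.lift_ι_apply,
        leftOp_mul _ _ h]⟩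

theorem regRep_TT (w : AffSym r) : regRep r (TT w) = leftOp w := by
  refine (RingQuot.liftAlgHom_mkAlgHom_apply ..).trans ?_
  exact FreeAlgebra.lift_ι_apply _ _

theorem TT_one : TT (1 : AffSym r) = 1 :=
  (RingQuot.mkAlgHom_rel Zv (HeckeRel.one (r := r))).trans (map_one _)

theorem TT_mul (w w' : AffSym r) (h : len (w * w') = len w + len w') :
    TT w * TT w' = TT (w * w') :=
  (map_mul (RingQuot.mkAlgHom Zv (HeckeRel r)) _ _).symm.trans
    (RingQuot.mkAlgHom_rel Zv (HeckeRel.mul w w' h))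

theorem TT_simple_sq {s : AffSym r} (hs : IsSimple s) :
    TT s * TT s = (vpow 2 - 1) • TT s + vpow 2 • (1 : Hecke r) := by
  refine (map_mul (RingQuot.mkAlgHom Zv (HeckeRel r)) _ _).symm.trans
    ((RingQuot.mkAlgHom_rel Zv (HeckeRel.quad s hs)).trans ?_)
  rw [map_add, map_smul, map_smul, map_one]
  rfl

theorem TT_simple_mul_of_lt {s w : AffSym r} (hs : IsSimple s) (h : len w < len (s * w)) :
    TT s * TT w = TT (s * w) :=
  TT_mul _ _ (by have := hs.len_mul w; have := hs.len_eq_one; omega)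

theorem TT_simple_mul_of_gt {s w : AffSym r} (hs : IsSimple s) (h : len (s * w) < len w) :
    TT s * TT w = vpow 2 • TT (s * w) + (vpow 2 - 1) • TT w := by
  have h1 := TT_simple_mul_of_lt (w := s * w) hs (by rwa [hs.isReflection.mul_cancel_left])
  rw [hs.isReflection.mul_cancel_left] at h1
  rw [← h1, ← mul_assoc, TT_simple_sq hs, add_mul, smul_mul_assoc, smul_mul_assoc, one_mul,
    add_comm]

theorem TT_rho_mul (a : ℤ) (w : AffSym r) : TT (rho r ^ a) * TT w = TT (rho r ^ a * w) :=
  TT_mul _ _ (by rw [len_rho_zpow_mul, len_rho_zpow, zero_add])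

theorem TT_mul_mem_span (w : AffSym r) {x : Hecke r}
    (hx : x ∈ Submodule.span Zv (Set.range (TT : AffSym r → Hecke r))) :
    TT w * x ∈ Submodule.span Zv (Set.range (TT : AffSym r → Hecke r)) := by
  have key : ∀ (u : AffSym r), (∀ w', TT u * TT w' ∈ Submodule.span Zv
      (Set.range (TT : AffSym r → Hecke r))) → ∀ x ∈ Submodule.span Zv
      (Set.range (TT : AffSym r → Hecke r)), TT u * x ∈ Submodule.span Zv
      (Set.range (TT : AffSym r → Hecke r)) := by
    intro u hu x hx
    induction hx using Submodule.span_induction with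
    | mem x hx => obtain ⟨w', rfl⟩ := hx; exact hu w'
    | zero => rw [mul_zero]; exact zero_mem _
    | add x y _ _ hx hy => rw [mul_add]; exact add_mem hx hy
    | smul c x _ hx => rw [mul_smul_comm]; exact Submodule.smul_mem _ _ hx
  have hT : ∀ w : AffSym r, TT w ∈ Submodule.span Zv (Set.range (TT : AffSym r → Hecke r)) :=
    fun w => Submodule.subset_span ⟨w, rfl⟩
  induction w using len_induction generalizing x with
  | h0 a => exact key _ (fun w' => by rw [TT_rho_mul]; exact hT _) x hx
  | h1 s u hs hl ih =>
    rw [← TT_simple_mul_of_lt hs (by omega), mul_assoc]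
    refine key s (fun w' => ?_) _ (ih hx)
    rcases hs.len_mul w' with h | h
    · rw [TT_simple_mul_of_lt hs (by omega)]; exact hT _
    · rw [TT_simple_mul_of_gt hs (by omega)]
      exact add_mem (Submodule.smul_mem _ _ (hT _)) (Submodule.smul_mem _ _ (hT _))

/-- The span is stable under left multiplication by the generators and contains `1 = T_1`. -/
theorem span_TT : Submodule.span Zv (Set.range (TT : AffSym r → Hecke r)) = ⊤ := by
  rw [eq_top_iff]
  rintro x -
  have key : ∀ a : FreeAlgebra Zv (AffSym r), ∀ x ∈ Submodule.span Zv
      (Set.range (TT : AffSym r → Hecke r)),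
      (show Hecke r from RingQuot.mkAlgHom Zv (HeckeRel r) a) * x ∈ Submodule.span Zv
      (Set.range (TT : AffSym r → Hecke r)) := by
    intro a
    induction a using FreeAlgebra.induction with
    | grade0 c =>
      intro x hx
      rw [AlgHom.commutes]
      have : (show Hecke r from algebraMap Zv (RingQuot (HeckeRel r)) c) * x = c • x :=
        (Algebra.smul_def (A := Hecke r) c x).symm
      rw [this]
      exact Submodule.smul_mem _ _ hx
    | grade1 w => intro x hx; exact TT_mul_mem_span w hx
    | mul a b ha hb =>
      intro x hx
      rw [map_mul]
      exact (mul_assoc (G := Hecke r) _ _ x).symm ▸ ha _ (hb x hx)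
    | add a b ha hb =>
      intro x hx
      rw [map_add]
      exact (add_mul (R := Hecke r) _ _ x).symm ▸ add_mem (ha x hx) (hb x hx)
  obtain ⟨a, ha⟩ := RingQuot.mkAlgHom_surjective Zv (HeckeRel r) x
  have := key a 1 (by rw [← TT_one]; exact Submodule.subset_span ⟨1, rfl⟩)
  rw [ha] at this
  rwa [show (show Hecke r from x) * 1 = x from mul_one (M := Hecke r) x] at this

/-- Acting on the basis vector at `1` in the regular representation sends the `T_w` to the standard
basis. -/
theorem linearIndependent_TT : LinearIndependent Zv (TT : AffSym r → Hecke r) := by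
  let f : Hecke r →ₗ[Zv] FreeMod r :=
    (LinearMap.applyₗ (ev 1)).comp (regRep r).toLinearMap
  refine LinearIndependent.of_comp f ?_
  have : f ∘ TT = fun w : AffSym r => ev w := funext fun w => by
    change regRep r (TT w) (ev 1) = _
    rw [regRep_TT, leftOp_one]
  rw [this]
  exact by
    classical exact Finsupp.linearIndependent_single_one Zv (AffSym r)

/-- The basis of the `T_w`. -/
def basisTT (r : ℕ) [NeZero r] : Module.Basis (AffSym r) Zv (Hecke r) :=
  Module.Basis.mk linearIndependent_TT span_TT.ge

theorem basisTT_apply (w : AffSym r) : basisTT r w = TT w := Module.Basis.mk_apply _ _ _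

end HeckeBasis

/-! ### The bar involution and the anti-automorphism `T_w ↦ T_{w⁻¹}`. -/

section Bar

set_option linter.unusedSectionVars false

variable {r : ℕ} [NeZero r]

theorem vpow_add (a b : ℤ) : vpow (a + b) = vpow a * vpow b := LaurentPolynomial.T_add a b

theorem vpow_zero : vpow 0 = 1 := LaurentPolynomial.T_zero

theorem invert_vpow (a : ℤ) : LaurentPolynomial.invert (vpow a) = vpow (-a) :=
  LaurentPolynomial.invert_T a

theorem vpow_mul_neg (a : ℤ) : vpow a * vpow (-a) = 1 := by
  rw [← vpow_add, add_neg_cancel, vpow_zero]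

theorem vpow_neg_mul (a : ℤ) : vpow (-a) * vpow a = 1 := by
  rw [← vpow_add, neg_add_cancel, vpow_zero]

/-- Solve the quadratic relation for the inverse of `T_s`. -/
theorem TT_simple_mul_inv {s : AffSym r} (hs : IsSimple s) :
    TT s * (vpow (-2) • TT s + (vpow (-2) - 1) • 1) = 1 := by
  rw [mul_add, mul_smul_comm, mul_smul_comm, mul_one, TT_simple_sq hs, smul_add, smul_smul,
    smul_smul, vpow_neg_mul, one_smul, mul_sub, vpow_neg_mul, mul_one]
  module

theorem TT_simple_inv_mul {s : AffSym r} (hs : IsSimple s) :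
    (vpow (-2) • TT s + (vpow (-2) - 1) • 1) * TT s = 1 := by
  rw [add_mul, smul_mul_assoc, smul_mul_assoc, one_mul, TT_simple_sq hs, smul_add, smul_smul,
    smul_smul, vpow_neg_mul, one_smul, mul_sub, vpow_neg_mul, mul_one]
  module

theorem isUnit_TT (w : AffSym r) : IsUnit (TT w) := by
  induction w using len_induction with
  | h0 a =>
    refine ⟨⟨TT (rho r ^ a), TT (rho r ^ (-a)), ?_, ?_⟩, rfl⟩
    · rw [TT_rho_mul, ← zpow_add, add_neg_cancel, zpow_zero, TT_one]
    · rw [TT_rho_mul, ← zpow_add, neg_add_cancel, zpow_zero, TT_one]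
  | h1 s u hs hl ih =>
    rw [← TT_simple_mul_of_lt hs (by omega)]
    exact IsUnit.mul ⟨⟨_, _, TT_simple_mul_inv hs, TT_simple_inv_mul hs⟩, rfl⟩ ih

/-- The element `T_w` as a unit. -/
def unitTT (w : AffSym r) : (Hecke r)ˣ := (isUnit_TT w).unit

theorem val_unitTT (w : AffSym r) : (unitTT w : Hecke r) = TT w := rfl

/-- The Hecke algebra, with scalars acting through `v ↦ v⁻¹`. -/
def HeckeTwist (r : ℕ) : Type := Hecke r

instance (r : ℕ) : Ring (HeckeTwist r) := inferInstanceAs (Ring (Hecke r))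

/-- With scalars twisted by `v ↦ v⁻¹`, the semilinear bar map becomes an algebra homomorphism, so it
can be obtained from the universal property of the presentation. -/
instance (r : ℕ) : Algebra Zv (HeckeTwist r) :=
  RingHom.toAlgebra' (S := Hecke r) ((algebraMap Zv (Hecke r)).comp
    ((LaurentPolynomial.invert : Zv ≃ₐ[ℤ] Zv) : Zv →+* Zv)) fun z x =>
      Algebra.commutes (A := Hecke r) (LaurentPolynomial.invert z) x

theorem twist_smul (z : Zv) (x : HeckeTwist r) : z • x =
    (LaurentPolynomial.invert z • (show Hecke r from x) : Hecke r) := by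
  rw [Algebra.smul_def, Algebra.smul_def]; rfl

/-- The image of `T_w` under the bar involution. -/
def barGen (w : AffSym r) : HeckeTwist r :=
  (show Hecke r from ((unitTT w⁻¹)⁻¹ : (Hecke r)ˣ))

theorem barGen_eq (w : AffSym r) : barGen w = (((unitTT w⁻¹)⁻¹ : (Hecke r)ˣ) : Hecke r) := rfl

/-- The bar involution as an algebra homomorphism to the twisted Hecke algebra. -/
def barAlgHom (r : ℕ) [NeZero r] : Hecke r →ₐ[Zv] HeckeTwist r :=
  RingQuot.liftAlgHom Zv (s := HeckeRel r)
    ⟨FreeAlgebra.lift Zv barGen, by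
    intro x y h
    induction h with
    | one =>
      rw [FreeAlgebra.lift_ι_apply, map_one]
      have : unitTT (1 : AffSym r)⁻¹ = 1 := Units.ext (by rw [val_unitTT, inv_one, TT_one]; rfl)
      rw [barGen_eq, this, inv_one]; rfl
    | quad s hs =>
      simp only [map_mul, map_add, map_smul, FreeAlgebra.lift_ι_apply, map_one, twist_smul, map_sub,
        invert_vpow]
      have e : (((unitTT s⁻¹)⁻¹ : (Hecke r)ˣ) : Hecke r)
          = vpow (-2) • TT s + (vpow (-2) - 1) • 1 := by
        rw [hs.isReflection.inv]
        exact Units.inv_eq_of_mul_eq_one_right (TT_simple_mul_inv hs)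
      -- The quadratic relation with `v` inverted: multiply the explicit formula for the inverse of
      -- `T_s` once more by that inverse.
      have h2 : (((unitTT s⁻¹)⁻¹ : (Hecke r)ˣ) : Hecke r) * (((unitTT s⁻¹)⁻¹ : (Hecke r)ˣ) : Hecke r)
          = (vpow (-2) - 1) • (((unitTT s⁻¹)⁻¹ : (Hecke r)ˣ) : Hecke r)
            + vpow (-2) • (1 : Hecke r) := by
        nth_rewrite 1 [e]
        rw [add_mul, smul_mul_assoc, smul_mul_assoc, one_mul, add_comm]
        congr 2
        rw [hs.isReflection.inv, ← val_unitTT, Units.mul_inv]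
      exact h2
    | mul w w' h =>
      rw [map_mul, FreeAlgebra.lift_ι_apply, FreeAlgebra.lift_ι_apply, FreeAlgebra.lift_ι_apply]
      -- Inversion in the group and inversion of units each reverse the order of the factors, so the
      -- original order is restored.
      have : unitTT (w * w')⁻¹ = unitTT w'⁻¹ * unitTT w⁻¹ := Units.ext (by
        rw [Units.val_mul, val_unitTT, val_unitTT, val_unitTT, TT_mul, mul_inv_rev]
        rw [← mul_inv_rev, len_inv, len_inv, len_inv, h, add_comm])
      have h2 : (((unitTT w⁻¹)⁻¹ : (Hecke r)ˣ) : Hecke r) * ((unitTT w'⁻¹)⁻¹ : (Hecke r)ˣ)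
          = ((unitTT (w * w')⁻¹)⁻¹ : (Hecke r)ˣ) := by
        rw [this, mul_inv_rev, Units.val_mul]
      exact h2⟩

theorem barAlgHom_TT (w : AffSym r) :
    barAlgHom r (TT w) = barGen w := by
  refine (RingQuot.liftAlgHom_mkAlgHom_apply ..).trans ?_
  exact FreeAlgebra.lift_ι_apply _ _

theorem ringHom_ext_TT {A : Type*} [Ring A] {f g : Hecke r →+* A}
    (h0 : ∀ z : Zv, f (algebraMap Zv _ z) = g (algebraMap Zv _ z))
    (h1 : ∀ w : AffSym r, f (TT w) = g (TT w)) : f = g := by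
  refine RingHom.ext fun x => ?_
  have hx : x ∈ Submodule.span Zv (Set.range (TT : AffSym r → Hecke r)) := by
    rw [span_TT]; trivial
  induction hx using Submodule.span_induction with
  | mem x hx => obtain ⟨w, rfl⟩ := hx; exact h1 w
  | zero => rw [map_zero, map_zero]
  | add x y _ _ hx hy => rw [map_add, map_add, hx, hy]
  | smul c x _ hx => rw [Algebra.smul_def, map_mul, map_mul, h0, hx]

theorem existsUnique_isHeckeBar (r : ℕ) [NeZero r] : ∃! β, IsHeckeBar r β := by
  refine ⟨(barAlgHom r).toRingHom, ⟨fun z => (barAlgHom r).commutes z, fun w => ?_⟩, ?_⟩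
  · have : (barAlgHom r).toRingHom (TT w) = (((unitTT w⁻¹)⁻¹ : (Hecke r)ˣ) : Hecke r) := barAlgHom_TT w
    constructor
    · exact (congrArg (· * TT w⁻¹) this).trans (Units.inv_mul (unitTT w⁻¹))
    · exact (congrArg (TT w⁻¹ * ·) this).trans (Units.mul_inv (unitTT w⁻¹))
  · intro β hβ
    refine ringHom_ext_TT (A := Hecke r) (fun z => ?_) fun w => ?_
    · exact (hβ.1 z).trans ((barAlgHom r).commutes z).symm
    · have h1 : β (TT w) = ((unitTT w⁻¹)⁻¹ : (Hecke r)ˣ) :=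
        (Units.inv_eq_of_mul_eq_one_right (u := unitTT w⁻¹) (hβ.2 w).2).symm
      exact h1.trans (barAlgHom_TT w).symm

theorem isHeckeBar_heckeBar (r : ℕ) [NeZero r] : IsHeckeBar r (heckeBar r) :=
  @Classical.epsilon_spec_aux _ ⟨RingHom.id _⟩ (IsHeckeBar r) (existsUnique_isHeckeBar r).exists

theorem heckeBar_smul (z : Zv) (x : Hecke r) :
    heckeBar r (z • x) = LaurentPolynomial.invert z • heckeBar r x := by
  rw [Algebra.smul_def, map_mul, (isHeckeBar_heckeBar r).1, ← Algebra.smul_def]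

theorem heckeBar_eq {w : AffSym r} {x : Hecke r} (h : TT w⁻¹ * x = 1) : heckeBar r (TT w) = x := by
  have := ((isHeckeBar_heckeBar r).2 w).1
  calc heckeBar r (TT w) = heckeBar r (TT w) * (TT w⁻¹ * x) := by rw [h, mul_one]
    _ = x := by rw [← mul_assoc, this, one_mul]

theorem heckeBar_rho (a : ℤ) : heckeBar r (TT (rho r ^ a)) = TT (rho r ^ a) := by
  refine heckeBar_eq ?_
  rw [← zpow_neg, TT_rho_mul, ← zpow_add, neg_add_cancel, zpow_zero, TT_one]

theorem heckeBar_simple {s : AffSym r} (hs : IsSimple s) :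
    heckeBar r (TT s) = vpow (-2) • TT s + (vpow (-2) - 1) • 1 := by
  refine heckeBar_eq ?_
  rw [hs.isReflection.inv, TT_simple_mul_inv hs]

/-- The anti-automorphism `T_w ↦ T_{w⁻¹}`, as a homomorphism to the opposite algebra. -/
def flipAlgHom (r : ℕ) [NeZero r] : Hecke r →ₐ[Zv] (Hecke r)ᵐᵒᵖ :=
  RingQuot.liftAlgHom Zv (s := HeckeRel r)
    ⟨FreeAlgebra.lift Zv fun w : AffSym r => MulOpposite.op (TT w⁻¹), by
    intro x y h
    induction h with
    | one => rw [FreeAlgebra.lift_ι_apply, map_one, inv_one, TT_one, MulOpposite.op_one]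
    | quad s hs =>
      simp only [map_mul, map_add, map_smul, FreeAlgebra.lift_ι_apply, map_one]
      rw [hs.isReflection.inv, ← MulOpposite.op_mul, TT_simple_sq hs]
      rfl
    | mul w w' h =>
      rw [map_mul, FreeAlgebra.lift_ι_apply, FreeAlgebra.lift_ι_apply, FreeAlgebra.lift_ι_apply,
        ← MulOpposite.op_mul, TT_mul, mul_inv_rev]
      rw [← mul_inv_rev, len_inv, len_inv, len_inv, h, add_comm]⟩

theorem flipAlgHom_TT (w : AffSym r) : flipAlgHom r (TT w) = MulOpposite.op (TT w⁻¹) := by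
  refine (RingQuot.liftAlgHom_mkAlgHom_apply ..).trans ?_
  exact FreeAlgebra.lift_ι_apply _ _

/-- The anti-automorphism `T_w ↦ T_{w⁻¹}`. -/
def flip (r : ℕ) [NeZero r] : Hecke r →ₗ[Zv] Hecke r :=
  (MulOpposite.opLinearEquiv Zv).symm.toLinearMap.comp (flipAlgHom r).toLinearMap

theorem flip_apply (x : Hecke r) : flip r x = (flipAlgHom r x).unop := rfl

theorem flip_TT (w : AffSym r) : flip r (TT w) = TT w⁻¹ := by
  rw [flip_apply, flipAlgHom_TT, MulOpposite.unop_op]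

theorem flip_mul (x y : Hecke r) : flip r (x * y) = flip r y * flip r x := by
  rw [flip_apply, map_mul, MulOpposite.unop_mul]; rfl

theorem flip_one : flip r 1 = 1 := by rw [← TT_one, flip_TT, inv_one]

theorem linearMap_ext_TT {M : Type*} [AddCommMonoid M] [Module Zv M] {f g : Hecke r →ₗ[Zv] M}
    (h : ∀ w, f (TT w) = g (TT w)) : f = g :=
  (basisTT r).ext fun w => by rw [basisTT_apply, h]

theorem flip_flip (x : Hecke r) : flip r (flip r x) = x := by
  have : (flip r).comp (flip r) = LinearMap.id := linearMap_ext_TT fun w => by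
    rw [LinearMap.comp_apply, flip_TT, flip_TT, inv_inv, LinearMap.id_apply]
  exact LinearMap.congr_fun this x

/-- On generators, apply the anti-automorphism to the identity that characterizes the bar of `T_w`
as an inverse. -/
theorem heckeBar_flip (x : Hecke r) : heckeBar r (flip r x) = flip r (heckeBar r x) := by
  have hx : x ∈ Submodule.span Zv (Set.range (TT : AffSym r → Hecke r)) := by
    rw [span_TT]; trivial
  induction hx using Submodule.span_induction with
  | mem x hx =>
    obtain ⟨w, rfl⟩ := hx
    rw [flip_TT]
    refine heckeBar_eq ?_
    have := congrArg (flip r) ((isHeckeBar_heckeBar r).2 w).1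
    rwa [flip_mul, flip_TT, flip_one] at this
  | zero => simp only [map_zero]
  | add x y _ _ hx hy => simp only [map_add, hx, hy]
  | smul c x _ hx => rw [map_smul, heckeBar_smul, heckeBar_smul, map_smul, hx]

end Bar

/-! ### Coordinates in the normalized basis and multiplication by `C'_s`. -/

section Normalized

set_option linter.unusedSectionVars false

variable {r : ℕ} [NeZero r]

theorem isUnit_vpow (a : ℤ) : IsUnit (vpow a) := LaurentPolynomial.isUnit_T a

/-- The basis of the normalized elements. -/
def basisTTn (r : ℕ) [NeZero r] : Module.Basis (AffSym r) Zv (Hecke r) :=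
  (basisTT r).isUnitSMul fun w => isUnit_vpow (-(len w : ℤ))

theorem basisTTn_apply (w : AffSym r) : basisTTn r w = TTn w := by
  rw [basisTTn, Module.Basis.isUnitSMul_apply, basisTT_apply, TTn]

/-- The coordinates with respect to the normalized basis. -/
def coef (y : AffSym r) : Hecke r →ₗ[Zv] Zv := (basisTTn r).coord y

open Classical in
theorem coef_TTn (y w : AffSym r) : coef y (TTn w) = if w = y then 1 else 0 := by
  rw [coef, Module.Basis.coord_apply, ← basisTTn_apply, Module.Basis.repr_self,
    Finsupp.single_apply]

theorem hecke_ext {x y : Hecke r} (h : ∀ w, coef w x = coef w y) : x = y :=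
  (basisTTn r).ext_elem h

theorem TT_eq_smul_TTn (w : AffSym r) : TT w = vpow (len w) • TTn w := by
  rw [TTn, smul_smul, vpow_mul_neg, one_smul]

theorem linearMap_ext_TTn {M : Type*} [AddCommMonoid M] [Module Zv M] {f g : Hecke r →ₗ[Zv] M}
    (h : ∀ w, f (TTn w) = g (TTn w)) : f = g :=
  (basisTTn r).ext fun w => by rw [basisTTn_apply, h]

theorem finite_coef_ne_zero (h : Hecke r) : {y | coef y h ≠ 0}.Finite :=
  ((basisTTn r).repr h).hasFiniteSupport

open Classical in
theorem coef_flip (y : AffSym r) (h : Hecke r) : coef y (flip r h) = coef y⁻¹ h := by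
  have : (coef y).comp (flip r) = coef y⁻¹ := linearMap_ext_TTn fun w => by
    have e : flip r (TTn w) = TTn w⁻¹ := by rw [TTn, map_smul, flip_TT, TTn, len_inv]
    rw [LinearMap.comp_apply, e, coef_TTn, coef_TTn]
    simp only [inv_eq_iff_eq_inv]
  exact LinearMap.congr_fun this h

/-- The Kazhdan-Lusztig element of a simple reflection. -/
def csim (s : AffSym r) : Hecke r := TTn s + vpow (-1) • 1

theorem csim_eq {s : AffSym r} (hs : IsSimple s) : csim s = vpow (-1) • (TT s + 1) := by
  rw [csim, TTn, hs.len_eq_one, smul_add]; rfl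

open Classical in
/-- The scalar `v⁻¹` or `v` according to whether `s w` is longer or shorter than `w`. -/
def vsign (s w : AffSym r) : Zv := if len w < len (s * w) then vpow (-1) else vpow 1

/-- After normalization ascents and descents give the same shape, differing only in the exponent of
the diagonal coefficient. The two cases of the multiplication rule for `T_s` collapse into one. -/
theorem csim_mul_TTn {s : AffSym r} (hs : IsSimple s) (w : AffSym r) :
    csim s * TTn w = TTn (s * w) + vsign s w • TTn w := by
  rw [csim_eq hs, smul_mul_assoc, add_mul, one_mul, TTn, mul_smul_comm, TTn, vsign]
  rcases hs.len_mul w with h | h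
  · rw [TT_simple_mul_of_lt hs (by omega), if_pos (by omega), h]
    simp only [smul_add, smul_smul, ← vpow_add]
    congr 3
    push_cast; ring
  · rw [TT_simple_mul_of_gt hs (by omega), if_neg (by omega), ← h]
    simp only [smul_add, smul_smul, ← vpow_add, mul_sub, mul_one, add_assoc]
    rw [← add_smul]
    congr 2
    · congr 1; push_cast; ring
    · rw [sub_add_cancel]
      congr 1
      push_cast; ring

open Classical in
theorem coef_csim_mul {s : AffSym r} (hs : IsSimple s) (y : AffSym r) (h : Hecke r) :
    coef y (csim s * h) = coef (s * y) h + vsign s y * coef y h := by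
  have : (coef y).comp (LinearMap.mulLeft Zv (csim s)) = coef (s * y) + vsign s y • coef y :=
    linearMap_ext_TTn fun w => by
      have e : s * w = y ↔ w = s * y :=
        ⟨fun h => by rw [← h, hs.isReflection.mul_cancel_left],
          fun h => by rw [h, hs.isReflection.mul_cancel_left]⟩
      simp only [LinearMap.comp_apply, LinearMap.mulLeft_apply, csim_mul_TTn hs, map_add, map_smul,
        coef_TTn, LinearMap.add_apply, LinearMap.smul_apply, e, smul_eq_mul]
      by_cases hwy : w = y
      · rw [hwy]
      · rw [if_neg hwy, mul_zero, mul_zero]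
  exact LinearMap.congr_fun this h

theorem heckeBar_csim {s : AffSym r} (hs : IsSimple s) : heckeBar r (csim s) = csim s := by
  rw [csim_eq hs, heckeBar_smul, map_add, heckeBar_simple hs, map_one, invert_vpow, smul_add,
    smul_add, smul_add, smul_smul, smul_smul, mul_sub, ← vpow_add, sub_smul]
  norm_num
  module

open Classical in
theorem csim_mul_csim {s : AffSym r} (hs : IsSimple s) :
    csim s * csim s = (vpow 1 + vpow (-1)) • csim s := by
  refine hecke_ext fun y => ?_
  rw [coef_csim_mul hs, csim, map_add, map_add, map_smul, map_smul, map_smul, map_add, map_smul,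
    ← TT_one]
  have e : (TT 1 : Hecke r) = TTn 1 := by rw [TTn, len_one]; simp [vpow_zero]
  have e1 : s = s * y ↔ 1 = y := by rw [left_eq_mul]; exact eq_comm
  have e2 : 1 = s * y ↔ s = y := by rw [eq_comm, mul_eq_one_iff_inv_eq, hs.isReflection.inv]
  rw [e, coef_TTn, coef_TTn, coef_TTn, coef_TTn]
  simp only [e1, e2]
  have hne : s ≠ 1 := fun h => by have := hs.len_eq_one; rw [h, len_one] at this; omega
  have h11 := vpow_mul_neg 1
  have h12 : vpow (-1) * vpow 1 = 1 := by rw [mul_comm, h11]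
  by_cases h1 : 1 = y
  · subst h1
    have : vsign s 1 = vpow (-1) := by
      rw [vsign, if_pos]
      rw [mul_one, len_one, hs.len_eq_one]; omega
    simp [this, hne, add_mul]
    linear_combination -h12
  · by_cases h2 : s = y
    · subst h2
      have : vsign s s = vpow 1 := by
        rw [vsign, if_neg]
        rw [hs.isReflection.mul_self, len_one]; omega
      simp [this, hne.symm]
      ring
    · simp [h1, h2]

end Normalized

/-! ### Laurent polynomials with restricted exponents, and polynomials in `v²`. -/

section Laurent

/-- Laurent polynomials with exponents in a given set. -/
def expIn (E : Set ℤ) : Submodule ℤ Zv where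
  carrier := {c | ∀ m ∉ E, c.coeff m = 0}
  add_mem' ha hb m hm := by
    rw [AddMonoidAlgebra.coeff_add, Finsupp.add_apply, ha m hm, hb m hm, add_zero]
  zero_mem' _ _ := rfl
  smul_mem' z c hc m hm := by
    rw [AddMonoidAlgebra.coeff_smul, Finsupp.smul_apply, hc m hm, smul_zero]

theorem expIn_mono {E F : Set ℤ} (h : E ⊆ F) {c : Zv} (hc : c ∈ expIn E) : c ∈ expIn F :=
  fun m hm => hc m fun hE => hm (h hE)

theorem vpow_mem_expIn {E : Set ℤ} {k : ℤ} (h : k ∈ E) : vpow k ∈ expIn E := fun m hm => by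
  rw [vpow, LaurentPolynomial.T_apply, if_neg]
  rintro rfl
  exact hm h

theorem coeff_vpow_mul (k : ℤ) (c : Zv) (m : ℤ) : (vpow k * c).coeff m = c.coeff (m - k) := by
  have := AddMonoidAlgebra.coeff_single_mul_apply c 1 k m
  rw [one_mul, neg_add_eq_sub] at this
  exact this

theorem vpow_mul_mem_expIn {E F : Set ℤ} {k : ℤ} {c : Zv} (hc : c ∈ expIn E)
    (h : ∀ m ∈ E, m + k ∈ F) : vpow k * c ∈ expIn F := fun m hm => by
  rw [coeff_vpow_mul]
  exact hc _ fun hE => hm (by simpa using h _ hE)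

theorem eq_zero_of_invert_eq {c : Zv} (hc : c ∈ expIn {m | m < 0})
    (h : LaurentPolynomial.invert c = c) : c = 0 := by
  refine LaurentPolynomial.ext fun m => ?_
  by_cases hm : m < 0
  · rw [← h, LaurentPolynomial.invert_apply, hc (-m) (by simp; omega)]
    rfl
  · exact hc m (by simpa using hm)

theorem sum_single_coeff (c : Zv) : c = ∑ m ∈ c.coeff.support, c.coeff m • vpow m := by
  refine LaurentPolynomial.ext fun a => ?_
  rw [AddMonoidAlgebra.coeff_sum, Finsupp.finsetSum_apply]
  simp only [AddMonoidAlgebra.coeff_smul, Finsupp.smul_apply, vpow, LaurentPolynomial.T_apply]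
  rw [Finset.sum_eq_single a]
  · simp
  · intro b _ hb; rw [if_neg hb, smul_zero]
  · intro h; rw [Finsupp.notMem_support_iff.1 h, zero_smul]

theorem vpow_pow (k : ℤ) (i : ℕ) : vpow k ^ i = vpow (i * k) := LaurentPolynomial.T_pow k i

/-- Together with `aeval_vpow_injective` this translates between Laurent polynomials with bounded
exponents of fixed parity and polynomials in `v²`. The degree bound is restricted to `p ≠ 0` because
`d + k` may be negative while the zero polynomial has `natDegree` zero. -/
theorem exists_poly {c : Zv} {k d : ℤ} (hc : c ∈ expIn {m | -k ≤ m ∧ m ≤ d ∧ 2 ∣ m + k}) :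
    ∃ p : Polynomial ℤ, c = vpow (-k) * Polynomial.aeval (vpow 2) p ∧
      (p ≠ 0 → 2 * (p.natDegree : ℤ) ≤ d + k) := by
  have hsupp : ∀ m ∈ c.coeff.support, -k ≤ m ∧ m ≤ d ∧ 2 ∣ m + k := fun m hm => by
    by_contra h
    exact Finsupp.mem_support_iff.1 hm (hc m h)
  refine ⟨∑ m ∈ c.coeff.support, Polynomial.monomial ((m + k) / 2).toNat (c.coeff m), ?_, ?_⟩
  · rw [map_sum, Finset.mul_sum]
    conv_lhs => rw [sum_single_coeff c]
    refine Finset.sum_congr rfl fun m hm => ?_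
    obtain ⟨h1, _, h2⟩ := hsupp m hm
    rw [Polynomial.aeval_monomial, vpow_pow, mul_left_comm, ← vpow_add, ← Algebra.smul_def]
    congr 2
    omega
  · intro hne
    have hd : 0 ≤ d + k := by
      obtain ⟨m, hm⟩ : ∃ m, m ∈ c.coeff.support := by
        by_contra h
        push Not at h
        exact hne (Finset.sum_eq_zero fun m hm => absurd hm (h m))
      have := hsupp m hm
      omega
    have h : (∑ m ∈ c.coeff.support, Polynomial.monomial ((m + k) / 2).toNat (c.coeff m)).natDegree
        ≤ ((d + k) / 2).toNat := by
      refine Polynomial.natDegree_sum_le_of_forall_le _ _ fun m hm => ?_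
      refine (Polynomial.natDegree_monomial_le _).trans ?_
      obtain ⟨h1, h2, h3⟩ := hsupp m hm
      omega
    omega

theorem aeval_mem_expIn (p : Polynomial ℤ) :
    Polynomial.aeval (vpow 2) p ∈ expIn {m | 0 ≤ m ∧ m ≤ 2 * p.natDegree ∧ 2 ∣ m} := by
  rw [Polynomial.aeval_eq_sum_range]
  refine Submodule.sum_mem _ fun i hi => Submodule.smul_mem _ _ ?_
  rw [vpow_pow]
  have := Finset.mem_range.1 hi
  exact vpow_mem_expIn ⟨by positivity, by omega, ⟨i, by ring⟩⟩

theorem coeff_aeval_vpow (p : Polynomial ℤ) (i : ℕ) :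
    (Polynomial.aeval (vpow 2) p).coeff (2 * i) = p.coeff i := by
  rw [Polynomial.aeval_eq_sum_range, AddMonoidAlgebra.coeff_sum, Finsupp.finsetSum_apply]
  simp only [AddMonoidAlgebra.coeff_smul, Finsupp.smul_apply, vpow_pow]
  simp only [vpow, LaurentPolynomial.T_apply]
  by_cases hi : i ≤ p.natDegree
  · rw [Finset.sum_eq_single i]
    · rw [if_pos (by ring)]; simp
    · intro b _ hb; rw [if_neg (by omega), smul_zero]
    · intro h; exact absurd (Finset.mem_range.2 (by omega)) h
  · rw [Polynomial.coeff_eq_zero_of_natDegree_lt (by omega)]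
    refine Finset.sum_eq_zero fun b hb => ?_
    have := Finset.mem_range.1 hb
    rw [if_neg (by omega), smul_zero]

theorem aeval_vpow_injective :
    Function.Injective (Polynomial.aeval (vpow 2) : Polynomial ℤ →ₐ[ℤ] Zv) := fun p p' h => by
  ext i
  rw [← coeff_aeval_vpow, ← coeff_aeval_vpow, h]

end Laurent

/-! ### Existence and uniqueness of the Kazhdan–Lusztig basis. -/

section KL

set_option linter.unusedSectionVars false

variable {r : ℕ} [NeZero r]

/-- Elements supported on group elements of length less than `N`. -/
def filt (r : ℕ) [NeZero r] (N : ℕ) : Submodule Zv (Hecke r) where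
  carrier := {h | ∀ y, N ≤ len y → coef y h = 0}
  add_mem' ha hb y hy := by rw [map_add, ha y hy, hb y hy, add_zero]
  zero_mem' _ _ := map_zero _
  smul_mem' c h hh y hy := by rw [map_smul, hh y hy, smul_zero]

theorem filt_mono {N N' : ℕ} (hN : N ≤ N') {h : Hecke r} (hh : h ∈ filt r N) : h ∈ filt r N' :=
  fun y hy => hh y (hN.trans hy)

theorem TTn_mem_filt {w : AffSym r} {N : ℕ} (h : len w < N) : TTn w ∈ filt r N := fun y hy => by
  rw [coef_TTn, if_neg]
  rintro rfl
  omega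

theorem csim_mul_mem_filt {s : AffSym r} (hs : IsSimple s) {N : ℕ} {h : Hecke r}
    (hh : h ∈ filt r N) : csim s * h ∈ filt r (N + 1) := fun y hy => by
  rw [coef_csim_mul hs, hh y (by omega), hh (s * y), mul_zero, add_zero]
  rcases hs.len_mul y with h | h <;> omega

theorem TTn_rho (a : ℤ) : TTn (rho r ^ a) = TT (rho r ^ a) := by
  rw [TTn, len_rho_zpow, Nat.cast_zero, neg_zero, vpow_zero, one_smul]

/-- Unitriangularity of the bar involution with respect to length; triangularity for the Bruhat
order is not needed, because the Bruhat support of `C'_w` is carried along in its construction. The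
induction rewrites the normalized `T_{s u}` by means of the bar-invariant `C'_s`. -/
theorem heckeBar_TTn_sub_mem (w : AffSym r) : heckeBar r (TTn w) - TTn w ∈ filt r (len w) := by
  induction w using len_induction with
  | h0 a => rw [TTn_rho, heckeBar_rho, sub_self]; exact zero_mem _
  | h1 s u hs hl ih =>
    have h1 := csim_mul_TTn hs u
    rw [vsign, if_pos (by omega)] at h1
    have h2 : TTn (s * u) = csim s * TTn u - vpow (-1) • TTn u := by rw [h1, add_sub_cancel_right]
    have h3 : heckeBar r (TTn (s * u)) - TTn (s * u) =
        csim s * (heckeBar r (TTn u) - TTn u) - vpow 1 • (heckeBar r (TTn u) - TTn u)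
          + (vpow (-1) - vpow 1) • TTn u := by
      nth_rewrite 1 [h2]
      rw [h2, map_sub, map_mul, heckeBar_csim hs, heckeBar_smul, invert_vpow, neg_neg, mul_sub]
      module
    rw [h3, hl]
    exact add_mem (sub_mem (csim_mul_mem_filt hs ih)
      (Submodule.smul_mem _ _ (filt_mono (by omega) ih)))
      (Submodule.smul_mem _ _ (TTn_mem_filt (by omega)))

/-- On the layer of greatest length the bar involution only inverts `v` in the coefficients, since
the correction to each basis element lies in strictly smaller length. -/
theorem coef_heckeBar {N : ℕ} {h : Hecke r} (hh : h ∈ filt r (N + 1)) {y : AffSym r}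
    (hy : len y = N) : coef y (heckeBar r h) = LaurentPolynomial.invert (coef y h) := by
  have hsum : h = ((basisTTn r).repr h).sum fun z c => c • TTn z := by
    conv_lhs => rw [← (basisTTn r).linearCombination_repr h]
    simp only [Finsupp.linearCombination_apply, basisTTn_apply]
  conv_lhs => rw [hsum]
  conv_rhs => rw [hsum]
  simp only [Finsupp.sum, map_sum, heckeBar_smul, map_smul, smul_eq_mul]
  refine Finset.sum_congr rfl fun z hz => ?_
  have hz' : len z < N + 1 := by
    by_contra hc
    exact Finsupp.mem_support_iff.1 hz (hh z (by omega))
  have h1 := heckeBar_TTn_sub_mem z y (by omega)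
  rw [map_sub, sub_eq_zero] at h1
  rw [map_mul, h1, coef_TTn]
  split_ifs <;> simp

/-- A bar-invariant element with all coefficients in `v⁻¹ ℤ[v⁻¹]` vanishes. -/
theorem eq_zero_of_heckeBar_eq {h : Hecke r} (hb : heckeBar r h = h)
    (hn : ∀ y, coef y h ∈ expIn {m | m < 0}) : h = 0 := by
  -- The layer of greatest length has coefficients fixed by `v ↦ v⁻¹` and with negative exponents
  -- only, so it is zero; the layers are removed one after the other.
  have key : ∀ N, h ∈ filt r N → h ∈ filt r 0 := by
    intro N
    induction N with
    | zero => exact id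
    | succ N ih =>
      intro hN
      refine ih fun y hy => ?_
      rcases hy.eq_or_lt with e | hlt
      · have := coef_heckeBar hN e.symm
        rw [hb] at this
        exact eq_zero_of_invert_eq (hn y) this.symm
      · exact hN y hlt
  obtain ⟨N, hN⟩ : ∃ N, h ∈ filt r N := by
    obtain ⟨N, hN⟩ := ((finite_coef_ne_zero h).image len).bddAbove
    refine ⟨N + 1, fun y hy => ?_⟩
    by_contra hc
    have := hN ⟨y, hc, rfl⟩
    omega
  exact hecke_ext fun w => by rw [key N hN w (by omega), map_zero]

/-- The characterization of the Kazhdan-Lusztig basis element of `w`. -/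
structure IsKL (w : AffSym r) (h : Hecke r) : Prop where
  bar : heckeBar r h = h
  one : coef w h = 1
  neg : ∀ y, y ≠ w → coef y h ∈ expIn {m | m < 0}
  par : ∀ y, coef y h ∈ expIn {m | (len y : ℤ) - len w ≤ m ∧ 2 ∣ m + len w - len y}
  le : ∀ y, coef y h ≠ 0 → BruhatLE y w

theorem IsKL.unique {w : AffSym r} {h h' : Hecke r} (H : IsKL w h) (H' : IsKL w h') : h = h' := by
  refine sub_eq_zero.1 (eq_zero_of_heckeBar_eq (by rw [map_sub, H.bar, H'.bar]) fun y => ?_)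
  rw [map_sub]
  by_cases hy : y = w
  · rw [hy, H.one, H'.one, sub_self]; exact zero_mem _
  · exact sub_mem (H.neg y hy) (H'.neg y hy)

theorem isKL_rho (a : ℤ) : IsKL (rho r ^ a) (TTn (rho r ^ a)) where
  bar := by rw [TTn_rho, heckeBar_rho]
  one := by rw [coef_TTn, if_pos rfl]
  neg y hy := by rw [coef_TTn, if_neg hy.symm]; exact zero_mem _
  par y := by
    rw [coef_TTn]
    split_ifs with h
    · subst h
      rw [← vpow_zero]
      exact vpow_mem_expIn ⟨by omega, by simp⟩
    · exact zero_mem _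
  le y hy := by
    rw [coef_TTn] at hy
    split_ifs at hy with h
    · rw [h]; exact BruhatLE.refl _
    · exact absurd rfl hy

/-- The classical recursion: multiply `C'_w` by `C'_s` and subtract the multiples `z y` of `C'_y`
that cancel the constant terms. Nonzero constant terms occur only at `y` with `s y < y`, where
`C'_y` is an eigenvector of `C'_s`; hence the difference remains an eigenvector. -/
theorem IsKL.step {s w : AffSym r} (hs : IsSimple s) (hsw : len w < len (s * w)) {h : Hecke r}
    (H : IsKL w h) (C : AffSym r → Hecke r)
    (hC : ∀ y, len y < len (s * w) → IsKL y (C y))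
    (hC' : ∀ y, len y < len (s * w) → len (s * y) < len y →
      csim s * C y = (vpow 1 + vpow (-1)) • C y) :
    ∃ h', IsKL (s * w) h' ∧ csim s * h' = (vpow 1 + vpow (-1)) • h' := by
  classical
  have hlen : len (s * w) = len w + 1 := by rcases hs.len_mul w with h | h <;> omega
  set D := csim s * h with hD
  have hDy : ∀ y, coef y D = coef (s * y) h + vsign s y * coef y h := fun y => coef_csim_mul hs y h
  have hbar : heckeBar r D = D := by rw [hD, map_mul, heckeBar_csim hs, H.bar]
  have hsq : csim s * D = (vpow 1 + vpow (-1)) • D := by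
    rw [hD, ← mul_assoc, csim_mul_csim hs, smul_mul_assoc]
  have hle : ∀ y, coef y D ≠ 0 → BruhatLE y (s * w) := by
    intro y hy
    by_cases h1 : coef y h = 0
    · have h2 : coef (s * y) h ≠ 0 := fun h2 => hy (by rw [hDy, h1, h2, mul_zero, add_zero])
      have := hs.mul_le_mul (H.le _ h2) hsw
      rwa [hs.isReflection.mul_cancel_left] at this
    · exact (H.le y h1).trans (BruhatLE.of_reflection hs.isReflection hsw)
  have hone : coef (s * w) D = 1 := by
    have : coef (s * w) h = 0 := by
      by_contra hc
      have := (H.le _ hc).len_le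
      omega
    rw [hDy, hs.isReflection.mul_cancel_left, H.one, this, mul_zero, add_zero]
  have hpar : ∀ y, coef y D ∈ expIn {m | (len y : ℤ) - len (s * w) ≤ m ∧
      2 ∣ m + len (s * w) - len y} := by
    intro y
    rw [hDy, vsign]
    refine add_mem (expIn_mono ?_ (H.par (s * y))) ?_
    · rintro m ⟨h1, h2⟩
      rcases hs.len_mul y with h | h
      · exact ⟨by omega, by omega⟩
      · exact ⟨by omega, by omega⟩
    · split_ifs with h
      · refine vpow_mul_mem_expIn (H.par y) ?_
        rintro m ⟨h1, h2⟩
        exact ⟨by omega, by omega⟩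
      · refine vpow_mul_mem_expIn (H.par y) ?_
        rintro m ⟨h1, h2⟩
        exact ⟨by omega, by omega⟩
  -- At an ascent both contributions have negative exponents: the one from `s y` because `s y ≠ w`,
  -- the one from `y` because of the factor `v⁻¹`, even for `y = w`.
  have hup : ∀ y, y ≠ s * w → len y < len (s * y) → coef y D ∈ expIn {m | m < 0} := by
    intro y hy hlt
    rw [hDy, vsign, if_pos hlt]
    refine add_mem (H.neg _ fun e => hy ?_) ?_
    · rw [← e, hs.isReflection.mul_cancel_left]
    · by_cases hyw : y = w
      · rw [hyw, H.one, mul_one]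
        exact vpow_mem_expIn (by simp)
      · refine vpow_mul_mem_expIn (H.neg y hyw) fun m hm => ?_
        simp only [Set.mem_ofPred_eq] at hm ⊢
        omega
  have hsub : {m : ℤ | m < 0} ⊆ {m | m ≤ 0} := fun m hm => by
    simp only [Set.mem_ofPred_eq] at hm ⊢; omega
  -- At a descent the factor is `v` instead, which raises negative exponents to at most zero; `y =
  -- w` is excluded, as `w` is an ascent.
  have hnonpos : ∀ y, y ≠ s * w → coef y D ∈ expIn {m | m ≤ 0} := by
    intro y hy
    by_cases hlt : len y < len (s * y)
    · exact expIn_mono hsub (hup y hy hlt)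
    · rw [hDy, vsign, if_neg hlt]
      refine add_mem (expIn_mono hsub (H.neg _ fun e => hy ?_)) ?_
      · rw [← e, hs.isReflection.mul_cancel_left]
      · have hyw : y ≠ w := by rintro rfl; exact hlt hsw
        refine vpow_mul_mem_expIn (H.neg y hyw) fun m hm => ?_
        simp only [Set.mem_ofPred_eq] at hm ⊢
        omega
  let S := ((basisTTn r).repr D).support.erase (s * w)
  -- The integers to subtract. They are set to zero outside `S`, so the leading coefficient at `s w`
  -- is left alone.
  let z : AffSym r → ℤ := fun y => if y ∈ S then (coef y D).coeff 0 else 0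
  have hz : ∀ y, z y ≠ 0 → coef y D ≠ 0 ∧ y ≠ s * w ∧ (coef y D).coeff 0 = z y := by
    intro y hy
    by_cases hyS : y ∈ S
    · have h1 := Finset.mem_erase.1 hyS
      exact ⟨Finsupp.mem_support_iff.1 h1.2, h1.1, (if_pos hyS).symm⟩
    · exact absurd (if_neg hyS) hy
  have hz2 : ∀ y, y ≠ s * w → z y = (coef y D).coeff 0 := by
    intro y hy
    by_cases hyS : y ∈ S
    · exact if_pos hyS
    · have : coef y D = 0 := by
        by_contra hc
        exact hyS (Finset.mem_erase.2 ⟨hy, Finsupp.mem_support_iff.2 hc⟩)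
      rw [this]
      exact if_neg hyS
  have hzlen : ∀ y, z y ≠ 0 → len y < len (s * w) := fun y hy =>
    (hle y (hz y hy).1).len_lt (hz y hy).2.1
  have hzdown : ∀ y, z y ≠ 0 → len (s * y) < len y := by
    intro y hy
    obtain ⟨_, h2, h3⟩ := hz y hy
    by_contra hc
    have := hs.len_mul y
    exact hy (h3 ▸ hup y h2 (by omega) 0 (by simp))
  -- The exponent zero occurs in the coefficient at `y`, so the lengths of `y` and `s w` have equal
  -- parity and subtracting `C'_y` respects the parity condition.
  have hzpar : ∀ y, z y ≠ 0 → (2 : ℤ) ∣ len (s * w) - len y := by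
    intro y hy
    obtain ⟨_, h2, h3⟩ := hz y hy
    by_contra hc
    refine hy (h3 ▸ hpar y 0 ?_)
    rintro ⟨_, h⟩
    exact hc (by simpa using h)
  have hcoef : ∀ x, coef x (D - ∑ y ∈ S, z y • C y)
      = coef x D - ∑ y ∈ S, z y • coef x (C y) := fun x => by
    rw [map_sub, map_sum]
    simp only [map_zsmul]
  refine ⟨D - ∑ y ∈ S, z y • C y, ⟨?_, ?_, ?_, ?_, ?_⟩, ?_⟩
  · rw [map_sub, hbar, map_sum]
    congr 1
    refine Finset.sum_congr rfl fun y _ => ?_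
    by_cases hy : z y = 0
    · rw [hy, zero_smul, map_zero]
    · rw [map_zsmul, (hC y (hzlen y hy)).bar]
  · rw [hcoef, hone, Finset.sum_eq_zero, sub_zero]
    intro y _
    by_cases hy : z y = 0
    · rw [hy, zero_smul]
    · have : coef (s * w) (C y) = 0 := by
        by_contra hc
        have h1 := ((hC y (hzlen y hy)).le _ hc).len_le
        have h2 := hzlen y hy
        omega
      rw [this, smul_zero]
  · intro x hx
    -- At `x` only the term `y = x` of the sum has a constant part. It cancels the constant term of
    -- `D`; all other terms have negative exponents.
    rw [hcoef]
    have hsplit : ∑ y ∈ S, z y • coef x (C y)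
        = z x • 1 + ∑ y ∈ S.erase x, z y • coef x (C y) := by
      by_cases hxS : x ∈ S
      · rw [← Finset.add_sum_erase _ _ hxS]
        congr 1
        by_cases hzx : z x = 0
        · rw [hzx, zero_smul, zero_smul]
        · rw [(hC x (hzlen x hzx)).one]
      · rw [Finset.erase_eq_of_notMem hxS, show z x = 0 from if_neg hxS, zero_smul, zero_add]
    rw [hsplit, ← sub_sub]
    refine sub_mem ?_ (Submodule.sum_mem _ fun y hy => ?_)
    · intro m hm
      simp only [Set.mem_ofPred_eq, not_lt] at hm
      rw [AddMonoidAlgebra.coeff_sub, Finsupp.sub_apply, AddMonoidAlgebra.coeff_smul,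
        Finsupp.smul_apply, ← vpow_zero, vpow, LaurentPolynomial.T_apply]
      rcases hm.eq_or_lt with rfl | hm
      · rw [if_pos rfl, hz2 x hx]; simp
      · rw [if_neg hm.ne, hnonpos x hx m (by simpa using hm)]; simp
    · by_cases hzy : z y = 0
      · rw [hzy, zero_smul]; exact zero_mem _
      · exact Submodule.smul_mem _ _
          ((hC y (hzlen y hzy)).neg x (Finset.mem_erase.1 hy).1.symm)
  · intro x
    rw [hcoef]
    refine sub_mem (hpar x) (Submodule.sum_mem _ fun y hy => ?_)
    by_cases hzy : z y = 0
    · rw [hzy, zero_smul]; exact zero_mem _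
    · refine Submodule.smul_mem _ _ (expIn_mono ?_ ((hC y (hzlen y hzy)).par x))
      have h1 := hzpar y hzy
      have h2 := hzlen y hzy
      rintro m ⟨h3, h4⟩
      exact ⟨by omega, by omega⟩
  · intro x hx
    rw [hcoef] at hx
    by_cases h1 : coef x D = 0
    · rw [h1, zero_sub, neg_ne_zero] at hx
      obtain ⟨y, _, hy⟩ := Finset.exists_ne_zero_of_sum_ne_zero hx
      have hzy : z y ≠ 0 := fun h => hy (by rw [h, zero_smul])
      have hxy : coef x (C y) ≠ 0 := fun h => hy (by rw [h, smul_zero])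
      exact ((hC y (hzlen y hzy)).le x hxy).trans (hle y (hz y hzy).1)
    · exact hle x h1
  · rw [mul_sub, hsq, Finset.mul_sum, smul_sub, Finset.smul_sum]
    congr 1
    refine Finset.sum_congr rfl fun y _ => ?_
    by_cases hy : z y = 0
    · simp only [hy, zero_smul, mul_zero, smul_zero]
    · rw [mul_smul_comm, hC' y (hzlen y hy) (hzdown y hy), smul_comm]

/-- The eigenvector property for all left descents has to be part of the induction, since the
recursion step by `s` uses it for the smaller elements. -/
theorem exists_isKL (w : AffSym r) : ∃ h, IsKL w h ∧
    ∀ s, IsSimple s → len (s * w) < len w → csim s * h = (vpow 1 + vpow (-1)) • h := by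
  induction hn : len w using Nat.strong_induction_on generalizing w with
  | _ n ih =>
    subst hn
    choose! C hC using fun (y : AffSym r) (hy : len y < len w) => ih _ hy y rfl
    have step : ∀ s, IsSimple s → len (s * w) < len w → ∃ h, IsKL w h ∧
        csim s * h = (vpow 1 + vpow (-1)) • h := by
      intro s hs hlt
      have e := hs.isReflection.mul_cancel_left w
      have := IsKL.step hs (w := s * w) (by rwa [e]) (hC _ hlt).1 C
        (fun y hy => (hC y (by rwa [e] at hy)).1) (fun y hy => (hC y (by rwa [e] at hy)).2 s hs)
      rwa [e] at this
    by_cases h0 : len w = 0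
    · obtain ⟨a, rfl⟩ := eq_rho_zpow_of_len_eq_zero h0
      exact ⟨_, isKL_rho a, fun s _ hlt => absurd hlt (by omega)⟩
    · obtain ⟨s, hs, hl⟩ := exists_left_descent h0
      obtain ⟨h, H, -⟩ := step s hs (by omega)
      -- Each descent `t` yields its own candidate that is an eigenvector for `t`; by uniqueness all
      -- candidates coincide.
      refine ⟨h, H, fun t ht hlt => ?_⟩
      obtain ⟨h', H', e'⟩ := step t ht hlt
      rw [H.unique H', e']

theorem coef_klSum (y w : AffSym r) (P : AffSym r →₀ Polynomial ℤ) :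
    coef y (klSum w P) = vpow ((len y : ℤ) - len w) * Polynomial.aeval (vpow 2) (P y) := by
  rw [klSum, Finsupp.sum, map_sum]
  simp only [map_smul, coef_TTn, smul_eq_mul]
  rw [Finset.sum_eq_single y]
  · rw [if_pos rfl, mul_one]
  · intro b _ hb; rw [if_neg hb, mul_zero]
  · intro h; rw [Finsupp.notMem_support_iff.1 h, map_zero, mul_zero, zero_mul]

/-- The degree bound on the polynomials is exactly the condition that the coefficients below `w`
have negative exponents. -/
theorem IsKLRow.isKL {w : AffSym r} {P : AffSym r →₀ Polynomial ℤ} (H : IsKLRow w P) :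
    IsKL w (klSum w P) where
  bar := H.2.2.2
  one := by rw [coef_klSum, H.1, map_one, mul_one, sub_self, vpow_zero]
  neg y hy := by
    rw [coef_klSum]
    by_cases h0 : P y = 0
    · rw [h0, map_zero, mul_zero]; exact zero_mem _
    · have h1 := H.2.2.1 y (H.2.1 y h0) hy
      refine vpow_mul_mem_expIn (aeval_mem_expIn _) ?_
      rintro m ⟨h2, h3, h4⟩
      simp only [Set.mem_ofPred_eq]
      omega
  par y := by
    rw [coef_klSum]
    refine vpow_mul_mem_expIn (aeval_mem_expIn _) ?_
    rintro m ⟨h2, h3, h4⟩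
    exact ⟨by omega, by omega⟩
  le y hy := by
    refine H.2.1 y fun h0 => hy ?_
    rw [coef_klSum, h0, map_zero, mul_zero]

theorem vpow_mul_cancel {k : ℤ} {a b : Zv} (h : vpow k * a = vpow k * b) : a = b := by
  have := congrArg (vpow (-k) * ·) h
  simpa only [← mul_assoc, vpow_neg_mul, one_mul] using this

theorem IsKLRow.unique {w : AffSym r} {P P' : AffSym r →₀ Polynomial ℤ} (H : IsKLRow w P)
    (H' : IsKLRow w P') : P = P' := by
  have e := H.isKL.unique H'.isKL
  ext1 y
  have := congrArg (coef y) e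
  rw [coef_klSum, coef_klSum] at this
  exact aeval_vpow_injective (vpow_mul_cancel this)

theorem IsKL.exists_isKLRow {w : AffSym r} {h : Hecke r} (H : IsKL w h) :
    ∃ P, IsKLRow w P ∧ klSum w P = h := by
  have hex : ∀ y, ∃ p : Polynomial ℤ, coef y h = vpow ((len y : ℤ) - len w) *
      Polynomial.aeval (vpow 2) p ∧
      (y ≠ w → p ≠ 0 → len y + 2 * p.natDegree + 1 ≤ len w) := by
    intro y
    by_cases hy : y = w
    · refine ⟨1, ?_, fun h => absurd hy h⟩
      rw [hy, H.one, map_one, mul_one, sub_self, vpow_zero]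
    · have hmem : coef y h ∈ expIn {m | -((len w : ℤ) - len y) ≤ m ∧ m ≤ -1 ∧
          2 ∣ m + ((len w : ℤ) - len y)} := by
        intro m hm
        by_cases hneg : m < 0
        · refine H.par y m fun h2 => hm ⟨?_, ?_, ?_⟩
          · have := h2.1; omega
          · omega
          · have := h2.2; omega
        · exact H.neg y hy m hneg
      obtain ⟨p, hp, hd⟩ := exists_poly hmem
      refine ⟨p, by rw [hp, neg_sub], fun _ h0 => ?_⟩
      have := hd h0
      omega
  choose p hp hd using hex
  have hp0 : ∀ y, p y ≠ 0 → coef y h ≠ 0 := by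
    intro y hy h0
    rw [hp, ← mul_zero (vpow ((len y : ℤ) - len w))] at h0
    exact hy (aeval_vpow_injective ((vpow_mul_cancel h0).trans (map_zero _).symm))
  let P : AffSym r →₀ Polynomial ℤ := Finsupp.onFinset ((basisTTn r).repr h).support p
    fun y hy => Finsupp.mem_support_iff.2 (hp0 y hy)
  have hP : klSum w P = h := hecke_ext fun y => by rw [coef_klSum, hp y]; rfl
  refine ⟨P, ⟨?_, fun y hy => H.le y (hp0 y hy), fun y hyw hne => ?_, by rw [hP, H.bar]⟩, hP⟩
  · have h1 := hp w
    rw [H.one, sub_self, vpow_zero, one_mul] at h1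
    exact aeval_vpow_injective (h1.symm.trans (map_one _).symm)
  · change len y + 2 * (p y).natDegree + 1 ≤ len w
    by_cases h0 : p y = 0
    -- The zero polynomial has `natDegree` zero, so here the inequality is the strict growth of the
    -- length.
    · have := hyw.len_lt hne
      rw [h0, Polynomial.natDegree_zero]
      omega
    · exact hd y hne h0

theorem existsUnique_isKLRow (w : AffSym r) : ∃! P, IsKLRow w P := by
  obtain ⟨h, H, -⟩ := exists_isKL w
  obtain ⟨P, hP, -⟩ := H.exists_isKLRow
  exact ⟨P, hP, fun P' hP' => hP'.unique hP⟩

theorem isKLRow_klRow (w : AffSym r) : IsKLRow w (klRow w) :=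
  Classical.epsilon_spec (existsUnique_isKLRow w).exists

theorem isKL_klC (w : AffSym r) : IsKL w (klC w) := (isKLRow_klRow w).isKL

theorem coef_klC (y w : AffSym r) : coef y (klC w) = vpow ((len y : ℤ) - len w) * klP y w :=
  coef_klSum y w _

theorem csim_mul_klC {s w : AffSym r} (hs : IsSimple s) (h : len (s * w) < len w) :
    csim s * klC w = (vpow 1 + vpow (-1)) • klC w := by
  obtain ⟨c, H, hc⟩ := exists_isKL w
  rw [(isKL_klC w).unique H, hc s hs h]

/-- Transfers statements about left descents of `C'_w` to right descents. -/
theorem IsKL.flip {w : AffSym r} {h : Hecke r} (H : IsKL w h) : IsKL w⁻¹ (flip r h) where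
  bar := by rw [heckeBar_flip, H.bar]
  one := by rw [coef_flip, inv_inv, H.one]
  neg y hy := by
    rw [coef_flip]
    exact H.neg _ fun e => hy (by rw [← e, inv_inv])
  par y := by
    rw [coef_flip]
    have := H.par y⁻¹
    rwa [len_inv] at this ⊢
  le y hy := by
    rw [coef_flip] at hy
    have := (H.le _ hy).inv
    rwa [inv_inv] at this

theorem flip_klC (w : AffSym r) : flip r (klC w) = klC w⁻¹ :=
  (isKL_klC w).flip.unique (isKL_klC w⁻¹)

end KL

/-! ### Young subgroups, blocks, and coset representatives. -/

section Parabolic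

set_option linter.unusedSectionVars false

variable {n r : ℕ} [NeZero n] [NeZero r]

/-- The index of the block containing a given integer. -/
def blk (la : Wt n r) (b : ℤ) : ℤ := (exists_block la b).choose

theorem mem_block_blk (la : Wt n r) (b : ℤ) : b ∈ block la (blk la b) :=
  (exists_block la b).choose_spec

theorem mem_block_iff (la : Wt n r) (m b : ℤ) : b ∈ block la m ↔ blk la b = m :=
  ⟨fun h => block_unique la (mem_block_blk la b) h, fun h => h ▸ mem_block_blk la b⟩

theorem blk_mono (la : Wt n r) : Monotone (blk la) := fun a b hab => by
  by_contra hc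
  have h1 := (mem_block la _ _).1 (mem_block_blk la a)
  have h2 := (mem_block la _ _).1 (mem_block_blk la b)
  have := blockStart_mono la (show blk la b + 1 ≤ blk la a by omega)
  omega

theorem blk_add (la : Wt n r) (b : ℤ) : blk la (b + r) = blk la b + n := by
  rw [← mem_block_iff, block_add]
  exact mem_block_blk la b

theorem blk_add_mul (la : Wt n r) (b k : ℤ) : blk la (b + k * r) = blk la b + k * n := by
  induction k using Int.induction_on with
  | zero => simp
  | succ k ih => rw [add_mul, one_mul, ← add_assoc, blk_add, ih]; ring
  | pred k ih =>
    have := blk_add la (b + (-(k : ℤ) - 1) * r)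
    rw [show b + (-(k : ℤ) - 1) * r + r = b + -k * r by ring, ih] at this
    linarith

theorem natCast_pos' (n : ℕ) [NeZero n] : (0 : ℤ) < n := by
  exact_mod_cast Nat.pos_of_ne_zero (NeZero.ne n)

/-- A shift by `k r` moves the block index by `k n`. -/
theorem not_modEq_of_blk_eq {la : Wt n r} {i j : ℤ} (h : blk la i = blk la j) (hne : i ≠ j) :
    ¬ i ≡ j [ZMOD r] := by
  intro e
  obtain ⟨k, hk⟩ := e.dvd
  have hj : j = i + k * r := by linarith
  rw [hj, blk_add_mul] at h
  have : k = 0 := by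
    have := natCast_pos' n
    have h0 : k * n = 0 := by linarith
    rcases mul_eq_zero.1 h0 with h | h
    · exact h
    · omega
  rw [this] at hj
  exact hne (by simpa using hj.symm)

theorem mem_young {la : Wt n r} {w : AffSym r} :
    w ∈ young la ↔ ∀ a, blk la (w.1 a) = blk la a := by
  change (∀ m a, w.1 a ∈ block la m ↔ a ∈ block la m) ↔ _
  simp only [mem_block_iff]
  exact ⟨fun h a => (h (blk la a) a).2 rfl, fun h m a => by rw [h]⟩

theorem blk_inv_of_mem_young {la : Wt n r} {w : AffSym r} (hw : w ∈ young la) (a : ℤ) :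
    blk la (w⁻¹.1 a) = blk la a := mem_young.1 (inv_mem hw) a

theorem affSwap_mem_young {la : Wt n r} {i j : ℤ} (h : ¬ i ≡ j [ZMOD r])
    (hb : blk la i = blk la j) : affSwap r i j h ∈ young la := by
  refine mem_young.2 fun a => ?_
  by_cases h1 : a ≡ i [ZMOD r]
  · rw [val_sub_of_modEq _ h1, affSwap_left]
    obtain ⟨k, hk⟩ := h1.symm.dvd
    rw [show j + (a - i) = j + k * r by linarith, show a = i + k * r by linarith, blk_add_mul,
      blk_add_mul, hb]
  · by_cases h2 : a ≡ j [ZMOD r]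
    · rw [val_sub_of_modEq _ h2, affSwap_right]
      obtain ⟨k, hk⟩ := h2.symm.dvd
      rw [show i + (a - j) = i + k * r by linarith, show a = j + k * r by linarith, blk_add_mul,
        blk_add_mul, hb]
    · rw [affSwap_of_ne h h1 h2]

/-- The function `f` is increasing on each block. -/
def IncOn (la : Wt n r) (f : ℤ → ℤ) : Prop := ∀ i j, i < j → blk la i = blk la j → f i < f j

/-- Blocks are intervals, so comparing neighbours suffices. Conditions on simple reflections thereby
become conditions on whole blocks. -/
theorem incOn_of_succ {la : Wt n r} {f : ℤ → ℤ}
    (h : ∀ i, blk la i = blk la (i + 1) → f i < f (i + 1)) : IncOn la f := by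
  have key : ∀ (k : ℕ) (i : ℤ), blk la i = blk la (i + k + 1) → f i < f (i + k + 1) := by
    intro k
    induction k with
    | zero => intro i hi; simpa using h i (by simpa using hi)
    | succ k ih =>
      intro i hi
      have h1 := blk_mono la (show i ≤ i + k + 1 by omega)
      have h2 := blk_mono la (show i + k + 1 ≤ i + (k + 1 : ℕ) + 1 by push_cast; omega)
      have h3 := ih i (by omega)
      have e : i + k + 1 + 1 = i + (k + 1 : ℕ) + 1 := by push_cast; ring
      have h4 := h (i + k + 1) (by rw [e]; omega)
      rw [e] at h4
      exact h3.trans h4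
  intro i j hij hb
  obtain ⟨k, hk⟩ := Int.eq_ofNat_of_zero_le (show 0 ≤ j - i - 1 by omega)
  obtain rfl : j = i + k + 1 := by omega
  exact key k i hb

/-- Preserving the blocks and increasing on each of them, `w⁻¹` increases everywhere and is a
translation by some `a`. -/
theorem eq_one_of_mem_young {la : Wt n r} {w : AffSym r} (hw : w ∈ young la)
    (h : IncOn la w⁻¹.1) : w = 1 := by
  have hmono : ∀ i, w⁻¹.1 i < w⁻¹.1 (i + 1) := by
    intro i
    by_cases hb : blk la i = blk la (i + 1)
    · exact h i (i + 1) (by omega) hb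
    · by_contra hc
      have h1 := blk_mono la (not_lt.1 hc)
      rw [blk_inv_of_mem_young hw, blk_inv_of_mem_young hw] at h1
      exact hb (le_antisymm (blk_mono la (by omega)) h1)
  obtain ⟨a, ha⟩ : ∃ a : ℤ, w⁻¹ = rho r ^ a := ⟨_, eq_rho_zpow_of_lt _ hmono⟩
  -- Repeating the translation `r` times shifts the block index by `a n`, yet must preserve it, so
  -- `a = 0`.
  have hk : ∀ k : ℕ, blk la (k * a) = blk la 0 := by
    intro k
    induction k with
    | zero => simp
    | succ k ih =>
      have := blk_inv_of_mem_young hw (k * a)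
      rw [ha, rho_zpow_apply] at this
      rw [← ih, ← this]
      congr 1
      push_cast; ring
  have h1 := blk_add_mul la 0 a
  rw [zero_add, mul_comm, hk r] at h1
  have h2 := natCast_pos' n
  have h3 : a * n = 0 := by linarith
  have h4 : a = 0 := by
    rcases mul_eq_zero.1 h3 with h | h
    · exact h
    · omega
  rw [h4, zpow_zero] at ha
  exact inv_eq_one.1 ha

/-- Induction over a Young subgroup. -/
theorem young_induction {la : Wt n r} {P : AffSym r → Prop} (h0 : P 1)
    (h1 : ∀ (i : ℤ) (h : ¬ i ≡ i + 1 [ZMOD r]) (w : AffSym r), blk la i = blk la (i + 1) →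
      w ∈ young la → len w < len (affSwap r i (i + 1) h * w) → P w →
      P (affSwap r i (i + 1) h * w)) {w : AffSym r} (hw : w ∈ young la) : P w := by
  induction hn : len w using Nat.strong_induction_on generalizing w with
  | _ m ih =>
    subst hn
    by_cases hc : ∃ i, blk la i = blk la (i + 1) ∧ w⁻¹.1 (i + 1) < w⁻¹.1 i
    · obtain ⟨i, hb, hi⟩ := hc
      have h := not_modEq_of_blk_eq hb (by omega)
      have hlt := len_affSwap_mul_lt h (by omega) hi
      have hmem := mul_mem (affSwap_mem_young h hb) hw
      have e : affSwap r i (i + 1) h * (affSwap r i (i + 1) h * w) = w := by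
        rw [← mul_assoc, affSwap_mul_self, one_mul]
      have := h1 i h (affSwap r i (i + 1) h * w) hb hmem (by rwa [e]) (ih _ hlt hmem rfl)
      rwa [e] at this
    · push Not at hc
      rw [eq_one_of_mem_young hw (incOn_of_succ fun i hi =>
        lt_of_le_of_ne (hc i hi) (inv_val_ne (by omega)))]
      exact h0

/-- An element `u` of the Young subgroup keeps a pair of neighbours inside its block, where `d⁻¹` is
increasing. An ascent of `u` is therefore also an ascent of `u d`, and the lengths grow in step. -/
theorem len_mul_of_incOn {la : Wt n r} {d : AffSym r} (hd : IncOn la d⁻¹.1) {w : AffSym r}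
    (hw : w ∈ young la) : len (w * d) = len w + len d := by
  refine young_induction (P := fun w => len (w * d) = len w + len d) ?_ ?_ hw
  · rw [one_mul, len_one, zero_add]
  · intro i h u hb hu hl ih
    have hs : IsSimple (affSwap r i (i + 1) h) := ⟨i, h, rfl⟩
    have h2 := (len_lt_affSwap_mul_iff h (by omega)).1 hl
    have h3 : len (u * d) < len (affSwap r i (i + 1) h * (u * d)) := by
      refine len_lt_affSwap_mul h (by omega) ?_
      rw [mul_inv_rev]
      exact hd _ _ h2 (by rw [blk_inv_of_mem_young hu, blk_inv_of_mem_young hu, hb])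
    rw [mul_assoc]
    have h4 := hs.len_mul u
    have h5 := hs.len_mul (u * d)
    omega

theorem mem_cosetReps_iff {la : Wt n r} {d : AffSym r} :
    d ∈ cosetReps la ↔ IncOn la d⁻¹.1 := by
  refine ⟨fun hd => incOn_of_succ fun i hb => ?_, fun hd w hw => len_mul_of_incOn hd hw⟩
  have h := not_modEq_of_blk_eq hb (by omega)
  have hs : IsSimple (affSwap r i (i + 1) h) := ⟨i, h, rfl⟩
  have h1 := hd _ (affSwap_mem_young h hb)
  rw [hs.len_eq_one] at h1
  exact (len_lt_affSwap_mul_iff h (by omega)).1 (by omega)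

theorem blockStart_one' (la : Wt n r) : blockStart la 1 = 0 := by
  have := blockStart_one_add la 0
  simpa using this

theorem blk_mem_Icc (la : Wt n r) (b : ℤ) :
    (1 ≤ blk la b ∧ blk la b ≤ n) ↔ (1 ≤ b ∧ b ≤ r) := by
  have h1 := (mem_block la _ _).1 (mem_block_blk la b)
  have h2 := blockStart_one' la
  have h3 : blockStart la (n + 1) = r := by
    have := blockStart_one_add la 1
    simpa using this
  have hm := blockStart_mono la
  constructor
  · rintro ⟨h4, h5⟩
    have h6 := hm h4
    have h7 := hm (show blk la b + 1 ≤ n + 1 by omega)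
    omega
  · rintro ⟨h4, h5⟩
    constructor
    · by_contra hc
      have := hm (show blk la b + 1 ≤ 1 by omega)
      omega
    · by_contra hc
      have := hm (show (n : ℤ) + 1 ≤ blk la b by omega)
      omega

theorem exists_rep_Icc (r : ℕ) [NeZero r] (i : ℤ) :
    ∃ j ∈ Finset.Icc (1 : ℤ) r, ∃ k : ℤ, i = j + k * r := by
  have hr := natCast_pos' r
  have h0 := Int.emod_nonneg (i - 1) hr.ne'
  have h1 := Int.emod_lt_of_pos (i - 1) hr
  refine ⟨(i - 1) % r + 1, Finset.mem_Icc.2 ⟨by omega, by omega⟩, (i - 1) / r, ?_⟩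
  have := Int.emod_add_mul_ediv (i - 1) r
  linarith [mul_comm ((i - 1) / (r : ℤ)) r]

/-- The interval from `1` to `r` is the union of the blocks `1, …, n`, so it is preserved, and by
periodicity it determines the permutation. -/
theorem finite_young (la : Wt n r) : (young la : Set (AffSym r)).Finite := by
  have hmap : ∀ w : young la, ∀ i ∈ Finset.Icc (1 : ℤ) r, w.1.1 i ∈ Finset.Icc (1 : ℤ) r := by
    intro w i hi
    rw [Finset.mem_Icc, ← blk_mem_Icc la] at hi ⊢
    rwa [mem_young.1 w.2]
  suffices Finite (young la) from Set.toFinite _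
  refine Finite.of_injective (β := Finset.Icc (1 : ℤ) r → Finset.Icc (1 : ℤ) r)
    (fun w i => ⟨w.1.1 i, hmap w i i.2⟩) fun w w' h => Subtype.ext (affSym_ext fun i => ?_)
  obtain ⟨j, hj, k, rfl⟩ := exists_rep_Icc r i
  have := congrArg Subtype.val (congrFun h ⟨j, hj⟩)
  rw [val_add_mul, val_add_mul]
  simpa using this

theorem self_mem_dblCoset (la mu : Wt n r) (d : AffSym r) : d ∈ dblCoset la d mu :=
  ⟨1, one_mem _, 1, one_mem _, by simp⟩

theorem mul_mem_dblCoset {la mu : Wt n r} {d w a b : AffSym r} (h : w ∈ dblCoset la d mu)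
    (ha : a ∈ young la) (hb : b ∈ young mu) : a * w * b ∈ dblCoset la d mu := by
  obtain ⟨a', ha', b', hb', rfl⟩ := h
  exact ⟨a * a', mul_mem ha ha', b' * b, mul_mem hb' hb, by simp only [mul_assoc]⟩

theorem left_mul_mem_dblCoset {la mu : Wt n r} {d w a : AffSym r} (h : w ∈ dblCoset la d mu)
    (ha : a ∈ young la) : a * w ∈ dblCoset la d mu := by
  simpa using mul_mem_dblCoset h ha (one_mem _)

theorem right_mul_mem_dblCoset {la mu : Wt n r} {d w b : AffSym r} (h : w ∈ dblCoset la d mu)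
    (hb : b ∈ young mu) : w * b ∈ dblCoset la d mu := by
  simpa using mul_mem_dblCoset h (one_mem _) hb

theorem dblCoset_eq_of_mem {la mu : Wt n r} {d w : AffSym r} (h : w ∈ dblCoset la d mu) :
    dblCoset la w mu = dblCoset la d mu := by
  refine Set.Subset.antisymm ?_ ?_
  · rintro _ ⟨a, ha, b, hb, rfl⟩
    exact mul_mem_dblCoset h ha hb
  · obtain ⟨a, ha, b, hb, rfl⟩ := h
    rintro _ ⟨a', ha', b', hb', rfl⟩
    refine ⟨a' * a⁻¹, mul_mem ha' (inv_mem ha), b⁻¹ * b', mul_mem (inv_mem hb) hb', ?_⟩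
    group

theorem finite_dblCoset (la mu : Wt n r) (d : AffSym r) : (dblCoset la d mu).Finite := by
  refine (((finite_young la).prod (finite_young mu)).image fun p => p.1 * d * p.2).subset ?_
  rintro _ ⟨a, ha, b, hb, rfl⟩
  exact ⟨(a, b), ⟨ha, hb⟩, rfl⟩

theorem inv_mem_dblCoset {la mu : Wt n r} {d w : AffSym r} (h : w ∈ dblCoset la d mu) :
    w⁻¹ ∈ dblCoset mu d⁻¹ la := by
  obtain ⟨a, ha, b, hb, rfl⟩ := h
  exact ⟨b⁻¹, inv_mem hb, a⁻¹, inv_mem ha, by group⟩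

theorem incOn_of_minimal {la mu : Wt n r} {d w : AffSym r} (hw : w ∈ dblCoset la d mu)
    (hmin : ∀ u ∈ dblCoset la d mu, len w ≤ len u) : IncOn la w⁻¹.1 := by
  refine incOn_of_succ fun i hb => ?_
  have h := not_modEq_of_blk_eq hb (by omega)
  have h1 := hmin _ (left_mul_mem_dblCoset hw (affSwap_mem_young h hb))
  by_contra hc
  have := len_affSwap_mul_lt h (by omega)
    (lt_of_le_of_ne (not_lt.1 hc) (inv_val_ne (w := w⁻¹) (by omega)))
  omega

/-- An ascent inside a block would allow a longer element in the double coset. Decreasing is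
expressed as `IncOn` of the negative. -/
theorem decOn_of_maximal {la mu : Wt n r} {d w : AffSym r} (hw : w ∈ dblCoset la d mu)
    (hmax : ∀ u ∈ dblCoset la d mu, len u ≤ len w) : IncOn la fun i => -w⁻¹.1 i := by
  refine incOn_of_succ fun i hb => ?_
  have h := not_modEq_of_blk_eq hb (by omega)
  have h1 := hmax _ (left_mul_mem_dblCoset hw (affSwap_mem_young h hb))
  by_contra hc
  have := len_lt_affSwap_mul (w := w) h (by omega)
    (lt_of_le_of_ne (by omega) (inv_val_ne (w := w⁻¹) (by omega)))
  omega

theorem exists_minimal (la mu : Wt n r) (d : AffSym r) :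
    ∃ w ∈ dblCoset la d mu, ∀ u ∈ dblCoset la d mu, len w ≤ len u :=
  Set.exists_min_image _ len (finite_dblCoset la mu d) ⟨d, self_mem_dblCoset la mu d⟩

theorem exists_maximal (la mu : Wt n r) (d : AffSym r) :
    ∃ w, IsLongest (dblCoset la d mu) w := by
  obtain ⟨w, hw, h⟩ := Set.exists_max_image _ len (finite_dblCoset la mu d)
    ⟨d, self_mem_dblCoset la mu d⟩
  exact ⟨w, hw, h⟩

theorem inv_minimal {la mu : Wt n r} {d w : AffSym r}
    (hmin : ∀ u ∈ dblCoset la d mu, len w ≤ len u) :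
    ∀ u ∈ dblCoset mu d⁻¹ la, len w⁻¹ ≤ len u := by
  intro u hu
  have := hmin _ (by simpa using inv_mem_dblCoset hu)
  rwa [len_inv] at this ⊢

theorem inv_maximal {la mu : Wt n r} {d w : AffSym r}
    (hmax : ∀ u ∈ dblCoset la d mu, len u ≤ len w) :
    ∀ u ∈ dblCoset mu d⁻¹ la, len u ≤ len w⁻¹ := by
  intro u hu
  have := hmax _ (by simpa using inv_mem_dblCoset hu)
  rwa [len_inv] at this ⊢

theorem mem_dblReps_iff {la mu : Wt n r} {d : AffSym r} :
    d ∈ dblReps la mu ↔ IncOn la d⁻¹.1 ∧ IncOn mu d.1 := by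
  rw [dblReps, Set.mem_ofPred_eq, mem_cosetReps_iff, mem_cosetReps_iff, inv_inv]

theorem mem_dblReps_of_minimal {la mu : Wt n r} {d w : AffSym r} (hw : w ∈ dblCoset la d mu)
    (hmin : ∀ u ∈ dblCoset la d mu, len w ≤ len u) : w ∈ dblReps la mu := by
  refine mem_dblReps_iff.2 ⟨incOn_of_minimal hw hmin, ?_⟩
  have := incOn_of_minimal (inv_mem_dblCoset hw) (inv_minimal hmin)
  rwa [inv_inv] at this

theorem decOn_val_of_maximal {la mu : Wt n r} {d w : AffSym r} (hw : w ∈ dblCoset la d mu)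
    (hmax : ∀ u ∈ dblCoset la d mu, len u ≤ len w) : IncOn mu fun i => -w.1 i := by
  have := decOn_of_maximal (inv_mem_dblCoset hw) (inv_maximal hmax)
  rwa [inv_inv] at this

/-! ### Recovering elements of double cosets from their matrices. -/

theorem jEntry_eq_card (la mu : Wt n r) (w : AffSym r) (k l : ℤ) :
    jEntry la w mu k l = ((block mu l).filter fun c => blk la (w.1 c) = k).card := by
  unfold jEntry
  refine Finset.card_bij' (fun b _ => w⁻¹.1 b) (fun c _ => w.1 c) ?_ ?_ ?_ ?_
  · intro b hb
    rw [mem_jEntry, mem_block_iff] at hb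
    exact Finset.mem_filter.2 ⟨hb.2, by rw [val_inv_apply]; exact hb.1⟩
  · intro c hc
    rw [Finset.mem_filter] at hc
    rw [mem_jEntry, mem_block_iff]
    exact ⟨hc.2, by rw [perm_inv_apply]; exact hc.1⟩
  · intro b _; exact val_inv_apply w b
  · intro c _; exact inv_val_apply w c

theorem jEntry_inv (la mu : Wt n r) (w : AffSym r) (k l : ℤ) :
    jEntry mu w⁻¹ la l k = jEntry la w mu k l := by
  rw [jEntry_eq_card]
  unfold jEntry
  congr 1
  ext b
  rw [Finset.mem_filter, mem_jEntry, mem_block_iff mu]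
  rfl

theorem jEntry_congr {la mu : Wt n r} {d w : AffSym r} (h : w ∈ dblCoset la d mu) (k l : ℤ) :
    jEntry la w mu k l = jEntry la d mu k l := by
  obtain ⟨a, ha, b, hb, rfl⟩ := h
  rw [jEntry_eq_card, jEntry_eq_card]
  refine Finset.card_bij' (fun c _ => b.1 c) (fun c _ => b⁻¹.1 c) ?_ ?_ ?_ ?_
  · intro c hc
    rw [Finset.mem_filter, mem_block_iff] at hc ⊢
    refine ⟨by rw [mem_young.1 hb, hc.1], ?_⟩
    rw [← hc.2]
    exact (mem_young.1 ha _).symm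
  · intro c hc
    rw [Finset.mem_filter, mem_block_iff] at hc ⊢
    refine ⟨by rw [blk_inv_of_mem_young hb, hc.1], ?_⟩
    rw [mul_val_apply, mul_val_apply, mem_young.1 ha, val_inv_apply, hc.2]
  · intro c _; exact inv_val_apply b c
  · intro c _; exact val_inv_apply b c

/-- Functions that are monotone on a finite set and have fibres of equal size agree. -/
theorem eqOn_of_card_fiber_eq {s : Finset ℤ} {f f' : ℤ → ℤ}
    (hf : ∀ a ∈ s, ∀ b ∈ s, a < b → f a ≤ f b) (hf' : ∀ a ∈ s, ∀ b ∈ s, a < b → f' a ≤ f' b)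
    (h : ∀ k, (s.filter fun c => f c = k).card = (s.filter fun c => f' c = k).card) :
    ∀ a ∈ s, f a = f' a := by
  have hmap : s.val.map f = s.val.map f' := by
    refine Multiset.ext.2 fun k => ?_
    rw [Multiset.count_map, Multiset.count_map]
    have := h k
    simp only [Finset.card_def, Finset.filter_val] at this
    simpa only [eq_comm] using this
  have hle : ∀ k, (s.filter fun c => f c ≤ k).card = (s.filter fun c => f' c ≤ k).card := by
    intro k
    have := congrArg (Multiset.countP (· ≤ k)) hmap
    rw [Multiset.countP_map, Multiset.countP_map] at this
    simpa only [Finset.card_def, Finset.filter_val] using this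
  -- If `f a < f' a`, monotonicity makes the set where `f' ≤ f a` a proper subset of the one where
  -- `f ≤ f a`, against the equality of cardinalities.
  have key : ∀ {f f' : ℤ → ℤ}, (∀ a ∈ s, ∀ b ∈ s, a < b → f a ≤ f b) →
      (∀ a ∈ s, ∀ b ∈ s, a < b → f' a ≤ f' b) →
      (∀ k, (s.filter fun c => f c ≤ k).card = (s.filter fun c => f' c ≤ k).card) →
      ∀ a ∈ s, f' a ≤ f a := by
    intro f f' hf hf' h a ha
    by_contra hlt
    have h1 : (s.filter fun c => f' c ≤ f a) ⊂ (s.filter fun c => f c ≤ f a) := by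
      rw [Finset.ssubset_iff_of_subset]
      · refine ⟨a, Finset.mem_filter.2 ⟨ha, le_rfl⟩, fun hm => hlt (Finset.mem_filter.1 hm).2⟩
      · intro c hc
        obtain ⟨hc, hc'⟩ := Finset.mem_filter.1 hc
        refine Finset.mem_filter.2 ⟨hc, ?_⟩
        rcases lt_trichotomy c a with hca | rfl | hca
        · exact hf c hc a ha hca
        · exact le_rfl
        · have := hf' a ha c hc hca
          omega
    have := Finset.card_lt_card h1
    rw [h] at this
    omega
  exact fun a ha => le_antisymm (key hf' hf (fun k => (hle k).symm) a ha) (key hf hf' hle a ha)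

/-- The matrix records how many elements of each `mu`-block are sent to each `la`-block.
Monotonicity on the `mu`-block then dictates which elements these are. -/
theorem blk_val_eq_of_jEntry_eq {la mu : Wt n r} {w w' : AffSym r}
    (h : ∀ k l, jEntry la w mu k l = jEntry la w' mu k l)
    (hw : IncOn mu w.1 ∧ IncOn mu w'.1 ∨ (IncOn mu fun i => -w.1 i) ∧ IncOn mu fun i => -w'.1 i)
    (a : ℤ) : blk la (w.1 a) = blk la (w'.1 a) := by
  have hbl : ∀ c ∈ block mu (blk mu a), ∀ c' ∈ block mu (blk mu a), blk mu c = blk mu c' := by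
    intro c hc c' hc'
    rw [mem_block_iff] at hc hc'
    rw [hc, hc']
  rcases hw with ⟨h1, h2⟩ | ⟨h1, h2⟩
  · refine eqOn_of_card_fiber_eq (s := block mu (blk mu a)) (f := fun c => blk la (w.1 c))
      (f' := fun c => blk la (w'.1 c)) ?_ ?_ ?_ a (mem_block_blk mu a)
    · exact fun c hc c' hc' hlt => blk_mono la (h1 c c' hlt (hbl c hc c' hc')).le
    · exact fun c hc c' hc' hlt => blk_mono la (h2 c c' hlt (hbl c hc c' hc')).le
    · intro k
      rw [← jEntry_eq_card, ← jEntry_eq_card, h]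
  · refine neg_injective (eqOn_of_card_fiber_eq (s := block mu (blk mu a))
      (f := fun c => -blk la (w.1 c)) (f' := fun c => -blk la (w'.1 c)) ?_ ?_ ?_ a
      (mem_block_blk mu a))
    · intro c hc c' hc' hlt
      have : -w.1 c < -w.1 c' := h1 c c' hlt (hbl c hc c' hc')
      exact neg_le_neg (blk_mono la (by omega))
    · intro c hc c' hc' hlt
      have : -w'.1 c < -w'.1 c' := h2 c c' hlt (hbl c hc c' hc')
      exact neg_le_neg (blk_mono la (by omega))
    · intro k
      simp only [neg_eq_iff_eq_neg]
      rw [← jEntry_eq_card, ← jEntry_eq_card, h]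

/-- The quotient `w w'⁻¹` lies in the Young subgroup, and an inversion of its inverse inside a block
would contradict the common monotonicity of `w⁻¹` and `w'⁻¹`. -/
theorem eq_of_blk_val_eq {la : Wt n r} {w w' : AffSym r}
    (h : ∀ a, blk la (w.1 a) = blk la (w'.1 a))
    (hw : IncOn la w⁻¹.1 ∧ IncOn la w'⁻¹.1 ∨
      (IncOn la fun i => -w⁻¹.1 i) ∧ IncOn la fun i => -w'⁻¹.1 i) : w = w' := by
  have hu : w * w'⁻¹ ∈ young la := mem_young.2 fun a => by
    rw [mul_val_apply, h, val_inv_apply]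
  refine mul_inv_eq_one.1 (eq_one_of_mem_young hu ?_)
  intro i j hij hb
  have h1 := blk_inv_of_mem_young hu i
  have h2 := blk_inv_of_mem_young hu j
  have e : ∀ k, w'⁻¹.1 ((w * w'⁻¹)⁻¹.1 k) = w⁻¹.1 k := fun k => by
    rw [← mul_val_apply]; congr 2; group
  by_contra hc
  have hlt : (w * w'⁻¹)⁻¹.1 j < (w * w'⁻¹)⁻¹.1 i :=
    lt_of_le_of_ne (not_lt.1 hc) (inv_val_ne (by omega))
  rcases hw with ⟨h3, h4⟩ | ⟨h3, h4⟩
  · have h5 := h3 i j hij hb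
    have h6 := h4 _ _ hlt (by rw [h1, h2, hb])
    rw [e, e] at h6
    omega
  · have h5 : -w⁻¹.1 i < -w⁻¹.1 j := h3 i j hij hb
    have h6 := h4 _ _ hlt (by rw [h1, h2, hb])
    simp only [e] at h6
    omega

theorem dblReps_unique {la mu : Wt n r} {d d' : AffSym r} (hd : d ∈ dblReps la mu)
    (hd' : d' ∈ dblReps la mu) (h : ∀ k l, jEntry la d mu k l = jEntry la d' mu k l) : d = d' := by
  rw [mem_dblReps_iff] at hd hd'
  exact eq_of_blk_val_eq (blk_val_eq_of_jEntry_eq h (Or.inl ⟨hd.2, hd'.2⟩)) (Or.inl ⟨hd.1, hd'.1⟩)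

/-- The same rigidity as in `dblReps_unique`, with decreasing in place of increasing; no
factorization of the double coset is required. -/
theorem isLongest_unique {la mu : Wt n r} {d w w' : AffSym r} (h : IsLongest (dblCoset la d mu) w)
    (h' : IsLongest (dblCoset la d mu) w') : w = w' :=
  eq_of_blk_val_eq (blk_val_eq_of_jEntry_eq
    (fun k l => (jEntry_congr h.1 k l).trans (jEntry_congr h'.1 k l).symm)
    (Or.inr ⟨decOn_val_of_maximal h.1 h.2, decOn_val_of_maximal h'.1 h'.2⟩))
    (Or.inr ⟨decOn_of_maximal h.1 h.2, decOn_of_maximal h'.1 h'.2⟩)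

theorem existsUnique_isLongest_dblCoset (la mu : Wt n r) (d : AffSym r) :
    ∃! w, IsLongest (dblCoset la d mu) w := by
  obtain ⟨w, hw⟩ := exists_maximal la mu d
  exact ⟨w, hw, fun w' hw' => isLongest_unique hw' hw⟩

theorem dblCoset_one (la : Wt n r) : dblCoset la 1 la = (young la : Set (AffSym r)) := by
  ext w
  constructor
  · rintro ⟨a, ha, b, hb, rfl⟩
    rw [mul_one]
    exact mul_mem ha hb
  · intro hw
    exact ⟨w, hw, 1, one_mem _, by simp⟩

theorem existsUnique_isLongest_young (la : Wt n r) :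
    ∃! w, IsLongest (young la : Set (AffSym r)) w := by
  rw [← dblCoset_one]
  exact existsUnique_isLongest_dblCoset la la 1

theorem isLongest_dPlus (la mu : Wt n r) (d : AffSym r) :
    IsLongest (dblCoset la d mu) (dPlus la d mu) :=
  Classical.epsilon_spec (exists_maximal la mu d)

theorem isLongest_wZero (la : Wt n r) : IsLongest (young la : Set (AffSym r)) (wZero la) :=
  Classical.epsilon_spec (existsUnique_isLongest_young la).exists

end Parabolic

/-! ### Bijectivity of the map from triples to matrices. -/

section Matrices

set_option linter.unusedSectionVars false

variable {n r : ℕ} [NeZero n] [NeZero r]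

theorem jEntry_col_sum (la mu : Wt n r) (d : AffSym r) (l : ℤ) :
    ∑ᶠ k, jEntry la d mu k l = mu l := by
  rw [← (jEntry_row_sum mu d⁻¹ la l).2]
  exact finsum_congr fun k => (jEntry_inv la mu d k l).symm

theorem ro_jMap (t : Triple n r) : ro (jMap t) = t.la.1 :=
  funext fun i => (jEntry_row_sum t.la t.d t.mu i).2

theorem co_jMap (t : Triple n r) : co (jMap t) = t.mu.1 :=
  funext fun j => jEntry_col_sum t.la t.mu t.d j

theorem Triple.ext' {t t' : Triple n r} (h1 : t.la = t'.la) (h2 : t.mu = t'.mu)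
    (h3 : t.d = t'.d) : t = t' := by
  cases t; cases t'
  subst h1 h2 h3
  rfl

theorem jMap_injective : Function.Injective (jMap : Triple n r → Theta n r) := by
  intro t t' h
  have h1 : t.la = t'.la := Subtype.ext (by rw [← ro_jMap, ← ro_jMap, h])
  have h2 : t.mu = t'.mu := Subtype.ext (by rw [← co_jMap, ← co_jMap, h])
  refine Triple.ext' h1 h2 ?_
  have h3 : ∀ k l, jEntry t.la t.d t.mu k l = jEntry t'.la t'.d t'.mu k l := fun k l =>
    congrFun (congrFun (congrArg Subtype.val h) k) l
  refine dblReps_unique t.mem (h1 ▸ h2 ▸ t'.mem) fun k l => ?_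
  rw [h3, h1, h2]

theorem theta_add_mul (A : Theta n r) (i j q : ℤ) : A (i + q * n) (j + q * n) = A i j := by
  induction q using Int.induction_on with
  | zero => simp
  | succ k ih =>
    rw [add_mul, one_mul, ← add_assoc, ← add_assoc, A.2.1, ih]
  | pred k ih =>
    rw [← ih, ← A.2.1 (i + (-(k : ℤ) - 1) * n) (j + (-(k : ℤ) - 1) * n)]
    rw [show i + (-(k : ℤ) - 1) * n + n = i + -k * n by ring,
      show j + (-(k : ℤ) - 1) * n + n = j + -k * n by ring]

/-- Integers as pairs of a residue in `1, …, n` and a quotient. -/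
def residueEquiv (n : ℕ) [NeZero n] : (Finset.Icc (1 : ℤ) n) × ℤ ≃ ℤ :=
  Equiv.ofBijective (fun p => p.1.1 + p.2 * n) (by
    have hn := natCast_pos' n
    constructor
    · rintro ⟨⟨a, ha⟩, q⟩ ⟨⟨b, hb⟩, q'⟩ h
      rw [Finset.mem_Icc] at ha hb
      simp only at h
      have h1 : q = q' := by
        rcases lt_trichotomy q q' with hl | hl | hl
        · nlinarith
        · exact hl
        · nlinarith
      subst h1
      have : a = b := by linarith
      subst this
      rfl
    · intro i
      obtain ⟨j, hj, k, e⟩ := exists_rep_Icc n i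
      exact ⟨(⟨j, hj⟩, k), e.symm⟩)

theorem finsum_residue {M : Type*} [AddCommMonoid M] (f : ℤ → M)
    (hf : (Function.support f).Finite) :
    ∑ᶠ j, f j = ∑ j ∈ Finset.Icc (1 : ℤ) n, ∑ᶠ q : ℤ, f (j + q * n) := by
  rw [← finsum_comp_equiv (residueEquiv n), finsum_curry, finsum_eq_sum_of_fintype]
  · exact Finset.sum_coe_sort (Finset.Icc (1 : ℤ) n) fun j => ∑ᶠ q : ℤ, f (j + q * n)
  · exact hf.preimage (residueEquiv n).injective.injOn

/-- Both totals count the entries once per orbit of the diagonal shift by `n`: fold the free index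
modulo `n`, then move the shift from the column to the row. -/
theorem sum_co (A : Theta n r) : ∑ j ∈ Finset.Icc (1 : ℤ) n, co A j = r := by
  have h := A.2.2.2.2
  have h1 : ∀ i, ∑ᶠ j, A i j = ∑ j ∈ Finset.Icc (1 : ℤ) n, ∑ᶠ q : ℤ, A i (j + q * n) :=
    fun i => finsum_residue _ (A.2.2.1 i)
  have h2 : ∀ j, co A j = ∑ i ∈ Finset.Icc (1 : ℤ) n, ∑ᶠ q : ℤ, A (i + q * n) j :=
    fun j => finsum_residue (fun i => A i j) (A.2.2.2.1 j)
  refine Eq.trans ?_ h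
  simp only [h1, h2]
  rw [Finset.sum_comm]
  refine Finset.sum_congr rfl fun i _ => Finset.sum_congr rfl fun j _ => ?_
  rw [← finsum_comp_equiv (Equiv.neg ℤ)]
  refine finsum_congr fun q => ?_
  rw [Equiv.neg_apply, ← theta_add_mul A i (j + q * n) (-q)]
  rw [show j + q * n + -q * n = j by ring]

/-- The row sums as a weight. -/
def roWt (A : Theta n r) : Wt n r := ⟨ro A, fun i => by
  unfold ro
  rw [← finsum_comp_equiv (Equiv.addRight (n : ℤ))]
  exact finsum_congr fun j => A.2.1 i j, A.2.2.2.2⟩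

/-- The column sums as a weight. -/
def coWt (A : Theta n r) : Wt n r := ⟨co A, fun j => by
  unfold co
  rw [← finsum_comp_equiv (Equiv.addRight (n : ℤ))]
  exact finsum_congr fun i => A.2.1 i j, sum_co A⟩

/-- The sum of the values of `c` at the integers less than `k`. -/
def psum (c : ℤ → ℕ) (k : ℤ) : ℕ := ∑ᶠ t, if t < k then c t else 0

theorem psum_eq_sum {c : ℤ → ℕ} (hc : {t | c t ≠ 0}.Finite) (k : ℤ) :
    psum c k = ∑ t ∈ hc.toFinset, if t < k then c t else 0 := by
  refine finsum_eq_sum_of_support_subset _ fun t ht => ?_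
  rw [Set.Finite.coe_toFinset]
  intro h0
  exact ht (by simp only [h0, ite_self])

theorem psum_succ {c : ℤ → ℕ} (hc : {t | c t ≠ 0}.Finite) (k : ℤ) :
    psum c (k + 1) = psum c k + c k := by
  have h : c k = ∑ t ∈ hc.toFinset, if t = k then c t else 0 := by
    rw [Finset.sum_ite_eq']
    split_ifs with h
    · rfl
    · by_contra h0
      exact h (hc.mem_toFinset.2 h0)
  rw [psum_eq_sum hc, psum_eq_sum hc, h, ← Finset.sum_add_distrib]
  refine Finset.sum_congr rfl fun t _ => ?_
  by_cases h1 : t < k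
  · rw [if_pos (by omega), if_pos h1, if_neg (by omega), add_zero]
  · by_cases h2 : t = k
    · rw [if_pos (by omega), if_neg h1, if_pos h2, zero_add]
    · rw [if_neg (by omega), if_neg h1, if_neg h2]

theorem psum_mono {c : ℤ → ℕ} (hc : {t | c t ≠ 0}.Finite) : Monotone (psum c) :=
  monotone_int_of_le_succ fun k => by rw [psum_succ hc]; omega

theorem psum_le {c : ℤ → ℕ} (hc : {t | c t ≠ 0}.Finite) (k : ℤ) : psum c k ≤ ∑ᶠ t, c t := by
  rw [psum_eq_sum hc, finsum_eq_sum_of_support_subset (s := hc.toFinset) c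
    (by rw [Set.Finite.coe_toFinset]; exact subset_rfl)]
  exact Finset.sum_le_sum fun t _ => by split_ifs <;> simp

theorem exists_psum_lt_le {c : ℤ → ℕ} (hc : {t | c t ≠ 0}.Finite) {x : ℕ} (h0 : 0 < x)
    (hx : x ≤ ∑ᶠ t, c t) : ∃ k, psum c k < x ∧ x ≤ psum c (k + 1) := by
  obtain ⟨a, ha⟩ := hc.bddBelow
  obtain ⟨b, hb⟩ := hc.bddAbove
  have hlow : psum c a = 0 := by
    rw [psum_eq_sum hc]
    refine Finset.sum_eq_zero fun t ht => if_neg ?_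
    have := ha (hc.mem_toFinset.1 ht)
    omega
  have hhigh : psum c (b + 1) = ∑ᶠ t, c t := by
    rw [psum_eq_sum hc, finsum_eq_sum_of_support_subset (s := hc.toFinset) c
      (by rw [Set.Finite.coe_toFinset]; exact subset_rfl)]
    refine Finset.sum_congr rfl fun t ht => if_pos ?_
    have := hb (hc.mem_toFinset.1 ht)
    omega
  have hbd : ∃ e, ∀ z, psum c z < x → z ≤ e := by
    refine ⟨b + 1, fun z hz => ?_⟩
    by_contra hcon
    have := psum_mono hc (not_le.1 hcon).le
    omega
  obtain ⟨k, h1, h2⟩ := Int.exists_greatest_of_bdd hbd ⟨a, by rw [hlow]; exact h0⟩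
  refine ⟨k, h1, ?_⟩
  by_contra hcon
  have := h2 _ (not_le.1 hcon)
  omega

/-- The integer `a` is the `y`-th position in the part of the block `l` reserved for the entry
`(k, l)` of `A`. -/
def IsPos (mu : Wt n r) (A : ℤ → ℤ → ℕ) (a k l : ℤ) (y : ℕ) : Prop :=
  1 ≤ y ∧ y ≤ A k l ∧ a = blockStart mu l + psum (fun t => A t l) k + y

theorem IsPos.blk_eq {mu : Wt n r} {A : ℤ → ℤ → ℕ} (hf : ∀ l, {t | A t l ≠ 0}.Finite)
    (hs : ∀ l, ∑ᶠ t, A t l = mu l) {a k l : ℤ} {y : ℕ} (h : IsPos mu A a k l y) :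
    blk mu a = l := by
  obtain ⟨h1, h2, h3⟩ := h
  rw [← mem_block_iff, mem_block, blockStart_succ, h3]
  have h4 := psum_le (hf l) (k + 1)
  rw [psum_succ (hf l), hs] at h4
  constructor <;> omega

/-- The parts of a block reserved for different `k` are consecutive disjoint intervals, delimited by
the partial sums. -/
theorem IsPos.unique {mu : Wt n r} {A : ℤ → ℤ → ℕ} (hf : ∀ l, {t | A t l ≠ 0}.Finite)
    (hs : ∀ l, ∑ᶠ t, A t l = mu l) {a k l k' l' : ℤ} {y y' : ℕ} (h : IsPos mu A a k l y)
    (h' : IsPos mu A a k' l' y') : k = k' ∧ l = l' ∧ y = y' := by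
  obtain rfl : l = l' := (h.blk_eq hf hs).symm.trans (h'.blk_eq hf hs)
  obtain ⟨h1, h2, h3⟩ := h
  obtain ⟨h1', h2', h3'⟩ := h'
  have e1 := psum_succ (hf l) k
  have e2 := psum_succ (hf l) k'
  have hk : k = k' := by
    rcases lt_trichotomy k k' with hl | hl | hl
    · have := psum_mono (hf l) (show k + 1 ≤ k' by omega)
      omega
    · exact hl
    · have := psum_mono (hf l) (show k' + 1 ≤ k by omega)
      omega
  subst hk
  exact ⟨rfl, rfl, by omega⟩

theorem exists_isPos {mu : Wt n r} {A : ℤ → ℤ → ℕ} (hf : ∀ l, {t | A t l ≠ 0}.Finite)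
    (hs : ∀ l, ∑ᶠ t, A t l = mu l) (a : ℤ) : ∃ k l y, IsPos mu A a k l y := by
  have h := (mem_block mu _ _).1 (mem_block_blk mu a)
  set l := blk mu a
  rw [blockStart_succ] at h
  obtain ⟨x, hx⟩ := Int.eq_ofNat_of_zero_le (show 0 ≤ a - blockStart mu l by omega)
  obtain ⟨k, h1, h2⟩ := exists_psum_lt_le (hf l) (x := x) (by omega) (by rw [hs]; omega)
  rw [psum_succ (hf l)] at h2
  exact ⟨k, l, x - psum (fun t => A t l) k, by omega, by omega, by omega⟩

theorem psum_shift (A : Theta n r) (k l : ℤ) :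
    psum (fun t => A t (l + n)) (k + n) = psum (fun t => A t l) k := by
  unfold psum
  rw [← finsum_comp_equiv (Equiv.addRight (n : ℤ))]
  refine finsum_congr fun t => ?_
  simp only [Equiv.coe_addRight, add_lt_add_iff_right, A.2.1]

theorem psum_shift' (A : Theta n r) (k l : ℤ) : psum (A (k + n)) (l + n) = psum (A k) l := by
  unfold psum
  rw [← finsum_comp_equiv (Equiv.addRight (n : ℤ))]
  refine finsum_congr fun t => ?_
  simp only [Equiv.coe_addRight, add_lt_add_iff_right, A.2.1]

/-- Cut the column block `l` into pieces of sizes `A k l` in the order of `k`, and the row block `k`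
into pieces of sizes `A k l` in the order of `l`. Sending each piece in order onto its partner with
the same `(k, l)` gives a periodic permutation with matrix `A`. -/
theorem exists_jEntry_eq (A : Theta n r) :
    ∃ w : AffSym r, ∀ k l, jEntry (roWt A) w (coWt A) k l = A k l := by
  have hf := A.2.2.2.1
  have hs : ∀ l, ∑ᶠ t, A t l = (coWt A) l := fun _ => rfl
  have hf' := A.2.2.1
  have hs' : ∀ k, ∑ᶠ t, A k t = (roWt A) k := fun _ => rfl
  choose fk fl fy hpos using exists_isPos hf hs
  -- The row blocks are cut by applying the same construction to the transposed matrix.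
  choose gl gk gy hpos' using exists_isPos (mu := roWt A) (A := fun l k => A k l) hf' hs'
  have hcol : ∀ a, IsPos (roWt A) (fun l k => A k l)
      (blockStart (roWt A) (fk a) + psum (A (fk a)) (fl a) + fy a) (fl a) (fk a) (fy a) :=
    fun a => ⟨(hpos a).1, (hpos a).2.1, rfl⟩
  have hrow : ∀ b, IsPos (coWt A) A.1
      (blockStart (coWt A) (gl b) + psum (fun t => A t (gl b)) (gk b) + gy b)
      (gk b) (gl b) (gy b) :=
    fun b => ⟨(hpos' b).1, (hpos' b).2.1, rfl⟩
  let e : Equiv.Perm ℤ :=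
    { toFun := fun a => blockStart (roWt A) (fk a) + psum (A (fk a)) (fl a) + fy a
      invFun := fun b => blockStart (coWt A) (gl b) + psum (fun t => A t (gl b)) (gk b) + gy b
      left_inv := fun a => by
        obtain ⟨h1, h2, h3⟩ := (hcol a).unique hf' hs' (hpos' _)
        simp only [← h1, ← h2, ← h3]
        exact (hpos a).2.2.symm
      right_inv := fun b => by
        obtain ⟨h1, h2, h3⟩ := (hrow b).unique hf hs (hpos _)
        simp only [← h1, ← h2, ← h3]
        exact (hpos' b).2.2.symm }
  have he : ∀ a, e a = blockStart (roWt A) (fk a) + psum (A (fk a)) (fl a) + fy a := fun _ => rfl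
  have hper : ∀ a, e (a + r) = e a + r := by
    intro a
    have h : IsPos (coWt A) A.1 (a + r) (fk a + n) (fl a + n) (fy a) := by
      refine ⟨(hpos a).1, ?_, ?_⟩
      · rw [A.2.1]; exact (hpos a).2.1
      · rw [psum_shift, blockStart_add]
        have := (hpos a).2.2
        linarith
    obtain ⟨h1, h2, h3⟩ := h.unique hf hs (hpos _)
    rw [he, he, ← h1, ← h2, ← h3, psum_shift', blockStart_add]
    ring
  refine ⟨⟨e, hper⟩, fun k l => ?_⟩
  rw [jEntry_eq_card]
  have hblk : ∀ a, blk (roWt A) (e a) = fk a := fun a => (hcol a).blk_eq hf' hs'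
  have hc : (Finset.Icc 1 (A k l)).card = A k l := by rw [Nat.card_Icc]; omega
  conv_rhs => rw [← hc]
  symm
  refine Finset.card_bij (fun y _ => blockStart (coWt A) l + psum (fun t => A t l) k + y) ?_ ?_ ?_
  · intro y hy
    rw [Finset.mem_Icc] at hy
    have h : IsPos (coWt A) A.1 (blockStart (coWt A) l + psum (fun t => A t l) k + y) k l y :=
      ⟨hy.1, hy.2, rfl⟩
    rw [Finset.mem_filter, mem_block_iff]
    refine ⟨h.blk_eq hf hs, ?_⟩
    exact (hblk _).trans ((h.unique hf hs (hpos _)).1).symm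
  · intro y _ y' _ h
    simpa using h
  · intro c hc
    rw [Finset.mem_filter, mem_block_iff] at hc
    have h1 : fl c = l := ((hpos c).blk_eq hf hs).symm.trans hc.1
    have h2 : fk c = k := (hblk c).symm.trans hc.2
    have h3 := hpos c
    rw [h1, h2] at h3
    exact ⟨fy c, Finset.mem_Icc.2 ⟨h3.1, h3.2.1⟩, h3.2.2.symm⟩

/-- A permutation with the given matrix may be replaced by a shortest element of its double coset,
which has the same matrix. -/
theorem jMap_surjective : Function.Surjective (jMap : Triple n r → Theta n r) := by
  intro A
  obtain ⟨w, hw⟩ := exists_jEntry_eq A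
  obtain ⟨d, hd, hmin⟩ := exists_minimal (roWt A) (coWt A) w
  refine ⟨⟨roWt A, d, coWt A, mem_dblReps_of_minimal hd hmin⟩, Subtype.ext ?_⟩
  exact funext fun k => funext fun l => (jEntry_congr hd k l).trans (hw k l)

theorem jMap_bijective : Function.Bijective (jMap : Triple n r → Theta n r) :=
  ⟨jMap_injective, jMap_surjective⟩

theorem jMap_triple (A : Theta n r) : jMap (triple A) = A :=
  Function.rightInverse_invFun jMap_surjective A

theorem triple_jMap (t : Triple n r) : triple (jMap t) = t :=
  Function.leftInverse_invFun jMap_injective t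

end Matrices

/-! ### Length as a number of inversions, and the exponent `d_A`. -/

section Counting

set_option linter.unusedSectionVars false

variable {n r : ℕ} [NeZero n] [NeZero r]

/-- The reflections shortening `w` by right multiplication. -/
def rightInv (w : AffSym r) : Set (AffSym r) := {t | IsReflection t ∧ len (w * t) < len w}

theorem rightInv_rho (a : ℤ) : rightInv (rho r ^ a) = ∅ := by
  ext t
  simp only [rightInv, Set.mem_ofPred_eq, len_rho_zpow, Nat.not_lt_zero, and_false,
    Set.mem_empty_iff_false]

/-- All reflections `t` other than `w⁻¹ s w` keep their status: `w t w⁻¹ ≠ s`, so `s` preserves the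
direction of the change of length. -/
theorem rightInv_simple_mul {s w : AffSym r} (hs : IsSimple s) (h : len w < len (s * w)) :
    rightInv (s * w) = insert (w⁻¹ * s * w) (rightInv w) := by
  ext t
  by_cases ht : t = w⁻¹ * s * w
  · have h1 : IsReflection t := by
      have := hs.isReflection.conj w⁻¹
      rwa [inv_inv, ← ht] at this
    have h2 : s * w * t = w := by
      rw [ht, show s * w * (w⁻¹ * s * w) = s * (s * w) by group, hs.isReflection.mul_cancel_left]
    refine ⟨fun _ => Or.inl ht, fun _ => ⟨h1, ?_⟩⟩
    rwa [h2]
  · have hne : w * t * w⁻¹ ≠ s := fun e => ht (by rw [← e]; group)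
    have key : IsReflection t → (len (s * w * t) < len (s * w) ↔ len (w * t) < len w) := by
      intro hr
      have hr' := hr.conj w
      have e1 : w * t * w⁻¹ * w = w * t := by group
      have e2 : w * t * w⁻¹ * (w * t) = w := by
        have h := hr'.mul_cancel_left w
        rwa [e1] at h
      have hne' : len (w * t) ≠ len w := by rw [← e1]; exact hr'.len_mul_ne w
      constructor
      · intro hlt
        by_contra hc
        have := hs.len_lt_of_ne hr' hne (a := w) (by rw [e1]; omega)
        rw [e1, ← mul_assoc] at this
        omega
      · intro hlt
        have := hs.len_lt_of_ne hr' hne (a := w * t) (by rwa [e2])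
        rwa [e2, ← mul_assoc] at this
    constructor
    · rintro ⟨h1, h2⟩
      exact Or.inr ⟨h1, (key h1).1 h2⟩
    · rintro (h1 | ⟨h1, h2⟩)
      · exact absurd h1 ht
      · exact ⟨h1, (key h1).2 h2⟩

theorem rightInv_finite_ncard (w : AffSym r) : (rightInv w).Finite ∧ (rightInv w).ncard = len w := by
  induction w using len_induction with
  | h0 a => rw [rightInv_rho, len_rho_zpow]; exact ⟨Set.finite_empty, Set.ncard_empty _⟩
  | h1 s w hs hl ih =>
    rw [rightInv_simple_mul hs (by omega)]
    refine ⟨ih.1.insert _, ?_⟩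
    rw [Set.ncard_insert_of_notMem _ ih.1, ih.2, hl]
    rintro ⟨_, h⟩
    rw [show w * (w⁻¹ * s * w) = s * w by group] at h
    omega

theorem affSwap_mem_rightInv {w : AffSym r} {a b : ℤ} (h : ¬ a ≡ b [ZMOD r]) (hab : a < b) :
    affSwap r a b h ∈ rightInv w ↔ w.1 b < w.1 a :=
  ⟨fun hm => (len_mul_affSwap_lt_iff h hab).1 hm.2,
    fun hlt => ⟨⟨a, b, h, rfl⟩, (len_mul_affSwap_lt_iff h hab).2 hlt⟩⟩

theorem not_modEq_of_inversion {w : AffSym r} {a b : ℤ} (hab : a < b) (h : w.1 b < w.1 a) :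
    ¬ a ≡ b [ZMOD r] := by
  intro e
  have := val_sub_of_modEq w e.symm
  omega

/-- The shift of an integer by multiples of `r` normalizing its image under `w`. -/
theorem exists_shift_Icc (w : AffSym r) (a : ℤ) : ∃ k : ℤ, 1 ≤ w.1 (a + k * r) ∧
    w.1 (a + k * r) ≤ r := by
  obtain ⟨j, hj, k, hk⟩ := exists_rep_Icc r (w.1 a)
  refine ⟨-k, ?_⟩
  rw [val_add_mul, hk]
  rw [Finset.mem_Icc] at hj
  constructor <;> linarith [hj.1, hj.2]

/-- A reflection determines its pair up to order and a common shift by multiples of `r`; `a < b`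
fixes the order, and requiring `w a` to lie in `1, …, r` fixes the shift. -/
theorem affSwap_injOn {w : AffSym r} {a b a' b' : ℤ} {h : ¬ a ≡ b [ZMOD r]}
    {h' : ¬ a' ≡ b' [ZMOD r]} (hab : a < b) (hab' : a' < b') (ha : 1 ≤ w.1 a ∧ w.1 a ≤ r)
    (ha' : 1 ≤ w.1 a' ∧ w.1 a' ≤ r) (e : affSwap r a b h = affSwap r a' b' h') :
    a = a' ∧ b = b' := by
  have h1 : (affSwap r a b h).1 a' = b' := by rw [e, affSwap_left]
  by_cases h2 : a' ≡ a [ZMOD r]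
  · obtain ⟨k, hk⟩ := h2.symm.dvd
    have hk' : a' = a + k * r := by linarith
    have h3 := val_add_mul w a k
    rw [← hk'] at h3
    have hr := natCast_pos' r
    have hk0 : k = 0 := by
      rcases lt_trichotomy k 0 with hl | hl | hl
      · nlinarith
      · exact hl
      · nlinarith
    have haa : a' = a := by rw [hk', hk0]; ring
    rw [haa, affSwap_left] at h1
    exact ⟨haa.symm, h1⟩
  · by_cases h3 : a' ≡ b [ZMOD r]
    · rw [val_sub_of_modEq _ h3, affSwap_right] at h1
      omega
    · rw [affSwap_of_ne h h2 h3] at h1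
      omega

theorem wZero_dec (mu : Wt n r) {a b : ℤ} (hab : a < b) (hb : blk mu a = blk mu b) :
    (wZero mu).1 b < (wZero mu).1 a := by
  have h := isLongest_wZero mu
  rw [← dblCoset_one] at h
  have h2 : -(wZero mu).1 a < -(wZero mu).1 b := decOn_val_of_maximal h.1 h.2 a b hab hb
  omega

theorem affSwap_mem_rightInv_wZero (mu : Wt n r) {a b : ℤ} (h : ¬ a ≡ b [ZMOD r]) (hab : a < b) :
    affSwap r a b h ∈ rightInv (wZero mu) ↔ blk mu a = blk mu b := by
  rw [affSwap_mem_rightInv h hab]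
  refine ⟨fun hlt => ?_, wZero_dec mu hab⟩
  have h1 := blk_mono mu hlt.le
  rw [mem_young.1 (isLongest_wZero mu).1, mem_young.1 (isLongest_wZero mu).1] at h1
  exact le_antisymm (blk_mono mu hab.le) h1

/-- The pairs of positions counted by `dNum`. -/
def pairSet (la mu : Wt n r) (w : AffSym r) : Set (ℤ × ℤ) :=
  {p | blk mu p.1 < blk mu p.2 ∧ blk la (w.1 p.2) ≤ blk la (w.1 p.1) ∧
    1 ≤ w.1 p.1 ∧ w.1 p.1 ≤ r}

/-- The reflections shortening the longest element `w` are of two kinds: those within a `mu`-block,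
which are the ones shortening `w_{0,mu}`, and those between different `mu`-blocks, which `pairSet`
lists once each. -/
theorem pairSet_finite_ncard {la mu : Wt n r} {d w : AffSym r}
    (hw : IsLongest (dblCoset la d mu) w) :
    (pairSet la mu w).Finite ∧ (pairSet la mu w).ncard + len (wZero mu) = len w := by
  have hdec : ∀ a b, a < b → blk mu a = blk mu b → w.1 b < w.1 a := fun a b hab hb => by
    have h : -w.1 a < -w.1 b := decOn_val_of_maximal hw.1 hw.2 a b hab hb
    omega
  have hinv : ∀ p ∈ pairSet la mu w, p.1 < p.2 ∧ w.1 p.2 < w.1 p.1 := by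
    rintro ⟨a, b⟩ ⟨h1, h2, -⟩
    have hab : a < b := by
      by_contra hc
      have := blk_mono mu (not_lt.1 hc)
      simp only at h1
      omega
    refine ⟨hab, ?_⟩
    -- Since `w⁻¹` decreases on each `la`-block, pairs with images in the same `la`-block are
    -- inversions as well. This is why the defining inequality of `pairSet` is weak in the row
    -- index.
    by_contra hc
    have hlt : w.1 a < w.1 b := lt_of_le_of_ne (not_lt.1 hc) (inv_val_ne hab.ne)
    have h3 : -w⁻¹.1 (w.1 a) < -w⁻¹.1 (w.1 b) := decOn_of_maximal hw.1 hw.2 _ _ hlt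
      (le_antisymm (blk_mono la hlt.le) h2)
    rw [inv_val_apply, inv_val_apply] at h3
    omega
  have hsub : rightInv (wZero mu) ⊆ rightInv w := by
    intro t ht
    obtain ⟨a, b, h, hab, rfl⟩ := ht.1.exists_lt
    rw [affSwap_mem_rightInv_wZero mu h hab] at ht
    exact (affSwap_mem_rightInv h hab).2 (hdec a b hab ht)
  have hfin := (rightInv_finite_ncard w).1
  have hcard := Set.ncard_sdiff_add_ncard_of_subset hsub hfin
  rw [(rightInv_finite_ncard w).2, (rightInv_finite_ncard (wZero mu)).2] at hcard
  let F : ∀ p ∈ pairSet la mu w, AffSym r := fun p hp =>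
    affSwap r p.1 p.2 (not_modEq_of_inversion (hinv p hp).1 (hinv p hp).2)
  have hinj : ∀ p q hp hq, F p hp = F q hq → p = q := by
    intro p q hp hq e
    have := affSwap_injOn (hinv p hp).1 (hinv q hq).1 hp.2.2 hq.2.2 e
    exact Prod.ext this.1 this.2
  have hmem : ∀ p hp, F p hp ∈ rightInv w \ rightInv (wZero mu) := by
    intro p hp
    have h1 := hinv p hp
    refine ⟨(affSwap_mem_rightInv _ h1.1).2 h1.2, fun h2 => ?_⟩
    exact hp.1.ne ((affSwap_mem_rightInv_wZero mu _ h1.1).1 h2)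
  have hsurj : ∀ t ∈ rightInv w \ rightInv (wZero mu), ∃ p hp, F p hp = t := by
    rintro t ⟨ht, ht'⟩
    obtain ⟨a, b, h, hab, rfl⟩ := ht.1.exists_lt
    rw [affSwap_mem_rightInv h hab] at ht
    rw [affSwap_mem_rightInv_wZero mu h hab] at ht'
    -- The pair is shifted so that `w a` falls in `1, …, r`; the reflection does not change.
    obtain ⟨k, hk1, hk2⟩ := exists_shift_Icc w a
    refine ⟨(a + k * r, b + k * r), ⟨?_, ?_, hk1, hk2⟩, affSwap_shift a b k h _⟩
    · simp only [blk_add_mul]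
      have := blk_mono mu hab.le
      omega
    · simp only [val_add_mul, blk_add_mul]
      have := blk_mono la ht.le
      omega
  have hcongr : (pairSet la mu w).ncard = (rightInv w \ rightInv (wZero mu)).ncard :=
    Set.ncard_congr F hmem hinj fun t ht => hsurj t ht
  refine ⟨?_, by rw [hcongr, hcard]⟩
  have hfd : (rightInv w \ rightInv (wZero mu)).Finite := hfin.subset Set.sdiff_subset
  have : Finite ↥(rightInv w \ rightInv (wZero mu)) := hfd
  suffices Finite (pairSet la mu w) from Set.toFinite _
  exact Finite.of_injective (fun p : pairSet la mu w =>
    (⟨F p.1 p.2, hmem p.1 p.2⟩ : ↥(rightInv w \ rightInv (wZero mu))))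
    fun p q e => Subtype.ext (hinj _ _ p.2 q.2 (congrArg Subtype.val e))

open Classical in
-- Group the pairs by the four blocks containing the positions and their images. The fibres are
-- products of sets counted by matrix entries, and `1 ≤ w a ≤ r` becomes `1 ≤ i ≤ n`.
theorem ncard_pairSet (la mu : Wt n r) (w : AffSym r) (hfin : (pairSet la mu w).Finite) :
    (pairSet la mu w).ncard = ∑ i ∈ Finset.Icc (1 : ℤ) n, ∑ᶠ p : ℤ × ℤ × ℤ,
      if p.2.1 ≤ i ∧ p.1 < p.2.2 then jEntry la w mu i p.1 * jEntry la w mu p.2.1 p.2.2 else 0 := by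
  set Q := hfin.toFinset
  have hQ : ∀ p, p ∈ Q ↔ p ∈ pairSet la mu w := fun p => hfin.mem_toFinset
  let f : ℤ × ℤ → ℤ × ℤ × ℤ × ℤ := fun p =>
    (blk la (w.1 p.1), blk mu p.1, blk la (w.1 p.2), blk mu p.2)
  let P : Finset (ℤ × ℤ × ℤ) := Q.image fun p => (f p).2
  have hfib : ∀ i ∈ Finset.Icc (1 : ℤ) n, ∀ p : ℤ × ℤ × ℤ,
      (Q.filter fun x => f x = (i, p)).card =
      if p.2.1 ≤ i ∧ p.1 < p.2.2 then jEntry la w mu i p.1 * jEntry la w mu p.2.1 p.2.2 else 0 := by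
    rintro i hi ⟨j, k, l⟩
    split_ifs with hc
    · rw [jEntry_eq_card, jEntry_eq_card, ← Finset.card_product]
      congr 1
      ext ⟨a, b⟩
      simp only [Finset.mem_filter, Finset.mem_product, mem_block_iff, hQ, f, Prod.mk.injEq]
      constructor
      · rintro ⟨_, h1, h2, h3, h4⟩
        exact ⟨⟨h2, h1⟩, h4, h3⟩
      · rintro ⟨⟨h2, h1⟩, h4, h3⟩
        refine ⟨⟨?_, ?_, ?_⟩, h1, h2, h3, h4⟩
        · simp only [h2, h4]; exact hc.2
        · simp only [h1, h3]; exact hc.1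
        · rw [← blk_mem_Icc la, h1]
          exact Finset.mem_Icc.1 hi
    · rw [Finset.card_eq_zero, Finset.filter_eq_empty_iff]
      rintro ⟨a, b⟩ hx e
      simp only [f, Prod.mk.injEq] at e
      obtain ⟨h1, h2, h3, h4⟩ := e
      obtain ⟨h5, h6, -⟩ := (hQ _).1 hx
      simp only [h1, h2, h3, h4] at h5 h6
      exact hc ⟨h6, h5⟩
  have hmaps : ∀ x ∈ Q, f x ∈ Finset.Icc (1 : ℤ) n ×ˢ P := by
    intro x hx
    refine Finset.mem_product.2 ⟨?_, Finset.mem_image_of_mem _ hx⟩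
    rw [Finset.mem_Icc]
    exact (blk_mem_Icc la _).2 ((hQ x).1 hx).2.2
  have hcard : Q.card = ∑ i ∈ Finset.Icc (1 : ℤ) n, ∑ p ∈ P,
      (Q.filter fun x => f x = (i, p)).card := by
    rw [← Finset.sum_product', Finset.card_eq_sum_card_fiberwise hmaps]
  rw [Set.ncard_eq_toFinset_card _ hfin, hcard]
  refine Finset.sum_congr rfl fun i hi => ?_
  rw [finsum_eq_sum_of_support_subset (s := P)]
  · exact Finset.sum_congr rfl fun p _ => hfib i hi p
  · intro p hp
    rw [Function.mem_support, ← hfib i hi p, Finset.card_ne_zero] at hp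
    obtain ⟨x, hx⟩ := hp
    rw [Finset.mem_filter] at hx
    exact Finset.mem_coe.2 (Finset.mem_image.2 ⟨x, hx.1, by rw [hx.2]⟩)

theorem dNum_add_len_wZero (t : Triple n r) :
    dNum (jMap t) + len (wZero t.mu) = len (dPlus t.la t.d t.mu) := by
  have hL := isLongest_dPlus t.la t.mu t.d
  obtain ⟨hfin, hcard⟩ := pairSet_finite_ncard hL
  rw [← hcard, ncard_pairSet _ _ _ hfin, dNum]
  congr 1
  refine Finset.sum_congr rfl fun i _ => finsum_congr fun p => ?_
  rw [jEntry_congr hL.1, jEntry_congr hL.1]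
  rfl

end Counting

/-! ### Comparison of the Bruhat order with the orders on matrices. -/

section Corner

set_option linter.unusedSectionVars false

variable {n r : ℕ} [NeZero n] [NeZero r]

/-- The displacement is periodic, hence bounded; this makes the corners finite. -/
theorem exists_abs_val_sub_le (w : AffSym r) : ∃ C : ℤ, ∀ a, |w.1 a - a| ≤ C := by
  obtain ⟨C, hC⟩ := ((Finset.Icc (1 : ℤ) r).image fun a => |w.1 a - a|).bddAbove
  refine ⟨C, fun a => ?_⟩
  obtain ⟨j, hj, k, rfl⟩ := exists_rep_Icc r a
  have := hC (Finset.mem_coe.2 (Finset.mem_image_of_mem (fun a => |w.1 a - a|) hj))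
  rwa [val_add_mul, show w.1 j + k * r - (j + k * r) = w.1 j - j by ring]

/-- The elements of the blocks up to `i` that `w` takes from the blocks from `j` on. -/
def lowCorner (la mu : Wt n r) (w : AffSym r) (i j : ℤ) : Set ℤ :=
  {c | blk la c ≤ i ∧ j ≤ blk mu (w⁻¹.1 c)}

/-- The elements of the blocks from `i` on that `w` takes from the blocks up to `j`. -/
def highCorner (la mu : Wt n r) (w : AffSym r) (i j : ℤ) : Set ℤ :=
  {c | i ≤ blk la c ∧ blk mu (w⁻¹.1 c) ≤ j}

theorem exists_bounds_blk (la : Wt n r) (i : ℤ) :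
    ∃ x y : ℤ, (∀ c, blk la c ≤ i → c ≤ y) ∧ ∀ c, i ≤ blk la c → x ≤ c := by
  refine ⟨blockStart la i, blockStart la (i + 1), fun c hc => ?_, fun c hc => ?_⟩
  · have h1 := ((mem_block _ _ _).1 (mem_block_blk la c)).2
    exact h1.trans (blockStart_mono la (by omega))
  · have h1 := ((mem_block _ _ _).1 (mem_block_blk la c)).1
    exact (blockStart_mono la hc).trans h1.le

theorem finite_lowCorner (la mu : Wt n r) (w : AffSym r) (i j : ℤ) :
    (lowCorner la mu w i j).Finite := by
  obtain ⟨C, hC⟩ := exists_abs_val_sub_le w⁻¹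
  obtain ⟨-, y, hy, -⟩ := exists_bounds_blk la i
  obtain ⟨x, -, -, hx⟩ := exists_bounds_blk mu j
  refine (Set.finite_Icc (x - C) y).subset fun c hc => ?_
  have h1 := hx _ hc.2
  have h2 := (abs_le.1 (hC c)).2
  exact ⟨by omega, hy _ hc.1⟩

theorem finite_highCorner (la mu : Wt n r) (w : AffSym r) (i j : ℤ) :
    (highCorner la mu w i j).Finite := by
  obtain ⟨C, hC⟩ := exists_abs_val_sub_le w⁻¹
  obtain ⟨x, -, -, hx⟩ := exists_bounds_blk la i
  obtain ⟨-, y, hy, -⟩ := exists_bounds_blk mu j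
  refine (Set.finite_Icc x (y + C)).subset fun c hc => ?_
  have h1 := hy _ hc.2
  have h2 := (abs_le.1 (hC c)).1
  exact ⟨hx _ hc.1, by omega⟩

open Classical in
theorem finsum_jEntry_eq_ncard (la mu : Wt n r) (w : AffSym r) (R : ℤ → ℤ → Prop)
    (hfin : {c | R (blk la c) (blk mu (w⁻¹.1 c))}.Finite) :
    ∑ᶠ p : ℤ × ℤ, (if R p.1 p.2 then jEntry la w mu p.1 p.2 else 0) =
      {c | R (blk la c) (blk mu (w⁻¹.1 c))}.ncard := by
  set Q := hfin.toFinset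
  have hQ : ∀ c, c ∈ Q ↔ R (blk la c) (blk mu (w⁻¹.1 c)) := fun c => hfin.mem_toFinset
  let f : ℤ → ℤ × ℤ := fun c => (blk la c, blk mu (w⁻¹.1 c))
  have hfib : ∀ p : ℤ × ℤ, (Q.filter fun c => f c = p).card =
      if R p.1 p.2 then jEntry la w mu p.1 p.2 else 0 := by
    rintro ⟨k, l⟩
    split_ifs with hc
    · unfold jEntry
      congr 1
      ext c
      rw [Finset.mem_filter, mem_jEntry, mem_block_iff, mem_block_iff, hQ, Prod.mk.injEq]
      refine ⟨fun h => h.2, fun h => ⟨?_, h⟩⟩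
      have h1 : blk mu (w⁻¹.1 c) = l := h.2
      rw [h.1, h1]
      exact hc
    · rw [Finset.card_eq_zero, Finset.filter_eq_empty_iff]
      intro c hcQ e
      rw [Prod.mk.injEq] at e
      rw [hQ, e.1, e.2] at hcQ
      exact hc hcQ
  rw [Set.ncard_eq_toFinset_card _ hfin, finsum_eq_sum_of_support_subset (s := Q.image f),
    Finset.card_eq_sum_card_fiberwise fun x hx => Finset.mem_coe.2 (Finset.mem_image_of_mem f hx)]
  · exact Finset.sum_congr rfl fun p _ => (hfib p).symm
  · intro p hp
    rw [Function.mem_support, ← hfib p, Finset.card_ne_zero] at hp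
    obtain ⟨x, hx⟩ := hp
    rw [Finset.mem_filter] at hx
    exact Finset.mem_coe.2 (Finset.mem_image.2 ⟨x, hx.1, hx.2⟩)

/-- Keep `c` where the condition survives the involution and replace it by `t c` elsewhere. A
collision between the two cases would make the condition both hold and fail at the same point. -/
theorem ncard_le_of_involutive {U V : ℤ → Prop} {f t : ℤ → ℤ} (ht : Function.Involutive t)
    (hfin : {c | U c ∧ V (f (t c))}.Finite)
    (h : ∀ c, V (f c) → ¬ V (f (t c)) → U c → U (t c)) :
    {c | U c ∧ V (f c)}.ncard ≤ {c | U c ∧ V (f (t c))}.ncard := by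
  classical
  refine Set.ncard_le_ncard_of_injOn (fun c => if V (f (t c)) then c else t c) ?_ ?_ hfin
  · rintro c ⟨h1, h2⟩
    split_ifs with hc
    · exact ⟨h1, hc⟩
    · exact ⟨h c h2 hc h1, by rwa [ht]⟩
  · rintro c ⟨-, h2⟩ c' ⟨-, h2'⟩ e
    simp only at e
    split_ifs at e with hc hc' hc'
    · exact e
    · rw [e] at h2; exact absurd h2 hc'
    · rw [← e] at h2'; exact absurd h2' hc
    · exact ht.injective e

/-- Only the classes of `i` and `j` move. On the class of `i` the reflection raises the value of
`w⁻¹`, so `c` lies in the class of `j`, which is lowered. -/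
theorem affSwap_inv_lt_iff {w : AffSym r} {i j : ℤ} (h : ¬ i ≡ j [ZMOD r]) (hij : i < j)
    (hw : w⁻¹.1 i < w⁻¹.1 j) {c : ℤ}
    (hc : w⁻¹.1 ((affSwap r i j h).1 c) < w⁻¹.1 c) : (affSwap r i j h).1 c < c := by
  by_cases h1 : c ≡ i [ZMOD r]
  · obtain ⟨k, hk⟩ := h1.symm.dvd
    obtain rfl : c = i + k * r := by linarith
    rw [val_add_mul, affSwap_left, val_add_mul, val_add_mul] at hc
    omega
  · by_cases h2 : c ≡ j [ZMOD r]
    · obtain ⟨k, hk⟩ := h2.symm.dvd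
      obtain rfl : c = j + k * r := by linarith
      rw [val_add_mul, affSwap_right]
      omega
    · rw [affSwap_of_ne h h1 h2] at hc
      exact absurd hc (lt_irrefl _)

/-- Along a link `y < t y` an element leaves the required `mu`-range only if `t` moves it further
into the required `la`-range, so `ncard_le_of_involutive` applies to both corners. -/
theorem BruhatLE.ncard_corner_le {y w : AffSym r} (hyw : BruhatLE y w) (la mu : Wt n r) (i j : ℤ) :
    (lowCorner la mu y i j).ncard ≤ (lowCorner la mu w i j).ncard ∧
    (highCorner la mu y i j).ncard ≤ (highCorner la mu w i j).ncard := by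
  induction hyw with
  | refl => exact ⟨le_rfl, le_rfl⟩
  | @tail y w _ hst ih =>
    obtain ⟨t, ht, rfl, hlt⟩ := hst
    obtain ⟨a, b, h, hab, rfl⟩ := ht.exists_lt
    rw [len_lt_affSwap_mul_iff h hab] at hlt
    have hinv : Function.Involutive (affSwap r a b h).1 := swapFun_involutive r a b h
    have hval : ∀ c, (affSwap r a b h * y)⁻¹.1 c = y⁻¹.1 ((affSwap r a b h).1 c) := fun c => by
      rw [mul_inv_rev, affSwap_inv, mul_val_apply]
    have hmono : ∀ c, y⁻¹.1 ((affSwap r a b h).1 c) < y⁻¹.1 c → (affSwap r a b h).1 c < c :=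
      fun c => affSwap_inv_lt_iff h hab hlt
    have hmono' : ∀ c, y⁻¹.1 c < y⁻¹.1 ((affSwap r a b h).1 c) → c < (affSwap r a b h).1 c :=
      fun c hc => by
        have := hmono ((affSwap r a b h).1 c)
        rw [hinv c] at this
        exact this hc
    refine ⟨ih.1.trans ?_, ih.2.trans ?_⟩
    · have hfin := finite_lowCorner la mu (affSwap r a b h * y) i j
      unfold lowCorner at hfin ⊢
      simp only [hval] at hfin ⊢
      refine ncard_le_of_involutive (U := fun c => blk la c ≤ i) (V := fun x => j ≤ blk mu x)
        hinv hfin fun c h1 h2 h3 => ?_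
      have := hmono c (by
        by_contra hc
        exact h2 (h1.trans (blk_mono mu (not_lt.1 hc))))
      exact (blk_mono la this.le).trans h3
    · have hfin := finite_highCorner la mu (affSwap r a b h * y) i j
      unfold highCorner at hfin ⊢
      simp only [hval] at hfin ⊢
      refine ncard_le_of_involutive (U := fun c => i ≤ blk la c) (V := fun x => blk mu x ≤ j)
        hinv hfin fun c h1 h2 h3 => ?_
      have := hmono' c (by
        by_contra hc
        exact h2 ((blk_mono mu (not_lt.1 hc)).trans h1))
      exact h3.trans (blk_mono la this.le)

theorem ro_eq (A : Theta n r) : ro A = (triple A).la.1 := by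
  rw [← ro_jMap, jMap_triple]

theorem co_eq (A : Theta n r) : co A = (triple A).mu.1 := by
  rw [← co_jMap, jMap_triple]

theorem triple_la_eq {A B : Theta n r} (h : ro B = ro A) : (triple B).la = (triple A).la :=
  Subtype.ext (by rw [← ro_eq, ← ro_eq, h])

theorem triple_mu_eq {A B : Theta n r} (h : co B = co A) : (triple B).mu = (triple A).mu :=
  Subtype.ext (by rw [← co_eq, ← co_eq, h])

theorem isLongest_yPlus (A : Theta n r) :
    IsLongest (dblCoset (triple A).la (triple A).d (triple A).mu) (yPlus A) :=
  isLongest_dPlus _ _ _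

theorem entry_eq_jEntry (A : Theta n r) {w : AffSym r}
    (hw : w ∈ dblCoset (triple A).la (triple A).d (triple A).mu) (k l : ℤ) :
    A k l = jEntry (triple A).la w (triple A).mu k l := by
  rw [jEntry_congr hw]
  conv_lhs => rw [← jMap_triple A]
  rfl

theorem cornerSum_eq (A : Theta n r) (i j : ℤ) :
    cornerSum i j A = if i < j
      then (lowCorner (triple A).la (triple A).mu (yPlus A) i j).ncard
      else (highCorner (triple A).la (triple A).mu (yPlus A) i j).ncard := by
  unfold cornerSum
  simp only [entry_eq_jEntry A (isLongest_yPlus A).1]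
  congr 1
  · convert finsum_jEntry_eq_ncard _ _ _ (fun k l => k ≤ i ∧ j ≤ l)
      (finite_lowCorner (triple A).la (triple A).mu (yPlus A) i j)
    rfl
  · convert finsum_jEntry_eq_ncard _ _ _ (fun k l => i ≤ k ∧ l ≤ j)
      (finite_highCorner (triple A).la (triple A).mu (yPlus A) i j)
    rfl

theorem sqLT_of_bruhatLE {A B : Theta n r} (hro : ro B = ro A) (hco : co B = co A) (hne : B ≠ A)
    (h : BruhatLE (yPlus B) (yPlus A)) : SqLT B A := by
  refine ⟨fun i j _ => ?_, hco, hro, hne⟩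
  rw [cornerSum_eq, cornerSum_eq, triple_la_eq hro, triple_mu_eq hco]
  have := h.ncard_corner_le (triple A).la (triple A).mu i j
  split_ifs
  · exact this.1
  · exact this.2

theorem exists_left_descent_of_not_incOn {la : Wt n r} {w : AffSym r} (h : ¬ IncOn la w⁻¹.1) :
    ∃ s ∈ young la, IsSimple s ∧ len (s * w) < len w := by
  by_contra! hc
  refine h (incOn_of_succ fun i hb => ?_)
  have hi := not_modEq_of_blk_eq hb (by omega)
  by_contra hlt
  have h1 := len_affSwap_mul_lt hi (by omega)
    (lt_of_le_of_ne (not_lt.1 hlt) (inv_val_ne (w := w⁻¹) (by omega)))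
  have h2 := hc _ (affSwap_mem_young hi hb) ⟨i, hi, rfl⟩
  omega

theorem exists_right_descent_of_not_incOn {mu : Wt n r} {w : AffSym r} (h : ¬ IncOn mu w.1) :
    ∃ s ∈ young mu, IsSimple s ∧ len (w * s) < len w := by
  obtain ⟨s, h1, h2, h3⟩ := exists_left_descent_of_not_incOn (w := w⁻¹) (la := mu)
    (by rwa [inv_inv])
  refine ⟨s, h1, h2, ?_⟩
  rwa [← len_inv, mul_inv_rev, inv_inv, h2.isReflection.inv, len_inv] at h3

theorem eq_of_mem_dblReps {la mu : Wt n r} {d w : AffSym r} (hd : d ∈ dblReps la mu)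
    (hw : w ∈ dblReps la mu) (h : w ∈ dblCoset la d mu) : w = d :=
  dblReps_unique hw hd (jEntry_congr h)

/-- The Bruhat order is inherited by the distinguished representatives of double cosets. -/
theorem BruhatLE.dblReps {la mu : Wt n r} {d d' : AffSym r} (hd : d ∈ dblReps la mu)
    (hd' : d' ∈ AffSchur.dblReps la mu) {y w : AffSym r} (hy : y ∈ dblCoset la d mu)
    (hw : w ∈ dblCoset la d' mu) (h : BruhatLE y w) : BruhatLE d d' := by
  -- While one of the two elements has a descent from a Young subgroup, both are projected along
  -- that reflection. The projection preserves the order and the double cosets and lowers the total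
  -- length; the process stops at `d` and `d'`.
  induction hN : len y + len w using Nat.strong_induction_on generalizing y w with
  | _ N ih =>
    subst hN
    by_cases hl : IncOn la y⁻¹.1 ∧ IncOn la w⁻¹.1
    · by_cases hr : IncOn mu y.1 ∧ IncOn mu w.1
      · rwa [← eq_of_mem_dblReps hd (mem_dblReps_iff.2 ⟨hl.1, hr.1⟩) hy,
          ← eq_of_mem_dblReps hd' (mem_dblReps_iff.2 ⟨hl.2, hr.2⟩) hw]
      · obtain ⟨s, hs, hss, hlt⟩ : ∃ s ∈ young mu, IsSimple s ∧
            (len (y * s) < len y ∨ len (w * s) < len w) := by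
          by_cases hr1 : IncOn mu y.1
          · obtain ⟨s, h1, h2, h3⟩ := exists_right_descent_of_not_incOn fun h2 => hr ⟨hr1, h2⟩
            exact ⟨s, h1, h2, Or.inr h3⟩
          · obtain ⟨s, h1, h2, h3⟩ := exists_right_descent_of_not_incOn hr1
            exact ⟨s, h1, h2, Or.inl h3⟩
        have hmem : ∀ {d u : AffSym r}, u ∈ dblCoset la d mu → downR s u ∈ dblCoset la d mu := by
          intro d u hu
          rcases hss.downR_eq_or u with e | e <;> rw [e]
          · exact right_mul_mem_dblCoset hu hs
          · exact hu
        refine ih _ ?_ (hmem hy) (hmem hw) (hss.downR_mono h) rfl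
        have h1 := (hss.downR_le y).len_le
        have h2 := (hss.downR_le w).len_le
        rcases hlt with h3 | h3
        · rw [hss.downR_of_lt h3]; omega
        · rw [hss.downR_of_lt h3]; omega
    · obtain ⟨s, hs, hss, hlt⟩ : ∃ s ∈ young la, IsSimple s ∧
          (len (s * y) < len y ∨ len (s * w) < len w) := by
        by_cases hl1 : IncOn la y⁻¹.1
        · obtain ⟨s, h1, h2, h3⟩ := exists_left_descent_of_not_incOn fun h2 => hl ⟨hl1, h2⟩
          exact ⟨s, h1, h2, Or.inr h3⟩
        · obtain ⟨s, h1, h2, h3⟩ := exists_left_descent_of_not_incOn hl1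
          exact ⟨s, h1, h2, Or.inl h3⟩
      have hmem : ∀ {d u : AffSym r}, u ∈ dblCoset la d mu → downL s u ∈ dblCoset la d mu := by
        intro d u hu
        rcases downL_eq_or s u with e | e <;> rw [e]
        · exact left_mul_mem_dblCoset hu hs
        · exact hu
      refine ih _ ?_ (hmem hy) (hmem hw) (hss.downL_mono h) rfl
      have h1 := (hss.downL_le y).len_le
      have h2 := (hss.downL_le w).len_le
      rcases hlt with h3 | h3
      · rw [downL_of_lt h3]; omega
      · rw [downL_of_lt h3]; omega

theorem boLE_of_bruhatLE {A B : Theta n r} (hro : ro B = ro A) (hco : co B = co A)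
    (h : BruhatLE (yPlus B) (yPlus A)) : BoLE B A := by
  have hB := isLongest_yPlus B
  have hd := (triple B).mem
  rw [triple_la_eq hro, triple_mu_eq hco] at hB hd
  exact ⟨hro, hco, h.dblReps hd (triple A).mem hB.1 (isLongest_yPlus A).1⟩

end Corner

/-! ### Hecke algebra elements constant on cosets, and the ideals `x_la H`. -/

section Invariants

set_option linter.unusedSectionVars false

variable {n r : ℕ} [NeZero n] [NeZero r]

/-- The coordinates with respect to the basis of the elements `T_w`. -/
def tcoef (y : AffSym r) : Hecke r →ₗ[Zv] Zv := (basisTT r).coord y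

open Classical in
theorem tcoef_TT (y w : AffSym r) : tcoef y (TT w) = if w = y then 1 else 0 := by
  rw [tcoef, Module.Basis.coord_apply, ← basisTT_apply, Module.Basis.repr_self,
    Finsupp.single_apply]

theorem hecke_ext_tcoef {x y : Hecke r} (h : ∀ w, tcoef w x = tcoef w y) : x = y :=
  (basisTT r).ext_elem h

theorem finite_tcoef_ne_zero (h : Hecke r) : {y | tcoef y h ≠ 0}.Finite :=
  ((basisTT r).repr h).hasFiniteSupport

open Classical in
theorem coef_eq_tcoef (y : AffSym r) (h : Hecke r) : coef y h = vpow (len y) * tcoef y h := by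
  have : coef y = vpow (len y) • tcoef y := linearMap_ext_TT fun w => by
    rw [TT_eq_smul_TTn, map_smul, coef_TTn, ← TT_eq_smul_TTn, LinearMap.smul_apply, tcoef_TT]
    split_ifs with hw
    · rw [hw]
    · simp
  rw [this]
  rfl

theorem tcoef_eq_coef (y : AffSym r) (h : Hecke r) : tcoef y h = vpow (-(len y : ℤ)) * coef y h := by
  rw [coef_eq_tcoef, ← mul_assoc, vpow_neg_mul, one_mul]

theorem tcoef_flip (y : AffSym r) (h : Hecke r) : tcoef y (flip r h) = tcoef y⁻¹ h := by
  rw [tcoef_eq_coef, tcoef_eq_coef, coef_flip, len_inv]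

open Classical in
theorem tcoef_finsum {X : Set (AffSym r)} (hX : X.Finite) (y : AffSym r) :
    tcoef y (∑ᶠ w ∈ X, TT w) = if y ∈ X then 1 else 0 := by
  rw [finsum_mem_eq_finite_toFinset_sum _ hX, map_sum]
  simp only [tcoef_TT, Finset.sum_ite_eq', Set.Finite.mem_toFinset]

/-- In the coordinate at `y` the term `v⁻¹` or `v` from the diagonal cancels. What remains relates
the normalized coordinates at `s y` and `y` by the power of `v` that normalization accounts for. -/
theorem csim_mul_eq_iff {s : AffSym r} (hs : IsSimple s) (h : Hecke r) :
    csim s * h = (vpow 1 + vpow (-1)) • h ↔ ∀ y, tcoef (s * y) h = tcoef y h := by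
  have key : ∀ y, coef y (csim s * h) = coef y ((vpow 1 + vpow (-1)) • h) ↔
      tcoef (s * y) h = tcoef y h := by
    intro y
    rw [coef_csim_mul hs, map_smul, smul_eq_mul, add_mul, vsign, coef_eq_tcoef, coef_eq_tcoef]
    rcases hs.len_mul y with e | e
    · rw [if_pos (by omega), add_left_inj, ← mul_assoc, ← vpow_add, e,
        show (1 : ℤ) + (len y : ℤ) = ((len y + 1 : ℕ) : ℤ) by push_cast; ring]
      exact ⟨vpow_mul_cancel, fun h => by rw [h]⟩
    · rw [if_neg (by omega), add_comm, add_right_inj, ← mul_assoc, ← vpow_add,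
        show -1 + (len y : ℤ) = (len (s * y) : ℤ) by rw [← e]; push_cast; ring]
      exact ⟨vpow_mul_cancel, fun h => by rw [h]⟩
  exact ⟨fun e y => (key y).1 (by rw [e]), fun e => hecke_ext fun y => (key y).2 (e y)⟩

/-- The `T`-coordinates of `h` are constant on left cosets of the Young subgroup. -/
def LeftInv (la : Wt n r) (h : Hecke r) : Prop :=
  ∀ w ∈ young la, ∀ y, tcoef (w * y) h = tcoef y h

/-- The `T`-coordinates of `h` are constant on right cosets of the Young subgroup. -/
def RightInv (mu : Wt n r) (h : Hecke r) : Prop :=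
  ∀ w ∈ young mu, ∀ y, tcoef (y * w) h = tcoef y h

theorem leftInv_iff {la : Wt n r} {h : Hecke r} :
    LeftInv la h ↔ ∀ s ∈ young la, IsSimple s → csim s * h = (vpow 1 + vpow (-1)) • h := by
  refine ⟨fun H s hs hss => (csim_mul_eq_iff hss h).2 (H s hs), fun H w hw => ?_⟩
  refine young_induction (P := fun w => ∀ y, tcoef (w * y) h = tcoef y h) (fun y => by rw [one_mul])
    (fun i hi w hb _ _ ih y => ?_) hw
  have hss : IsSimple (affSwap r i (i + 1) hi) := ⟨i, hi, rfl⟩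
  rw [mul_assoc, (csim_mul_eq_iff hss h).1 (H _ (affSwap_mem_young hi hb) hss), ih]

theorem leftInv_flip_iff {mu : Wt n r} {h : Hecke r} : LeftInv mu (flip r h) ↔ RightInv mu h := by
  constructor
  · intro H w hw y
    have := H w⁻¹ (inv_mem hw) y⁻¹
    rwa [tcoef_flip, tcoef_flip, mul_inv_rev, inv_inv, inv_inv] at this
  · intro H w hw y
    rw [tcoef_flip, tcoef_flip, mul_inv_rev]
    exact H w⁻¹ (inv_mem hw) _

theorem flip_csim {s : AffSym r} (hs : IsSimple s) : flip r (csim s) = csim s := by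
  rw [csim_eq hs, map_smul, map_add, flip_TT, hs.isReflection.inv, flip_one]

theorem rightInv_iff {mu : Wt n r} {h : Hecke r} :
    RightInv mu h ↔ ∀ s ∈ young mu, IsSimple s → h * csim s = (vpow 1 + vpow (-1)) • h := by
  rw [← leftInv_flip_iff, leftInv_iff]
  refine forall_congr' fun s => forall_congr' fun _ => forall_congr' fun hs => ?_
  constructor
  · intro e
    have := congrArg (flip r) e
    rwa [flip_mul, flip_flip, map_smul, flip_flip, flip_csim hs] at this
  · intro e
    rw [← flip_csim hs, ← flip_mul, e, map_smul]

/-- Invisible in coordinates, but immediate from the eigenvector equations on the left. -/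
theorem LeftInv.mul {la : Wt n r} {h : Hecke r} (H : LeftInv la h) (x : Hecke r) :
    LeftInv la (h * x) := by
  rw [leftInv_iff] at H ⊢
  intro s hs hss
  rw [← mul_assoc, H s hs hss, smul_mul_assoc]

theorem LeftInv.smul {la : Wt n r} {h : Hecke r} (H : LeftInv la h) (c : Zv) :
    LeftInv la (c • h) := fun w hw y => by rw [map_smul, map_smul, H w hw]

theorem RightInv.smul {mu : Wt n r} {h : Hecke r} (H : RightInv mu h) (c : Zv) :
    RightInv mu (c • h) := fun w hw y => by rw [map_smul, map_smul, H w hw]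

open Classical in
theorem tcoef_xElt (la : Wt n r) (y : AffSym r) :
    tcoef y (xElt la) = if y ∈ young la then 1 else 0 := tcoef_finsum (finite_young la) y

theorem leftInv_xElt (la : Wt n r) : LeftInv la (xElt la) := fun w hw y => by
  classical
  rw [tcoef_xElt, tcoef_xElt, Subgroup.mul_mem_cancel_left _ hw]

theorem rightInv_xElt (la : Wt n r) : RightInv la (xElt la) := fun w hw y => by
  classical
  rw [tcoef_xElt, tcoef_xElt, Subgroup.mul_mem_cancel_right _ hw]

theorem flip_xElt (la : Wt n r) : flip r (xElt la) = xElt la := by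
  classical
  refine hecke_ext_tcoef fun y => ?_
  rw [tcoef_flip, tcoef_xElt, tcoef_xElt, inv_mem_iff]

theorem exists_cosetRep (la : Wt n r) (y : AffSym r) :
    ∃ w ∈ young la, ∃ d ∈ cosetReps la, y = w * d := by
  induction hN : len y using Nat.strong_induction_on generalizing y with
  | _ N ih =>
    subst hN
    by_cases h : IncOn la y⁻¹.1
    · exact ⟨1, one_mem _, y, mem_cosetReps_iff.2 h, (one_mul _).symm⟩
    · obtain ⟨s, hs, hss, hlt⟩ := exists_left_descent_of_not_incOn h
      obtain ⟨w, hw, d, hd, e⟩ := ih _ hlt _ rfl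
      refine ⟨s * w, mul_mem hs hw, d, hd, ?_⟩
      rw [mul_assoc, ← e, hss.isReflection.mul_cancel_left]

theorem LeftInv.ext {la : Wt n r} {h h' : Hecke r} (H : LeftInv la h) (H' : LeftInv la h')
    (e : ∀ d ∈ cosetReps la, tcoef d h = tcoef d h') : h = h' := by
  refine hecke_ext_tcoef fun y => ?_
  obtain ⟨w, hw, d, hd, rfl⟩ := exists_cosetRep la y
  rw [H w hw, H' w hw, e d hd]

/-- Length additivity, used once for `d` and once for `e`, forces the quotient to have length zero;
such an element has no descents, so in a Young subgroup it is the identity. -/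
theorem cosetReps_unique {la : Wt n r} {d e : AffSym r} (hd : d ∈ cosetReps la)
    (he : e ∈ cosetReps la) (h : d * e⁻¹ ∈ young la) : d = e := by
  have h1 := he _ h
  have h2 := hd _ (inv_mem h)
  rw [inv_mul_cancel_right] at h1
  rw [mul_inv_rev, inv_inv, inv_mul_cancel_right] at h2
  have h3 : len (d * e⁻¹) = 0 := by omega
  refine mul_inv_eq_one.1 (eq_one_of_mem_young h (incOn_of_succ fun i hb => ?_))
  have hi := not_modEq_of_blk_eq hb (by omega)
  exact (len_lt_affSwap_mul_iff hi (by omega)).1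
    (by have := (IsSimple.isReflection ⟨i, hi, rfl⟩).len_mul_ne (d * e⁻¹); omega)

open Classical in
-- The lengths add, so the product is the sum of the `T_w` over the coset of `e`, which meets the
-- representatives only in `e`.
theorem tcoef_xElt_mul_TT {la : Wt n r} {d e : AffSym r} (hd : d ∈ cosetReps la)
    (he : e ∈ cosetReps la) : tcoef d (xElt la * TT e) = if e = d then 1 else 0 := by
  rw [show xElt la = ∑ᶠ w ∈ (young la : Set (AffSym r)), TT w from rfl,
    finsum_mem_eq_finite_toFinset_sum _ (finite_young la), Finset.sum_mul, map_sum,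
    Finset.sum_congr rfl fun w hw => by
      rw [TT_mul w e (he w ((finite_young la).mem_toFinset.1 hw)), tcoef_TT]]
  split_ifs with h
  · subst h
    rw [Finset.sum_eq_single 1]
    · simp
    · intro w _ hw
      rw [if_neg (by simpa using hw)]
    · intro h1
      exact absurd ((finite_young la).mem_toFinset.2 (one_mem (young la))) h1
  · refine Finset.sum_eq_zero fun w hw => if_neg fun e1 => h ?_
    refine (cosetReps_unique hd he ?_).symm
    rw [← e1, mul_inv_cancel_right]
    exact (finite_young la).mem_toFinset.1 hw

/-- Elements with constant coordinates on left cosets lie in `x_la H`. -/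
theorem LeftInv.exists_eq_mul {la : Wt n r} {h : Hecke r} (H : LeftInv la h) :
    ∃ x, h = xElt la * x := by
  classical
  have hfin : {d | d ∈ cosetReps la ∧ tcoef d h ≠ 0}.Finite :=
    (finite_tcoef_ne_zero h).subset fun d hd => hd.2
  refine ⟨∑ d ∈ hfin.toFinset, tcoef d h • TT d, H.ext ((leftInv_xElt la).mul _) fun d hd => ?_⟩
  rw [Finset.mul_sum, map_sum, Finset.sum_congr rfl fun e he => by
    rw [mul_smul_comm, map_smul, tcoef_xElt_mul_TT hd (hfin.mem_toFinset.1 he).1]]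
  simp only [smul_eq_mul, mul_ite, mul_one, mul_zero, Finset.sum_ite_eq']
  split_ifs with h1
  · rfl
  · by_contra h2
    exact h1 (hfin.mem_toFinset.2 ⟨hd, h2⟩)

theorem RightInv.exists_eq_mul {mu : Wt n r} {h : Hecke r} (H : RightInv mu h) :
    ∃ x, h = x * xElt mu := by
  obtain ⟨x, hx⟩ := (leftInv_flip_iff.2 H).exists_eq_mul
  refine ⟨flip r x, ?_⟩
  rw [← flip_flip h, hx, flip_mul, flip_xElt]

open Classical in
theorem tcoef_dblSum (la mu : Wt n r) (d y : AffSym r) :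
    tcoef y (dblSum la d mu) = if y ∈ dblCoset la d mu then 1 else 0 :=
  tcoef_finsum (finite_dblCoset la mu d) y

theorem leftInv_dblSum (la mu : Wt n r) (d : AffSym r) : LeftInv la (dblSum la d mu) := by
  classical
  intro w hw y
  rw [tcoef_dblSum, tcoef_dblSum]
  refine if_congr ⟨fun h => ?_, fun h => left_mul_mem_dblCoset h hw⟩ rfl rfl
  simpa using left_mul_mem_dblCoset h (inv_mem hw)

theorem rightInv_dblSum (la mu : Wt n r) (d : AffSym r) : RightInv mu (dblSum la d mu) := by
  classical
  intro w hw y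
  rw [tcoef_dblSum, tcoef_dblSum]
  refine if_congr ⟨fun h => ?_, fun h => right_mul_mem_dblCoset h hw⟩ rfl rfl
  simpa using right_mul_mem_dblCoset h (inv_mem hw)

/-- Every simple reflection of the Young subgroup is a left descent of the longest element, so the
eigenvector property of `C'_w` applies to all of them. -/
theorem leftInv_klC {la mu : Wt n r} {d w : AffSym r} (hw : IsLongest (dblCoset la d mu) w) :
    LeftInv la (klC w) := leftInv_iff.2 fun _ hs hss => csim_mul_klC hss
  (lt_of_le_of_ne (hw.2 _ (left_mul_mem_dblCoset hw.1 hs)) (hss.isReflection.len_mul_ne w))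

theorem rightInv_klC {la mu : Wt n r} {d w : AffSym r} (hw : IsLongest (dblCoset la d mu) w) :
    RightInv mu (klC w) := by
  rw [← leftInv_flip_iff, flip_klC]
  exact leftInv_klC ⟨inv_mem_dblCoset hw.1, inv_maximal hw.2⟩

theorem leftInv_thetaVal (la mu : Wt n r) (d : AffSym r) : LeftInv la (thetaVal la d mu) :=
  (leftInv_klC (isLongest_dPlus la mu d)).smul _

theorem rightInv_thetaVal (la mu : Wt n r) (d : AffSym r) : RightInv mu (thetaVal la d mu) :=
  (rightInv_klC (isLongest_dPlus la mu d)).smul _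

theorem tcoef_eq_of_mem_dblCoset {la mu : Wt n r} {h : Hecke r} (hl : LeftInv la h)
    (hr : RightInv mu h) {d w : AffSym r} (hw : w ∈ dblCoset la d mu) : tcoef w h = tcoef d h := by
  obtain ⟨a, ha, b, hb, rfl⟩ := hw
  rw [hr b hb, hl a ha]

end Invariants

/-! ### The Schur algebra as functions on double cosets. -/

section SchurAlgebra

set_option linter.unusedSectionVars false

variable {n r : ℕ} [NeZero n] [NeZero r]

/-- The component in `x_la H` of the image of `x_mu`. -/
def sval (la mu : Wt n r) : Schur n r →ₗ[Zv] Hecke r where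
  toFun f := (f (gen mu 1 1) la : xIdeal la)
  map_add' _ _ := rfl
  map_smul' _ _ := rfl

theorem gen_eq_smul (mu : Wt n r) (z : Zv) (h : Hecke r) :
    gen mu z h = MulOpposite.op (z • h) • gen mu 1 1 := by
  rw [gen, gen, ← Pi.single_smul]
  congr 1
  refine Subtype.ext ?_
  change z • (xElt mu * h) = ((1 : Zv) • (xElt mu * 1)) * (z • h)
  rw [one_smul, mul_one, mul_smul_comm]

theorem coe_apply_gen (f : Schur n r) (la mu : Wt n r) (z : Zv) (h : Hecke r) :
    ((f (gen mu z h) la : xIdeal la) : Hecke r) = z • (sval la mu f * h) := by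
  rw [gen_eq_smul, map_smul, ← mul_smul_comm]
  rfl

theorem coe_gen (la mu : Wt n r) (z : Zv) (h : Hecke r) :
    ((gen mu z h la : xIdeal la) : Hecke r) = if mu = la then z • (xElt mu * h) else 0 := by
  split_ifs with e
  · subst e
    rw [gen, Pi.single_eq_same]
    rfl
  · rw [gen, Pi.single_eq_of_ne (Ne.symm e)]
    rfl

theorem exists_eq_of_mem_xIdeal {la : Wt n r} {z : Hecke r} (hz : z ∈ xIdeal la) :
    ∃ h, z = xElt la * h := by
  obtain ⟨a, ha⟩ := Submodule.mem_span_singleton.1 hz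
  exact ⟨a.unop, ha.symm⟩

theorem mul_mem_xIdeal (la : Wt n r) (h : Hecke r) : xElt la * h ∈ xIdeal la :=
  Submodule.mem_span_singleton.2 ⟨MulOpposite.op h, rfl⟩

theorem schur_ext {f g : Schur n r} (h : ∀ la mu, sval la mu f = sval la mu g) : f = g := by
  refine LinearMap.pi_ext fun mu x => ?_
  obtain ⟨y, hy⟩ := exists_eq_of_mem_xIdeal x.2
  have e : Pi.single mu x = gen mu 1 y := by
    rw [gen, one_smul]
    congr 1
    exact Subtype.ext hy
  rw [e]
  funext la
  refine Subtype.ext ?_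
  rw [coe_apply_gen, coe_apply_gen, h]

theorem leftInv_sval (la mu : Wt n r) (f : Schur n r) : LeftInv la (sval la mu f) := by
  obtain ⟨y, hy⟩ := exists_eq_of_mem_xIdeal (f (gen mu 1 1) la).2
  have e : sval la mu f = xElt la * y := hy
  rw [e]
  exact (leftInv_xElt la).mul y

/-- The generator satisfies `x_mu C'_s = (v + v⁻¹) x_mu`, and a homomorphism of right modules
preserves this equation. -/
theorem rightInv_sval (la mu : Wt n r) (f : Schur n r) : RightInv mu (sval la mu f) := by
  refine rightInv_iff.2 fun s hs hss => ?_
  have h1 : gen mu 1 (csim s) = gen mu (vpow 1 + vpow (-1)) 1 := by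
    funext la
    refine Subtype.ext ?_
    rw [coe_gen, coe_gen, rightInv_iff.1 (rightInv_xElt mu) s hs hss, one_smul, mul_one]
  have h2 := coe_apply_gen f la mu 1 (csim s)
  rw [h1, coe_apply_gen, one_smul, mul_one] at h2
  exact h2.symm

theorem actsBy_iff {la mu : Wt n r} {z : Hecke r} {f : Schur n r} :
    ActsBy la mu z f ↔ ∀ ka nu, sval ka nu f = if nu = mu ∧ ka = la then z else 0 := by
  constructor
  · intro H ka nu
    have := H nu 1 ka
    rwa [coe_apply_gen, one_smul, mul_one, mul_one] at this
  · intro H nu h ka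
    rw [coe_apply_gen, one_smul, H, ite_mul, zero_mul]

theorem ActsBy.unique {la mu : Wt n r} {z : Hecke r} {f g : Schur n r} (hf : ActsBy la mu z f)
    (hg : ActsBy la mu z g) : f = g :=
  schur_ext fun ka nu => by rw [actsBy_iff.1 hf, actsBy_iff.1 hg]

/-- Left multiplication by `x` as a map from `x_mu H` to `x_la H`. -/
def mulXIdeal (la mu : Wt n r) (x : Hecke r) (hx : LeftInv la (x * xElt mu)) :
    xIdeal mu →ₗ[(Hecke r)ᵐᵒᵖ] xIdeal la where
  toFun u := ⟨x * u, by
    obtain ⟨y, hy⟩ := exists_eq_of_mem_xIdeal u.2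
    obtain ⟨h, hh⟩ := hx.exists_eq_mul
    rw [hy, ← mul_assoc, hh, mul_assoc]
    exact mul_mem_xIdeal la _⟩
  map_add' u v := Subtype.ext (mul_add x _ _)
  map_smul' a u := Subtype.ext (mul_assoc x _ _).symm

/-- Right invariance gives a factorization `z = x x_mu`. Left multiplication by `x` is then a
homomorphism sending `x_mu h` to `z h`, and it lands in `x_la H` by left invariance. -/
theorem exists_actsBy {la mu : Wt n r} {z : Hecke r} (hl : LeftInv la z) (hr : RightInv mu z) :
    ∃ f, ActsBy la mu z f := by
  obtain ⟨x, rfl⟩ := hr.exists_eq_mul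
  refine ⟨LinearMap.single _ _ la ∘ₗ mulXIdeal la mu x hl ∘ₗ LinearMap.proj mu,
    actsBy_iff.2 fun ka nu => ?_⟩
  change ((Pi.single la (mulXIdeal la mu x hl (gen nu 1 1 mu)) : TensorSpace n r) ka : Hecke r) = _
  by_cases h1 : ka = la
  · subst h1
    rw [Pi.single_eq_same]
    change x * ((gen nu 1 1 mu : xIdeal mu) : Hecke r) = _
    rw [coe_gen, one_smul, mul_one]
    by_cases h2 : nu = mu
    · subst h2; simp
    · rw [if_neg h2, if_neg (fun h => h2 h.1), mul_zero]
  · rw [Pi.single_eq_of_ne h1, if_neg (fun h => h1 h.2)]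
    rfl

theorem existsUnique_actsBy {la mu : Wt n r} {z : Hecke r} (hl : LeftInv la z)
    (hr : RightInv mu z) : ∃! f, ActsBy la mu z f := by
  obtain ⟨f, hf⟩ := exists_actsBy hl hr
  exact ⟨f, hf, fun g hg => hg.unique hf⟩

theorem sval_schurHom {la mu : Wt n r} {z : Hecke r} (hl : LeftInv la z) (hr : RightInv mu z)
    (ka nu : Wt n r) : sval ka nu (schurHom la mu z) = if nu = mu ∧ ka = la then z else 0 :=
  actsBy_iff.1 (Classical.epsilon_spec (exists_actsBy hl hr)) ka nu

/-- The coefficient of `e_A`. -/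
def ecoef (A : Theta n r) : Schur n r →ₗ[Zv] Zv :=
  tcoef (yRep A) ∘ₗ sval (triple A).la (triple A).mu

theorem ecoef_apply (A : Theta n r) (f : Schur n r) :
    ecoef A f = tcoef (yRep A) (sval (triple A).la (triple A).mu f) := rfl

theorem triple_injective : Function.Injective (triple : Theta n r → Triple n r) := fun A B h => by
  rw [← jMap_triple A, h, jMap_triple]

open Classical in
theorem ecoef_eElt (A B : Theta n r) : ecoef A (eElt B) = if A = B then 1 else 0 := by
  rw [ecoef_apply, eElt, phi, sval_schurHom (leftInv_dblSum _ _ _) (rightInv_dblSum _ _ _)]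
  split_ifs with h1 h2 h2
  · subst h2
    rw [tcoef_dblSum]
    exact if_pos (self_mem_dblCoset _ _ _)
  · rw [tcoef_dblSum, if_neg]
    intro h3
    have hA := (triple A).mem
    rw [h1.1, h1.2] at hA
    exact h2 (triple_injective (Triple.ext' h1.2 h1.1 (eq_of_mem_dblReps (triple B).mem hA h3)))
  · exact absurd ⟨by rw [h2], by rw [h2]⟩ h1
  · exact map_zero _

/-- Values are constant on double cosets, and each double coset contains a distinguished
representative, whose coordinate is some `ecoef`. -/
theorem schur_ext_ecoef {f g : Schur n r} (h : ∀ A, ecoef A f = ecoef A g) : f = g := by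
  refine schur_ext fun la mu => hecke_ext_tcoef fun w => ?_
  obtain ⟨d, hd, hmin⟩ := exists_minimal la mu w
  rw [← tcoef_eq_of_mem_dblCoset (leftInv_sval la mu f) (rightInv_sval la mu f) hd,
    ← tcoef_eq_of_mem_dblCoset (leftInv_sval la mu g) (rightInv_sval la mu g) hd]
  have := h (jMap ⟨la, d, mu, mem_dblReps_of_minimal hd hmin⟩)
  rwa [ecoef_apply, ecoef_apply, yRep, triple_jMap] at this

theorem finite_ecoef_ne_zero (f : Schur n r) : {A | ecoef A f ≠ 0}.Finite := by
  let X : Set (Wt n r × Wt n r × AffSym r) :=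
    ⋃ la : Wt n r, ⋃ mu : Wt n r, (fun y => (la, mu, y)) '' {y | tcoef y (sval la mu f) ≠ 0}
  have hX : X.Finite := Set.finite_iUnion fun la => Set.finite_iUnion fun mu =>
    (finite_tcoef_ne_zero _).image _
  refine Set.Finite.of_finite_image (f := fun A => ((triple A).la, (triple A).mu, yRep A))
    (hX.subset ?_) fun A _ B _ e => ?_
  · rintro _ ⟨A, hA, rfl⟩
    exact Set.mem_iUnion.2 ⟨_, Set.mem_iUnion.2 ⟨_, ⟨_, hA, rfl⟩⟩⟩
  · simp only [Prod.mk.injEq] at e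
    exact triple_injective (Triple.ext' e.1 e.2.1 e.2.2)

/-- The coefficient of `[A]`. -/
def bcoef (A : Theta n r) : Schur n r →ₗ[Zv] Zv := vpow (dNum A) • ecoef A

theorem bcoef_apply (A : Theta n r) (f : Schur n r) : bcoef A f = vpow (dNum A) * ecoef A f := rfl

open Classical in
theorem bcoef_brk (A B : Theta n r) : bcoef A (brk B) = if A = B then 1 else 0 := by
  rw [bcoef_apply, brk, map_smul, ecoef_eElt]
  split_ifs with h
  · rw [h, smul_eq_mul, mul_one, vpow_mul_neg]
  · simp

theorem bcoef_sub (A : Theta n r) (f g : Schur n r) :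
    bcoef A (f - g) = bcoef A f - bcoef A g := by
  change vpow _ * tcoef _ (sval _ _ f - sval _ _ g) = vpow _ * tcoef _ _ - vpow _ * tcoef _ _
  rw [map_sub, mul_sub]

theorem schur_ext_bcoef {f g : Schur n r} (h : ∀ A, bcoef A f = bcoef A g) : f = g :=
  schur_ext_ecoef fun A => vpow_mul_cancel (h A)

theorem finite_bcoef_ne_zero (f : Schur n r) : {A | bcoef A f ≠ 0}.Finite :=
  (finite_ecoef_ne_zero f).subset fun A hA h0 => hA (by
    have h1 : ecoef A f = 0 := h0
    rw [bcoef_apply, h1, mul_zero])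

/-- A family in a module with a separating family of dual functionals, finitely many of which are
nonzero at each vector, is a basis. -/
theorem exists_basis_of_dual {ι R M : Type*} [DecidableEq ι] [CommRing R] [AddCommGroup M]
    [Module R M] (e : ι → M) (c : ι → M →ₗ[R] R) (h1 : ∀ i j, c i (e j) = if i = j then 1 else 0)
    (h2 : ∀ f g, (∀ i, c i f = c i g) → f = g) (h3 : ∀ f, {i | c i f ≠ 0}.Finite) :
    ∃ b : Module.Basis ι R M, ⇑b = e ∧ ∀ i f, b.repr f i = c i f := by
  have hli : LinearIndependent R e := linearIndependent_iff'.2 fun s g hg i hi => by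
    have := congrArg (c i) hg
    rw [map_sum, map_zero] at this
    simpa [h1, hi] using this
  have hspan : ⊤ ≤ Submodule.span R (Set.range e) := fun f _ => by
    have : f = ∑ i ∈ (h3 f).toFinset, c i f • e i := h2 _ _ fun i => by
      rw [map_sum]
      simp only [map_smul, h1, smul_eq_mul, mul_ite, mul_one, mul_zero, Finset.sum_ite_eq]
      split_ifs with h
      · rfl
      · by_contra h0
        exact h ((h3 f).mem_toFinset.2 h0)
    rw [this]
    exact sum_mem fun i _ => Submodule.smul_mem _ _ (Submodule.subset_span ⟨i, rfl⟩)
  refine ⟨Module.Basis.mk hli hspan, Module.Basis.coe_mk _ _, fun i f => ?_⟩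
  have : (Module.Basis.mk hli hspan).coord i = c i := (Module.Basis.mk hli hspan).ext fun j => by
    rw [Module.Basis.coord_apply, Module.Basis.repr_self, Module.Basis.mk_apply, h1,
      Finsupp.single_apply]
    exact if_congr eq_comm rfl rfl
  exact LinearMap.congr_fun this f

/-- A family that is unitriangular with respect to a basis is a basis. -/
theorem exists_basis_of_triangular {ι R M : Type*} [CommRing R] [AddCommGroup M]
    [Module R M] (b : Module.Basis ι R M) (e : ι → M) (l : ι → ℕ) (h1 : ∀ i, b.repr (e i) i = 1)
    (h2 : ∀ i j, b.repr (e i) j ≠ 0 → j ≠ i → l j < l i) :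
    ∃ b' : Module.Basis ι R M, ⇑b' = e := by
  classical
  have hli : LinearIndependent R e := linearIndependent_iff'.2 fun s g hg => by
    by_contra! hc
    obtain ⟨i₀, hi₀, hg₀⟩ := hc
    -- At an index of maximal `l` among the nonzero coefficients, no other term of the relation
    -- contributes.
    obtain ⟨i, hi, hmax⟩ := (s.filter fun i => g i ≠ 0).exists_max_image l
      ⟨i₀, Finset.mem_filter.2 ⟨hi₀, hg₀⟩⟩
    rw [Finset.mem_filter] at hi
    have := congrArg (b.coord i) hg
    rw [map_sum, map_zero, Finset.sum_eq_single i] at this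
    · rw [map_smul, Module.Basis.coord_apply, h1, smul_eq_mul, mul_one] at this
      exact hi.2 this
    · intro j hj hji
      rw [map_smul, Module.Basis.coord_apply, smul_eq_mul]
      by_cases hgj : g j = 0
      · rw [hgj, zero_mul]
      · by_contra h0
        have h3 := h2 j i (fun h => h0 (by rw [h, mul_zero])) hji.symm
        have h4 := hmax j (Finset.mem_filter.2 ⟨hj, hgj⟩)
        omega
    · intro h; exact absurd hi.1 h
  have hb : ∀ i, b i ∈ Submodule.span R (Set.range e) := fun i => by
    induction hN : l i using Nat.strong_induction_on generalizing i with
    | _ N ih =>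
      subst hN
      have h3 : e i = ∑ j ∈ insert i (b.repr (e i)).support, b.repr (e i) j • b j := by
        conv_lhs => rw [← b.linearCombination_repr (e i), Finsupp.linearCombination_apply]
        exact Finsupp.sum_of_support_subset _ (Finset.subset_insert _ _) _ fun j _ => zero_smul _ _
      rw [← Finset.add_sum_erase _ _ (Finset.mem_insert_self i _), h1, one_smul,
        ← sub_eq_iff_eq_add] at h3
      rw [← h3]
      refine sub_mem (Submodule.subset_span ⟨i, rfl⟩) (sum_mem fun j hj => ?_)
      rw [Finset.mem_erase] at hj
      by_cases h0 : b.repr (e i) j = 0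
      · rw [h0, zero_smul]; exact zero_mem _
      · exact Submodule.smul_mem _ _ (ih _ (h2 i j h0 hj.1) j rfl)
  exact ⟨Module.Basis.mk hli (by
    rw [← b.span_eq, Submodule.span_le]
    rintro _ ⟨i, rfl⟩
    exact hb i), Module.Basis.coe_mk _ _⟩

theorem exists_basis_eElt (n r : ℕ) [NeZero n] [NeZero r] : ∃ b : Module.Basis (Theta n r) Zv (Schur n r), ⇑b = eElt := by
  classical
  obtain ⟨b, hb, -⟩ := exists_basis_of_dual (M := Schur n r) eElt ecoef ecoef_eElt (fun _ _ => schur_ext_ecoef)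
    finite_ecoef_ne_zero
  exact ⟨b, hb⟩

theorem exists_basis_brk (n r : ℕ) [NeZero n] [NeZero r] : ∃ b : Module.Basis (Theta n r) Zv (Schur n r), ⇑b = brk ∧
    ∀ A f, b.repr f A = bcoef A f := by
  classical
  exact exists_basis_of_dual (M := Schur n r) brk bcoef bcoef_brk (fun _ _ => schur_ext_bcoef) finite_bcoef_ne_zero

theorem eq_sum_bcoef (f : Schur n r) {s : Finset (Theta n r)} (hs : {A | bcoef A f ≠ 0} ⊆ s) :
    f = ∑ A ∈ s, bcoef A f • brk A := by
  classical
  refine schur_ext_bcoef fun A => ?_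
  rw [map_sum]
  simp only [map_smul, bcoef_brk, smul_eq_mul, mul_ite, mul_one, mul_zero, Finset.sum_ite_eq]
  split_ifs with h
  · rfl
  · by_contra h0
    exact h (hs h0)

/-! ### The elements `θ` form the canonical basis. -/

/-- The element `θ` attached to a matrix. -/
def thetaElt (A : Theta n r) : Schur n r :=
  thetaHom (triple A).la (triple A).d (triple A).mu

theorem sval_thetaElt (A : Theta n r) (ka nu : Wt n r) : sval ka nu (thetaElt A) =
    if nu = (triple A).mu ∧ ka = (triple A).la
    then thetaVal (triple A).la (triple A).d (triple A).mu else 0 :=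
  sval_schurHom (leftInv_thetaVal _ _ _) (rightInv_thetaVal _ _ _) ka nu

theorem dNum_eq (A : Theta n r) : (dNum A : ℤ) = len (yPlus A) - len (wZero (triple A).mu) := by
  have := dNum_add_len_wZero (triple A)
  rw [jMap_triple] at this
  rw [yPlus, ← this]
  push_cast; ring

/-- The value of `θ` is constant on double cosets, so the coordinate at `y_B` may be taken at
`y_B⁺`. There the powers `d_B`, `ℓ(w_{0,mu})` and `-ℓ(y_B⁺)` add up to zero. -/
theorem bcoef_thetaElt (A B : Theta n r) : bcoef B (thetaElt A) =
    if (triple B).mu = (triple A).mu ∧ (triple B).la = (triple A).la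
    then coef (yPlus B) (klC (yPlus A)) else 0 := by
  rw [bcoef_apply, ecoef_apply, sval_thetaElt]
  split_ifs with h
  · have hB := (isLongest_yPlus B).1
    rw [h.1, h.2] at hB
    rw [yRep, ← tcoef_eq_of_mem_dblCoset (leftInv_thetaVal _ _ _) (rightInv_thetaVal _ _ _) hB,
      thetaVal, map_smul, smul_eq_mul, ← yPlus, tcoef_eq_coef, ← mul_assoc, ← mul_assoc,
      ← vpow_add, ← vpow_add, dNum_eq, h.1]
    rw [show (len (yPlus B) : ℤ) - len (wZero (triple A).mu) + len (wZero (triple A).mu) +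
      -(len (yPlus B) : ℤ) = 0 by ring, vpow_zero, one_mul]
  · rw [map_zero, mul_zero]

/-- For fixed row and column sums the longest element determines the double coset, hence the
representative and the matrix. -/
theorem yPlus_injOn {A B : Theta n r} (hmu : (triple B).mu = (triple A).mu)
    (hla : (triple B).la = (triple A).la) (h : yPlus B = yPlus A) : B = A := by
  have h1 := (isLongest_yPlus B).1
  have h2 := (isLongest_yPlus A).1
  have hd := (triple B).mem
  rw [hmu, hla, h] at h1
  rw [hmu, hla] at hd
  refine triple_injective (Triple.ext' hla hmu (eq_of_mem_dblReps (triple A).mem hd ?_))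
  rw [← dblCoset_eq_of_mem h2, dblCoset_eq_of_mem h1]
  exact self_mem_dblCoset _ _ _

theorem bcoef_thetaElt_self (A : Theta n r) : bcoef A (thetaElt A) = 1 := by
  rw [bcoef_thetaElt, if_pos ⟨rfl, rfl⟩, (isKL_klC _).one]

theorem bcoef_thetaElt_of_ne {A B : Theta n r} (h : bcoef B (thetaElt A) ≠ 0) (hne : B ≠ A) :
    SqLT B A ∧ len (yPlus B) < len (yPlus A) := by
  rw [bcoef_thetaElt] at h
  split_ifs at h with he
  · have hle := (isKL_klC _).le _ h
    refine ⟨sqLT_of_bruhatLE ?_ ?_ hne hle, hle.len_lt fun e => hne (yPlus_injOn he.1 he.2 e)⟩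
    · rw [ro_eq, ro_eq, he.2]
    · rw [co_eq, co_eq, he.1]
  · exact absurd rfl h

theorem bcoef_thetaElt_mem {A B : Theta n r} (hne : B ≠ A) :
    bcoef B (thetaElt A) ∈ expIn {m | m < 0} := by
  rw [bcoef_thetaElt]
  split_ifs with he
  · exact (isKL_klC _).neg _ fun e => hne (yPlus_injOn he.1 he.2 e)
  · exact zero_mem _

theorem exists_basis_thetaElt :
    ∃ b : Module.Basis (Theta n r) Zv (Schur n r), ⇑b = thetaElt := by
  obtain ⟨b, -, hb⟩ := exists_basis_brk n r
  refine exists_basis_of_triangular (M := Schur n r) b thetaElt (fun A => len (yPlus A)) (fun A => ?_)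
    fun A B h hne => ?_
  · rw [hb, bcoef_thetaElt_self]
  · rw [hb] at h
    exact (bcoef_thetaElt_of_ne h hne).2

theorem isSchurBar_iff {f g : Schur n r} : IsSchurBar f g ↔ ∀ la mu,
    vpow (-(len (wZero mu) : ℤ)) • sval la mu g =
      heckeBar r (vpow (-(len (wZero mu) : ℤ)) • sval la mu f) := by
  constructor
  · intro H la mu
    have := H mu 1 la
    rwa [coe_apply_gen, coe_apply_gen, mul_one, mul_one, mul_one] at this
  · intro H mu h la
    rw [coe_apply_gen, coe_apply_gen, mul_one, ← H, smul_mul_assoc]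

theorem isSchurBar_thetaElt (A : Theta n r) : IsSchurBar (thetaElt A) (thetaElt A) := by
  refine isSchurBar_iff.2 fun la mu => ?_
  rw [sval_thetaElt]
  split_ifs with h
  · rw [thetaVal, smul_smul, ← h.1, vpow_neg_mul, one_smul, (isKL_klC _).bar]
  · rw [smul_zero, map_zero]

/-- The lattice of negative powers of `v` times elements `[B]` with `B` below `A`. -/
def negSpan (A : Theta n r) : Submodule ℤ (Schur n r) := Submodule.span ℤ
  {x : Schur n r | ∃ B, SqLT B A ∧ ∃ k : ℕ, 1 ≤ k ∧ x = vpow (-(k : ℤ)) • brk B}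

theorem smul_brk_mem_negSpan {A B : Theta n r} (h : SqLT B A) {c : Zv}
    (hc : c ∈ expIn {m | m < 0}) : c • brk B ∈ negSpan A := by
  rw [sum_single_coeff c, Finset.sum_smul]
  refine sum_mem fun m hm => ?_
  have hm0 : m < 0 := by
    by_contra h0
    exact Finsupp.mem_support_iff.1 hm (hc m h0)
  rw [smul_assoc]
  refine Submodule.smul_mem _ _ (Submodule.subset_span ⟨B, h, m.natAbs, by omega, ?_⟩)
  rw [show -(m.natAbs : ℤ) = m by omega]

theorem bcoef_mem_of_mem_negSpan {A : Theta n r} {f : Schur n r} (h : f ∈ negSpan A)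
    (B : Theta n r) : bcoef B f ∈ expIn {m | m < 0} := by
  classical
  induction h using Submodule.span_induction with
  | mem x hx =>
    obtain ⟨C, -, k, hk, rfl⟩ := hx
    rw [map_smul, bcoef_brk]
    split_ifs
    · rw [smul_eq_mul, mul_one]
      refine vpow_mem_expIn ?_
      simp only [Set.mem_ofPred_eq]
      omega
    · rw [smul_zero]; exact zero_mem _
  | zero => rw [map_zero]; exact zero_mem _
  | add x y _ _ hx hy => rw [map_add]; exact add_mem hx hy
  | smul z x _ hx =>
    have e : bcoef B (z • x) = z • bcoef B x := by
      change vpow _ * tcoef _ (z • sval _ _ x) = z • (vpow _ * tcoef _ (sval _ _ x))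
      rw [map_zsmul, mul_smul_comm]
    rw [e]
    exact zsmul_mem hx z

theorem thetaElt_sub_brk_mem (A : Theta n r) : thetaElt A - brk A ∈ negSpan A := by
  classical
  have h := eq_sum_bcoef (thetaElt A) (s := insert A (finite_bcoef_ne_zero (thetaElt A)).toFinset)
    (by simp)
  rw [← Finset.add_sum_erase _ _ (Finset.mem_insert_self A _), bcoef_thetaElt_self, one_smul] at h
  have h' := sub_eq_of_eq_add' (G := Schur n r) h
  rw [h']
  refine sum_mem fun B hB => ?_
  rw [Finset.mem_erase] at hB
  by_cases h0 : bcoef B (thetaElt A) = 0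
  · rw [h0, zero_smul]; exact zero_mem _
  · exact smul_brk_mem_negSpan (bcoef_thetaElt_of_ne h0 hB.1).1 (bcoef_thetaElt_mem hB.1)

theorem isCanonicalBasis_thetaElt : IsCanonicalBasis (thetaElt : Theta n r → Schur n r) :=
  ⟨exists_basis_thetaElt, isSchurBar_thetaElt, thetaElt_sub_brk_mem⟩

/-- A bar-invariant element with all coefficients in `v⁻¹ ℤ[v⁻¹]` vanishes. -/
theorem eq_zero_of_isSchurBar {f : Schur n r} (hb : IsSchurBar f f)
    (hn : ∀ B, bcoef B f ∈ expIn {m | m < 0}) : f = 0 := by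
  refine schur_ext fun la mu => ?_
  have h0 : vpow (-(len (wZero mu) : ℤ)) • sval la mu f = 0 := by
    refine eq_zero_of_heckeBar_eq (isSchurBar_iff.1 hb la mu).symm fun w => ?_
    obtain ⟨d, hd, hmin⟩ := exists_minimal la mu w
    set t : Triple n r := ⟨la, d, mu, mem_dblReps_of_minimal hd hmin⟩
    have hL := isLongest_dPlus la mu d
    have hw : w ∈ dblCoset la d mu := by
      rw [dblCoset_eq_of_mem hd]
      exact self_mem_dblCoset la mu w
    have h1 := hn (jMap t)
    have h2 := dNum_add_len_wZero t
    rw [bcoef_apply, ecoef_apply, yRep, triple_jMap] at h1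
    rw [map_smul, smul_eq_mul, coef_eq_tcoef,
      tcoef_eq_of_mem_dblCoset (leftInv_sval la mu f) (rightInv_sval la mu f) hw]
    -- Compared with the coefficient of `[A]`, the normalized coordinate at `w` carries the extra
    -- factor `v ^ (ℓ(w) - ℓ(d⁺))`, whose exponent is at most zero. Negativity therefore holds on
    -- the whole double coset, not only at its longest element.
    have h3 : vpow (-(len (wZero mu) : ℤ)) * (vpow (len w) * tcoef d (sval la mu f)) =
        vpow ((len w : ℤ) - len (dPlus la d mu)) *
          (vpow (dNum (jMap t)) * tcoef d (sval la mu f)) := by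
      rw [← mul_assoc, ← mul_assoc, ← vpow_add, ← vpow_add]
      congr 2
      have h4 : dNum (jMap t) + len (wZero mu) = len (dPlus la d mu) := h2
      omega
    rw [h3]
    refine vpow_mul_mem_expIn h1 fun m hm => ?_
    have := hL.2 w hw
    simp only [Set.mem_ofPred_eq] at hm ⊢
    omega
  have := congrArg (vpow (len (wZero mu)) • ·) h0
  rwa [smul_smul, vpow_mul_neg, one_smul, smul_zero] at this

/-- The difference of two candidates at `A` is bar-invariant with coefficients in `v⁻¹ ℤ[v⁻¹]`;
neither the order on matrices nor the basis property enters. -/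
theorem IsCanonicalBasis.unique {θ θ' : Theta n r → Schur n r} (h : IsCanonicalBasis θ)
    (h' : IsCanonicalBasis θ') : θ = θ' := by
  funext A
  refine sub_eq_zero.1 (eq_zero_of_isSchurBar (isSchurBar_iff.2 fun la mu => ?_) fun B => ?_)
  · rw [map_sub, smul_sub, map_sub, ← isSchurBar_iff.1 (h.2.1 A), ← isSchurBar_iff.1 (h'.2.1 A)]
  · have e : bcoef B (θ A - θ' A) = bcoef B (θ A - brk A) - bcoef B (θ' A - brk A) := by
      rw [bcoef_sub, bcoef_sub, bcoef_sub, sub_sub_sub_cancel_right]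
    rw [e]
    exact sub_mem (bcoef_mem_of_mem_negSpan (h.2.2 A) B) (bcoef_mem_of_mem_negSpan (h'.2.2 A) B)

theorem canonicalBasis_eq : canonicalBasis n r = thetaElt :=
  (Classical.epsilon_spec ⟨_, isCanonicalBasis_thetaElt⟩ : IsCanonicalBasis _).unique
    isCanonicalBasis_thetaElt

theorem thetaElt_eq_finsum (A : Theta n r) : thetaElt A = ∑ᶠ (B : Theta n r) (_ : BoLE B A),
    (vpow ((len (yPlus B) : ℤ) - len (yPlus A)) * klP (yPlus B) (yPlus A)) • brk B := by
  classical
  have key : ∀ B, (∑ᶠ _ : BoLE B A,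
      (vpow ((len (yPlus B) : ℤ) - len (yPlus A)) * klP (yPlus B) (yPlus A)) • brk B) =
      bcoef B (thetaElt A) • brk B := by
    intro B
    rw [bcoef_thetaElt, ← coef_klC]
    by_cases h : BoLE B A
    · rw [finsum_eq_if, if_pos h, if_pos ⟨triple_mu_eq h.2.1, triple_la_eq h.1⟩]
    -- Outside the range of summation the coefficient vanishes: a nonzero one would give `y_B⁺ ≤
    -- y_A⁺` with equal row and column sums, hence `BoLE B A`.
    · rw [finsum_eq_if, if_neg h]
      split_ifs with he
      · by_contra h0
        refine h (boLE_of_bruhatLE ?_ ?_ ((isKL_klC _).le _ fun h1 => h0 ?_))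
        · rw [ro_eq, ro_eq, he.2]
        · rw [co_eq, co_eq, he.1]
        · rw [h1, zero_smul]
      · rw [zero_smul]
  rw [finsum_congr key, finsum_eq_sum_of_support_subset
    (s := (finite_bcoef_ne_zero (thetaElt A)).toFinset)]
  · exact eq_sum_bcoef _ (by simp)
  · intro B hB
    rw [Set.Finite.coe_toFinset]
    intro h0
    exact hB (by simp only [h0, zero_smul])

theorem wellDefined (n r : ℕ) [NeZero n] [NeZero r] : WellDefined n r :=
  ⟨⟨basisTT r, funext basisTT_apply⟩, existsUnique_isHeckeBar r, existsUnique_isKLRow,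
    existsUnique_isLongest_young, jMap_bijective, fun _ =>
      ⟨existsUnique_isLongest_dblCoset _ _ _,
        existsUnique_actsBy (leftInv_dblSum _ _ _) (rightInv_dblSum _ _ _),
        existsUnique_actsBy (leftInv_thetaVal _ _ _) (rightInv_thetaVal _ _ _)⟩,
    exists_basis_eElt n r, ⟨thetaElt, isCanonicalBasis_thetaElt, fun _ h =>
      h.unique isCanonicalBasis_thetaElt⟩⟩

end SchurAlgebra

end AffSchur

end

theorem proposition3p8 (n r : ℕ) [NeZero n] [NeZero r] :
    AffSchur.WellDefined n r ∧
    ∀ (la mu : AffSchur.Wt n r) (d : AffSchur.AffSym r) (hd : d ∈ AffSchur.dblReps la mu)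
      (A : AffSchur.Theta n r), A = AffSchur.jMap ⟨la, d, mu, hd⟩ →
      AffSchur.thetaHom la d mu = AffSchur.canonicalBasis n r A ∧
      AffSchur.canonicalBasis n r A =
        ∑ᶠ (B : AffSchur.Theta n r) (_ : AffSchur.BoLE B A),
          (AffSchur.vpow ((AffSchur.len (AffSchur.yPlus B) : ℤ) -
              AffSchur.len (AffSchur.yPlus A)) *
            AffSchur.klP (AffSchur.yPlus B) (AffSchur.yPlus A)) • AffSchur.brk B := by
  refine ⟨AffSchur.wellDefined n r, fun la mu d hd A hA => ?_⟩
  rw [AffSchur.canonicalBasis_eq]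
  refine ⟨?_, AffSchur.thetaElt_eq_finsum A⟩
  rw [hA, AffSchur.thetaElt, AffSchur.triple_jMap]
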